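/- Let $N\ge 2$ be even, $M\ge 1$, and $0=t_0<t_1<\dots<t_M<t_{M+1}=T<\infty$. **The process.** Put $p_t(x,y)=\frac{1}{\sqrt{2\pi t}}e^{-(x-y)^2/2t}$ for $t>0$ and $p_0(y,x)\,dy=\delta_x(dy)$; $\mathbf R^N_<=\{x_1<\dots<x_N\}$; $h_N(\mathbf x)=\prod_{i<j}(x_j-x_i)$; $f_N(t,\mathbf x,\mathbf y)=\det_{1\le i,j\le N}(p_t(x_i,y_j))$; $\mathcal N_N(t,\mathbf x)=\int_{\mathbf R^N_<}f_N(t,\mathbf x,\mathbf y)\,d\mathbf y$ for $t>0$ and $\mathcal N_N(0,\mathbf x)=1$. The system of $N$ Brownian particles started from the origin and conditioned not to collide during $[0,T]$ has the transition densities $$g_N^T(s,\mathbf x;t,\mathbf y)=\frac{f_N(t-s,\mathbf x,\mathbf y)\,\mathcal N_N(T-t,\mathbf y)}{\mathcal N_N(T-s,\mathbf x)}\quad(0<s<t\le T),$$ $$g_N^T(0,\mathbf 0;t,\mathbf y)=C(N,T,t)\,h_N(\mathbf y)\,\mathcal N_N(T-t,\mathbf y)\prod_{i=1}^N p_t(0,y_i),\qquad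 C(N,T,t)=\frac{\pi^{N/2}\,T^{N(N-1)/4}\,t^{-N(N-1)/2}}{\prod_{j=1}^N\Gamma(j/2)},$$ for $\mathbf x,\mathbf y\in\mathbf R^N_<$. For finite sets $\xi,\eta\subset\mathbf R$ let $\tilde g_N^T(s,\xi;t,\eta)$ be $g_N^T$ evaluated at the increasing enumerations of $\xi,\eta$ if $s>0$ and $\sharp\xi=\sharp\eta=N$; let it be $g_N^T(0,\mathbf 0;t,\cdot)$ at the increasing enumeration of $\eta$ if $s=0$, $\xi=\{0\}$, $\sharp\eta=N$; and let it be $0$ otherwise. The multitime density is $$\rho_N^T(t_1,\xi_1;\dots;t_{M+1},\xi_{M+1})=\prod_{m=0}^{M}\tilde g_N^T(t_m,\xi_m;t_{m+1},\xi_{m+1}),\qquad \xi_0=\{0\}.$$ Let $1\le N_m\le N$ for $1\le m\le M+1$. For $x^{(m)}_1<\dots<x^{(m)}_{N_m}$, with $\xi_m^{N_m}=\{x_1^{(m)},\dots,x_{N_m}^{(m)}\}$, the $(N_1,\dots,N_{M+1})$-multitime correlation function is $$\rho_N^T(t_1,\xi_1^{N_1};\dots;t_{M+1},\xi_{M+1}^{N_{M+1}})=\int\prod_{m=1}^{M+1}\frac{1}{(N-N_m)!}\prod_{i=N_m+1}^{N}dx_i^{(m)}\;\rho_N^T\big(t_1,\{x^{(1)}_1,\dots,x^{(1)}_N\};\dots;t_{M+1},\{x^{(M+1)}_1,\dots,x^{(M+1)}_N\}\big),$$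 the integral being over $\prod_{m}\mathbf R^{N-N_m}$. **The kernels.** Let $H_j$ be the Hermite polynomials ($H_0=1$, $H_{j+1}=2xH_j-H_j'$), $c_1=\sqrt{t_1(2T-t_1)/T}$, $z_1=\sqrt{(2T-t_1)/t_1}$, $$R_k(x)=z_1^{-k}\sum_{j=0}^k\alpha_{kj}H_j\Big(\frac{x}{c_1}\Big)z_1^j,\qquad \alpha_{kj}=\begin{cases}2^{-k}c_1^k\,\delta_{kj},&k\text{ even},\\ 2^{-k}c_1^k\{\delta_{kj}-2(k-1)\delta_{k-2\,j}\},&k\text{ odd},\end{cases}$$ $$r_j=\frac{\Gamma(j+\frac12)\Gamma(j+1)}{\pi}\Big(\frac{t_1^2}{T}\Big)^{2j+1/2}.$$ For $1\le m,n\le M+1$ put $$F^{m,n}(x,y)=\int_{-\infty}^{\infty}dw\int_{-\infty}^{w}dz\begin{vmatrix}p_{T-t_m}(x,z)&p_{T-t_m}(x,w)\\p_{T-t_n}(y,z)&p_{T-t_n}(y,w)\end{vmatrix},$$ $$R_k^{(m)}(x)=\int_{\mathbf R}dy\,R_k(y)p_{t_1}(0,y)p_{t_m-t_1}(y,x),\qquad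 \Phi_k^{(m)}(x)=\int_{\mathbf R}dy\,R_k^{(m)}(y)F^{m,m}(y,x),$$ $$D^{m,n}(x,y)=\sum_{k=0}^{N/2-1}\frac1{r_k}\big[R^{(m)}_{2k}(x)R^{(n)}_{2k+1}(y)-R^{(m)}_{2k+1}(x)R^{(n)}_{2k}(y)\big],$$ $$\tilde I^{m,n}(x,y)=-\sum_{k=0}^{N/2-1}\frac1{r_k}\big[\Phi^{(m)}_{2k}(x)\Phi^{(n)}_{2k+1}(y)-\Phi^{(m)}_{2k+1}(x)\Phi^{(n)}_{2k}(y)\big]+F^{m,n}(x,y),$$ $$\tilde S^{m,n}(x,y)=\sum_{k=0}^{N/2-1}\frac1{r_k}\big[\Phi^{(m)}_{2k}(x)R^{(n)}_{2k+1}(y)-\Phi^{(m)}_{2k+1}(x)R^{(n)}_{2k}(y)\big]-p_{t_n-t_m}(x,y)\mathbf 1(m<n).$$ **Quaternions.** Consider quaternions $q=q_0+q_1e_1+q_2e_2+q_3e_3$ with complex coefficients, with the matrix representation $$C(1)=\begin{pmatrix}1&0\\0&1\end{pmatrix},\quad C(e_1)=\begin{pmatrix}0&-1\\1&0\end{pmatrix},\quad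 C(e_2)=\begin{pmatrix}0&-\sqrt{-1}\\-\sqrt{-1}&0\end{pmatrix},\quad C(e_3)=\begin{pmatrix}\sqrt{-1}&0\\0&-\sqrt{-1}\end{pmatrix},$$ and the dual $q^\dagger=q_0-q_1e_1-q_2e_2-q_3e_3$. A quaternion matrix is self-dual if $q_{ji}^\dagger=q_{ij}$ for all $i,j$. For a self-dual $n\times n$ matrix, $$\mathrm{Tdet}\,Q=\sum_{\pi\in S_n}(-1)^{n-\ell(\pi)}\prod_{1}^{\ell(\pi)}q_{ab}q_{bc}\cdots q_{da},$$ where $\ell(\pi)$ is the number of cycles $(a\to b\to c\to\dots\to d\to a)$ of $\pi$ (each cycle is started at its smallest element, and the cycle products are multiplied in increasing order of these elements). Let $q^{m,n}(x,y)$ be the quaternion with $$C(q^{m,n}(x,y))=\begin{pmatrix}\tilde S^{m,n}(x,y)&\tilde I^{m,n}(x,y)\\D^{m,n}(x,y)&\tilde S^{n,m}(y,x)\end{pmatrix},$$ and let $Q$ be the $\sum_mN_m\times\sum_mN_m$ quaternion matrix with entries $q^{m,n}(x_i^{(m)},x_j^{(n)})$, $1\le i\le N_m$, $1\le j\le N_n$,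 $1\le m,n\le M+1$, arranged in blocks indexed by $(m,n)$. **Theorem 3.** The matrix $Q$ is self-dual, the integral defining the correlation function converges absolutely, and $$\rho_N^T\big(t_1,\xi_1^{N_1};\dots;t_{M+1},\xi_{M+1}^{N_{M+1}}\big)=\mathrm{Tdet}\,Q\big(\mathbf x^{(1)}_{N_1},\mathbf x^{(2)}_{N_2},\dots,\mathbf x^{(M+1)}_{N_{M+1}}\big).$$ -/

import Mathlib

open MeasureTheory ProbabilityTheory
open scoped Quaternion Nat

namespace NonColliding

noncomputable section

/-! ### Complex quaternions, self-dual matrices and Dyson's determinant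

Quaternions with complex coefficients are `ℍ[ℂ]`, with `e₁, e₂, e₃` the units `i, j, k`.  The dual
`q₀ - q₁ e₁ - q₂ e₂ - q₃ e₃` is `star q`: the complex coefficients are not conjugated. -/

theorem star_eq_dual (q : ℍ[ℂ]) : star q = ⟨q.re, -q.imI, -q.imJ, -q.imK⟩ := by
  ext <;> simp

/-- The `2 × 2` matrix representation `C` of the complex quaternions. -/
def matrixRep (q : ℍ[ℂ]) : Matrix (Fin 2) (Fin 2) ℂ :=
  q.re • !![1, 0; 0, 1] + q.imI • !![0, -1; 1, 0]
    + q.imJ • !![0, -Complex.I; -Complex.I, 0] + q.imK • !![Complex.I, 0; 0, -Complex.I]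

/-- The quaternion whose matrix representation is the given matrix
(see `matrixRep_ofMatrix` and `matrixRep_injective`). -/
def ofMatrix (A : Matrix (Fin 2) (Fin 2) ℂ) : ℍ[ℂ] :=
  ⟨(A 0 0 + A 1 1) / 2, (A 1 0 - A 0 1) / 2,
    Complex.I * (A 0 1 + A 1 0) / 2, Complex.I * (A 1 1 - A 0 0) / 2⟩

theorem matrixRep_ofMatrix (A : Matrix (Fin 2) (Fin 2) ℂ) : matrixRep (ofMatrix A) = A := by
  have hI : Complex.I * Complex.I = -1 := Complex.I_mul_I
  ext i j
  fin_cases i <;> fin_cases j <;> simp [matrixRep, ofMatrix]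
  · linear_combination (A 1 1 - A 0 0) / 2 * hI
  · linear_combination (-(A 0 1 + A 1 0) / 2) * hI
  · linear_combination (-(A 0 1 + A 1 0) / 2) * hI
  · linear_combination (-(A 1 1 - A 0 0) / 2) * hI

theorem ofMatrix_matrixRep (q : ℍ[ℂ]) : ofMatrix (matrixRep q) = q := by
  have hI : Complex.I * Complex.I = -1 := Complex.I_mul_I
  ext <;> simp [matrixRep, ofMatrix]
  · ring
  · linear_combination (-q.imJ) * hI
  · linear_combination (-q.imK) * hI

theorem matrixRep_injective : Function.Injective matrixRep :=
  Function.LeftInverse.injective ofMatrix_matrixRep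

/-- A quaternion matrix is self-dual if it equals its dual matrix `(star q_{ji})_{ij}`. -/
def IsSelfDual {k : ℕ} (Q : Matrix (Fin k) (Fin k) ℍ[ℂ]) : Prop :=
  ∀ i j, star (Q j i) = Q i j

/-- The ordered product `q_{ab} q_{bc} ⋯ q_{da}` along the cycle
`a → b = π a → c = π b → ⋯ → d → a` of the permutation `π`, started at `a`. -/
def cycleProd {k : ℕ} (Q : Matrix (Fin k) (Fin k) ℍ[ℂ]) (π : Equiv.Perm (Fin k)) (a : Fin k) :
    ℍ[ℂ] :=
  ((List.range (Function.minimalPeriod π a)).map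
    fun l => Q ((π ^ l) a) ((π ^ (l + 1)) a)).prod

open Classical in
/-- One representative, the smallest element, of each cycle of `π` (fixed points are cycles). -/
def cycleReps {k : ℕ} (π : Equiv.Perm (Fin k)) : Finset (Fin k) :=
  Finset.univ.filter fun a => ∀ b, π.SameCycle a b → a ≤ b

/-- Dyson's quaternion determinant
`Tdet Q = ∑_π (-1)^{k - ℓ(π)} ∏_{cycles} q_{ab} q_{bc} ⋯ q_{da}`, where `ℓ(π)` is the number of
cycles of `π`.  Quaternions do not commute, so a starting point of every cycle and an order of the
cycles have to be fixed: cycles start at their smallest elements and are multiplied in increasing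
order of these.  (For a self-dual matrix the sum is the same for all choices of starting points and
of the order that depend only on the underlying sets of the cycles.) -/
def Tdet {k : ℕ} (Q : Matrix (Fin k) (Fin k) ℍ[ℂ]) : ℍ[ℂ] :=
  ∑ π : Equiv.Perm (Fin k),
    (-1) ^ (k - (cycleReps π).card) * (((cycleReps π).sort (· ≤ ·)).map (cycleProd Q π)).prod

/-! ### The non-colliding Brownian motions started from the origin -/

/-- The heat kernel `p_t(x, y)`. -/
def heat (t x y : ℝ) : ℝ :=
  1 / Real.sqrt (2 * Real.pi * t) * Real.exp (-(x - y) ^ 2 / (2 * t))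

/-- The measure `p_t(y, x) dy = p_t(x, y) dy`, for `t ≥ 0`: it is the Gaussian law of mean `x` and
variance `t`, which is the unit mass at `x` if `t = 0`. -/
def heatMeasure (t x : ℝ) : Measure ℝ := gaussianReal x t.toNNReal

/-- The Weyl chamber `x₁ < x₂ < ⋯ < x_N`. -/
def weylChamber (N : ℕ) : Set (Fin N → ℝ) := {x | StrictMono x}

/-- The Vandermonde product `h_N(x) = ∏_{i < j} (x_j - x_i)`. -/
def vandermondeProd {N : ℕ} (x : Fin N → ℝ) : ℝ := ∏ i, ∏ j ∈ Finset.Ioi i, (x j - x i)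

/-- The transition density `f_N(t, x, y)` of the absorbing Brownian motion in the Weyl chamber. -/
def absorbedDensity {N : ℕ} (t : ℝ) (x y : Fin N → ℝ) : ℝ :=
  Matrix.det (Matrix.of fun i j => heat t (x i) (y j))

/-- The probability `𝒩_N(t, x)` that Brownian motion started at `x` in the Weyl chamber does not hit
the boundary up to time `t`; it is `1` for `t = 0`. -/
def survivalProb {N : ℕ} (t : ℝ) (x : Fin N → ℝ) : ℝ :=
  if t = 0 then 1 else ∫ y in weylChamber N, absorbedDensity t x y

/-- The transition density `g_N^T(s, x; t, y)` of the non-colliding Brownian motions. -/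
def transDensity {N : ℕ} (T s : ℝ) (x : Fin N → ℝ) (t : ℝ) (y : Fin N → ℝ) : ℝ :=
  absorbedDensity (t - s) x y * survivalProb (T - t) y / survivalProb (T - s) x

/-- The constant `C(N, T, t)`. -/
def originConst (N : ℕ) (T t : ℝ) : ℝ :=
  Real.pi ^ ((N : ℝ) / 2) * (∏ j ∈ Finset.Icc 1 N, Real.Gamma ((j : ℝ) / 2))⁻¹
    * T ^ ((N : ℝ) * ((N : ℝ) - 1) / 4) * t ^ (-((N : ℝ) * ((N : ℝ) - 1) / 2))

/-- The transition density `g_N^T(0, 0; t, y)` from the origin. -/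
def originDensity {N : ℕ} (T t : ℝ) (y : Fin N → ℝ) : ℝ :=
  originConst N T t * vandermondeProd y * survivalProb (T - t) y * ∏ i, heat t 0 (y i)

/-- The configuration `γ(x) = {x_i}`. -/
def config {k : ℕ} (x : Fin k → ℝ) : Finset ℝ := Finset.univ.image x

open Classical in
/-- The transition density `g̃_N^T(s, ξ; t, η)` of the process of unlabelled particles;
`Finset.orderEmbOfFin` lists the points of a configuration in increasing order. -/
def configTransDensity (N : ℕ) (T s : ℝ) (ξ : Finset ℝ) (t : ℝ) (η : Finset ℝ) : ℝ :=
  if h : 0 < s ∧ ξ.card = N ∧ η.card = N then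
    transDensity T s (ξ.orderEmbOfFin h.2.1) t (η.orderEmbOfFin h.2.2)
  else if h : s = 0 ∧ ξ = {0} ∧ η.card = N then
    originDensity T t (η.orderEmbOfFin h.2.2)
  else 0

/-! In what follows `t : Fin (M + 2) → ℝ` lists the times
`0 = t₀ < t₁ < ⋯ < t_M < t_{M+1} = T`, and `m : Fin (M + 1)` stands for the time `t m.succ`. -/

/-- The final time `T = t_{M+1}`. -/
def finalTime {M : ℕ} (t : Fin (M + 2) → ℝ) : ℝ := t (Fin.last (M + 1))

/-- The multitime transition density
`ρ_N^T(t₁, ξ₁; …; t_{M+1}, ξ_{M+1}) = ∏_{m=0}^{M} g̃_N^T(t_m, ξ_m; t_{m+1}, ξ_{m+1})`, `ξ₀ = {0}`. -/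
def multitimeDensity (N : ℕ) {M : ℕ} (t : Fin (M + 2) → ℝ) (ξ : Fin (M + 1) → Finset ℝ) : ℝ :=
  ∏ m : Fin (M + 1),
    configTransDensity N (finalTime t)
      (t m.castSucc) ((Fin.cons {0} ξ : Fin (M + 2) → Finset ℝ) m.castSucc) (t m.succ) (ξ m)

/-- The integrand of the correlation function: the multitime density at the configurations
`{x₁, …, x_{n_m}, y₁, …, y_{N - n_m}}`, over the factorials of the `N - n_m`. -/
def correlationIntegrand (N : ℕ) {M : ℕ} (t : Fin (M + 2) → ℝ) (n : Fin (M + 1) → ℕ)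
    (x : (m : Fin (M + 1)) → Fin (n m) → ℝ) (y : (m : Fin (M + 1)) → Fin (N - n m) → ℝ) : ℝ :=
  (∏ m, 1 / ((N - n m)! : ℝ)) * multitimeDensity N t fun m => config (Fin.append (x m) (y m))

/-- The `(n₁, …, n_{M+1})`-multitime correlation function. -/
def correlation (N : ℕ) {M : ℕ} (t : Fin (M + 2) → ℝ) (n : Fin (M + 1) → ℕ)
    (x : (m : Fin (M + 1)) → Fin (n m) → ℝ) : ℝ :=
  ∫ y, correlationIntegrand N t n x y

/-! ### The kernels -/

/-- The (physicists') Hermite polynomials `H₀ = 1`, `H_{k+1} = 2 X H_k - H_k'`. -/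
def hermiteH : ℕ → Polynomial ℝ
  | 0 => 1
  | k + 1 => 2 * Polynomial.X * hermiteH k - Polynomial.derivative (hermiteH k)

/-- `c₁ = √(t₁ (2T - t₁) / T)`. -/
def cOne {M : ℕ} (t : Fin (M + 2) → ℝ) : ℝ :=
  Real.sqrt (t 1 * (2 * finalTime t - t 1) / finalTime t)

/-- `z₁ = √((2T - t₁) / t₁)`. -/
def zOne {M : ℕ} (t : Fin (M + 2) → ℝ) : ℝ :=
  Real.sqrt ((2 * finalTime t - t 1) / t 1)

/-- The coefficients `α_{kj}`. -/
def alphaCoeff {M : ℕ} (t : Fin (M + 2) → ℝ) (k j : ℕ) : ℝ :=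
  if Even k then (2 ^ k)⁻¹ * cOne t ^ k * (if k = j then 1 else 0)
  else (2 ^ k)⁻¹ * cOne t ^ k *
    ((if k = j then 1 else 0) - 2 * ((k : ℝ) - 1) * (if k = j + 2 then 1 else 0))

/-- The polynomials `R_k(x) = z₁^{-k} ∑_{j=0}^k α_{kj} H_j(x / c₁) z₁^j`. -/
def skewPoly {M : ℕ} (t : Fin (M + 2) → ℝ) (k : ℕ) (x : ℝ) : ℝ :=
  (zOne t ^ k)⁻¹ *
    ∑ j ∈ Finset.range (k + 1), alphaCoeff t k j * (hermiteH j).eval (x / cOne t) * zOne t ^ j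

/-- `r_j = Γ(j + 1/2) Γ(j + 1) / π · (t₁² / T)^{2j + 1/2}`. -/
def skewNorm {M : ℕ} (t : Fin (M + 2) → ℝ) (j : ℕ) : ℝ :=
  Real.Gamma ((j : ℝ) + 1 / 2) * Real.Gamma ((j : ℝ) + 1) / Real.pi
    * (t 1 ^ 2 / finalTime t) ^ (2 * (j : ℝ) + 1 / 2)

/-- `F^{m,n}(x, y) = ∫ dw ∫_{z < w} dz (p_{T-t_m}(x,z) p_{T-t_n}(y,w) - p_{T-t_m}(x,w) p_{T-t_n}(y,z))`,
written with the measures `p_{T-t_m}(x, ·)` and `p_{T-t_n}(y, ·)`, one or both of which are unit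
masses if `t_m = T` or `t_n = T`. -/
def kernelF {M : ℕ} (t : Fin (M + 2) → ℝ) (m n : Fin (M + 1)) (x y : ℝ) : ℝ :=
  ((heatMeasure (finalTime t - t m.succ) x).prod
      (heatMeasure (finalTime t - t n.succ) y)).real {v | v.1 < v.2}
    - ((heatMeasure (finalTime t - t m.succ) x).prod
      (heatMeasure (finalTime t - t n.succ) y)).real {v | v.2 < v.1}

/-- `R_k^{(m)}(x) = ∫ dy R_k(y) p_{t₁}(0, y) p_{t_m - t₁}(y, x)`, where `p_0(y, x) dy = δ_x(dy)`. -/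
def transR {M : ℕ} (t : Fin (M + 2) → ℝ) (m : Fin (M + 1)) (k : ℕ) (x : ℝ) : ℝ :=
  ∫ y, skewPoly t k y * heat (t 1) 0 y ∂(heatMeasure (t m.succ - t 1) x)

/-- `Φ_k^{(m)}(x) = ∫ dy R_k^{(m)}(y) F^{m,m}(y, x)`. -/
def transPhi {M : ℕ} (t : Fin (M + 2) → ℝ) (m : Fin (M + 1)) (k : ℕ) (x : ℝ) : ℝ :=
  ∫ y, transR t m k y * kernelF t m m y x

/-- `D^{m,n}(x, y)`. -/
def kernelD (N : ℕ) {M : ℕ} (t : Fin (M + 2) → ℝ) (m n : Fin (M + 1)) (x y : ℝ) : ℝ :=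
  ∑ k ∈ Finset.range (N / 2), 1 / skewNorm t k *
    (transR t m (2 * k) x * transR t n (2 * k + 1) y
      - transR t m (2 * k + 1) x * transR t n (2 * k) y)

/-- `I^{m,n}(x, y)`. -/
def kernelI (N : ℕ) {M : ℕ} (t : Fin (M + 2) → ℝ) (m n : Fin (M + 1)) (x y : ℝ) : ℝ :=
  -∑ k ∈ Finset.range (N / 2), 1 / skewNorm t k *
    (transPhi t m (2 * k) x * transPhi t n (2 * k + 1) y
      - transPhi t m (2 * k + 1) x * transPhi t n (2 * k) y)

/-- `S^{m,n}(x, y)`. -/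
def kernelS (N : ℕ) {M : ℕ} (t : Fin (M + 2) → ℝ) (m n : Fin (M + 1)) (x y : ℝ) : ℝ :=
  ∑ k ∈ Finset.range (N / 2), 1 / skewNorm t k *
    (transPhi t m (2 * k) x * transR t n (2 * k + 1) y
      - transPhi t m (2 * k + 1) x * transR t n (2 * k) y)

/-- `S̃^{m,n}(x, y) = S^{m,n}(x, y) - p_{t_n - t_m}(x, y) 1(m < n)`. -/
def kernelSTilde (N : ℕ) {M : ℕ} (t : Fin (M + 2) → ℝ) (m n : Fin (M + 1)) (x y : ℝ) : ℝ :=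
  kernelS N t m n x y - if m < n then heat (t n.succ - t m.succ) x y else 0

/-- `Ĩ^{m,n}(x, y) = I^{m,n}(x, y) + F^{m,n}(x, y)`. -/
def kernelITilde (N : ℕ) {M : ℕ} (t : Fin (M + 2) → ℝ) (m n : Fin (M + 1)) (x y : ℝ) : ℝ :=
  kernelI N t m n x y + kernelF t m n x y

/-- The quaternion `q^{m,n}(x, y)`, given by its matrix representation. -/
def kernelQ (N : ℕ) {M : ℕ} (t : Fin (M + 2) → ℝ) (m n : Fin (M + 1)) (x y : ℝ) : ℍ[ℂ] :=
  ofMatrix !![(kernelSTilde N t m n x y : ℂ), (kernelITilde N t m n x y : ℂ);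
    (kernelD N t m n x y : ℂ), (kernelSTilde N t n m y x : ℂ)]

/-- The block matrix `Q` of size `∑ n_m`, with entries `q^{m,m'}(x_i^{(m)}, x_j^{(m')})`;
`finSigmaFinEquiv` enumerates the pairs `(m, i)` block by block. -/
def quaternionMatrix (N : ℕ) {M : ℕ} (t : Fin (M + 2) → ℝ) (n : Fin (M + 1) → ℕ)
    (x : (m : Fin (M + 1)) → Fin (n m) → ℝ) :
    Matrix (Fin (∑ m, n m)) (Fin (∑ m, n m)) ℍ[ℂ] :=
  Matrix.of fun a b =>
    kernelQ N t (finSigmaFinEquiv.symm a).1 (finSigmaFinEquiv.symm b).1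
      (x _ (finSigmaFinEquiv.symm a).2) (x _ (finSigmaFinEquiv.symm b).2)

end

end NonColliding

open NonColliding

/-! ### Cycles of a permutation and their smallest elements -/

section Cycles

variable {k : ℕ} (π : Equiv.Perm (Fin k))

/-! The theorem is proved through a generating function with point masses, whose square is a
determinant.

Density. On ordered configurations the survival probabilities in `multitimeDensity` telescope. The
Vandermonde product with its Gaussian weight is the determinant of the functions `initialFn`, which
are monic polynomials times that weight. The constant 1 left at the final time is, up to `2 ^ n * n
!`, the Pfaffian of the matrix sgn(x_j - x_i). The density thus becomes a constant times
`pathWeight`, which is symmetric under relabelling at each time and so represents the density at all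
labelled points (`multitimeDensity_config`).

Generating function. Give every observed point x_a a mass u_a, added to Lebesgue measure at the time
of the point. The integral of the density over all particles is then a polynomial P in the masses.
After normalization its coefficient at ∏ u_a is the correlation function: each observed point is
occupied by exactly one particle and the remaining particles are integrated over ℝ
(`correlation_eq_coeff`). Andréief's identity at the earlier times and de Bruijn's identity at the
final time evaluate the integral as the Pfaffian of the skew products of the functions transported
through these measures (`integral_pathWeight`).

Determinant. Without masses the skew products are those of skew orthogonal functions with norms r_k
(`skewForm_finalFn`): at the final time the even functions are Hermite functions, the odd ones are
multiples of their derivatives, and integration against sgn undoes a derivative. Together with the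
value of `originConst` this gives P(0) = 1. With masses, the matrix of skew products is a
perturbation built from the values of R, Φ, F and of the heat kernels at the points. The identity
`det_perturbed_skew` turns its determinant into det(1 + uQ), where Q is written in 2 × 2 blocks
(`det_skewMatrix`). Hence P² = det(1 + uQ) (`correlationPoly_sq`).

Comparison with `Tdet`. The coefficient of ∏ u_a in P^s is a polynomial in s. For even s it is a
coefficient of a power of the determinant, that is, a signed sum over permutations in which every
cycle carries s/2 times a trace. At s = 1 every cycle carries half a trace
(`coeff_ones_of_sq_eq_det`). On the quaternion side, inverting a cycle replaces its product by the
dual, so for a self-dual matrix every cycle product may be replaced by its scalar part, which is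
again half a trace (`Tdet_eq_sum_labellings`). -/

theorem mem_cycleReps {a : Fin k} : a ∈ cycleReps π ↔ ∀ b, π.SameCycle a b → a ≤ b := by
  simp [cycleReps]

theorem exists_cycleRep_sameCycle (a : Fin k) : ∃ r ∈ cycleReps π, π.SameCycle r a := by
  classical
  have hne : (Finset.univ.filter fun b => π.SameCycle a b).Nonempty :=
    ⟨a, by simp [Equiv.Perm.SameCycle.refl]⟩
  refine ⟨_, ?_, (Finset.mem_filter.1 (Finset.min'_mem _ hne)).2.symm⟩
  rw [mem_cycleReps]
  intro b hb
  apply Finset.min'_le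
  have := (Finset.mem_filter.1 (Finset.min'_mem _ hne)).2
  simpa using this.trans hb

theorem cycleReps_eq_of_sameCycle {r s : Fin k} (hr : r ∈ cycleReps π) (hs : s ∈ cycleReps π)
    (h : π.SameCycle r s) : r = s :=
  le_antisymm ((mem_cycleReps π).1 hr s h) ((mem_cycleReps π).1 hs r h.symm)

/-- `cycleType` ignores fixed points, so these are counted separately; the nontrivial cycles
correspond to their smallest elements through `cycleOf`. -/
theorem card_cycleReps :
    (cycleReps π).card = (k - π.support.card) + π.cycleType.card := by
  classical
  have h1 : ((cycleReps π).filter fun a => a ∉ π.support).card = k - π.support.card := by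
    have : ((cycleReps π).filter fun a => a ∉ π.support) = π.supportᶜ := by
      ext a
      simp only [Finset.mem_filter, Finset.mem_compl, and_iff_right_iff_imp]
      intro ha
      rw [mem_cycleReps]
      intro b hb
      rw [Equiv.Perm.notMem_support] at ha
      exact ((Equiv.Perm.SameCycle.eq_of_left hb ha)).le
    rw [this, Finset.card_compl, Fintype.card_fin]
  have h2 : ((cycleReps π).filter fun a => a ∈ π.support).card = π.cycleType.card := by
    rw [Equiv.Perm.cycleType_def, Multiset.card_map]
    change _ = π.cycleFactorsFinset.card
    refine Finset.card_bij (fun a _ => π.cycleOf a) ?_ ?_ ?_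
    · intro a ha
      exact Equiv.Perm.cycleOf_mem_cycleFactorsFinset_iff.2 (Finset.mem_filter.1 ha).2
    · intro a ha b hb hab
      refine cycleReps_eq_of_sameCycle π (Finset.mem_filter.1 ha).1 (Finset.mem_filter.1 hb).1 ?_
      have : b ∈ (π.cycleOf a).support := by
        rw [hab, Equiv.Perm.mem_support_cycleOf_iff]
        exact ⟨Equiv.Perm.SameCycle.refl _ _, (Finset.mem_filter.1 hb).2⟩
      exact (Equiv.Perm.mem_support_cycleOf_iff.1 this).1
    · intro c hc
      obtain ⟨x, hx⟩ := (Equiv.Perm.mem_cycleFactorsFinset_iff.1 hc).1.nonempty_support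
      have hcx := Equiv.Perm.cycle_is_cycleOf hx hc
      have hxs : x ∈ π.support := Equiv.Perm.mem_cycleFactorsFinset_support_le hc hx
      obtain ⟨r, hr, hrx⟩ := exists_cycleRep_sameCycle π x
      refine ⟨r, Finset.mem_filter.2 ⟨hr, (hrx.mem_support_iff).2 hxs⟩, ?_⟩
      rw [hcx, hrx.cycleOf_eq]
  rw [← Finset.card_filter_add_card_filter_not (s := cycleReps π) (fun a => a ∉ π.support), h1]
  simp only [not_not, h2]

/-- The exponent in `sign_of_cycleType` differs from the number of points minus the number of cycles
by twice the number of nontrivial cycles. -/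
theorem sign_eq_neg_one_pow_cycleReps :
    ((Equiv.Perm.sign π : ℤˣ) : ℤ) = (-1) ^ (k - (cycleReps π).card) := by
  classical
  have h := card_cycleReps π
  have hle : π.support.card ≤ k := by simpa using Finset.card_le_univ π.support
  have hc : (cycleReps π).card ≤ k := by simpa using Finset.card_le_univ (cycleReps π)
  rw [Equiv.Perm.sign_of_cycleType, Equiv.Perm.sum_cycleType]
  push_cast
  have : π.support.card + π.cycleType.card = (k - (cycleReps π).card) + 2 * π.cycleType.card := by
    omega
  rw [this, pow_add, pow_mul]
  simp

theorem minimalPeriod_pos_of_perm (a : Fin k) : 0 < Function.minimalPeriod π a :=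
  Function.minimalPeriod_pos_of_mem_periodicPts
    ((Equiv.injective π).mem_periodicPts a)

/-- The cycle decomposition as an enumeration of the points of every cycle. -/
theorem bijective_cycle_enumeration : Function.Bijective
    (fun p : (r : cycleReps π) × Fin (Function.minimalPeriod π r) => (π ^ (p.2 : ℕ)) (p.1 : Fin k)) := by
  constructor
  · rintro ⟨⟨r, hr⟩, l⟩ ⟨⟨s, hs⟩, l'⟩ h
    simp only at h
    have hrs : r = s := by
      refine cycleReps_eq_of_sameCycle π hr hs ?_
      rw [← Equiv.Perm.sameCycle_pow_left (n := (l : ℕ)), h, Equiv.Perm.sameCycle_pow_left]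
    subst hrs
    have : (l : ℕ) = l' :=
      Function.iterate_injOn_Iio_minimalPeriod (f := π) (x := r) l.2 l'.2 h
    have : l = l' := Fin.ext this
    subst this
    rfl
  · intro x
    obtain ⟨r, hr, hrx⟩ := exists_cycleRep_sameCycle π x
    obtain ⟨i, -, hi⟩ := hrx.exists_pow_eq'
    refine ⟨⟨⟨r, hr⟩, ⟨i % Function.minimalPeriod π r, Nat.mod_lt _ (minimalPeriod_pos_of_perm π r)⟩⟩, ?_⟩
    simp only
    rw [← hi]
    exact Function.iterate_mod_minimalPeriod_eq (f := π)

end Cycles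

/-! ### Traces along cycles -/

section Trace

variable {ι R : Type*} [Fintype ι] [DecidableEq ι] [CommRing R]

/-- Summing over the interior points of a path is matrix multiplication. The function `h` of the two
endpoints is arbitrary so that the induction can absorb the last step into it. -/
theorem sum_path_eq (q : ℕ) (A : ℕ → Matrix ι ι R) (h : ι → ι → R) :
    ∑ j : Fin (q + 1) → ι, (∏ l : Fin q, A l (j l.castSucc) (j l.succ)) * h (j 0) (j (Fin.last q))
      = ∑ x, ∑ y, ((List.range q).map A).prod x y * h x y := by
  induction q generalizing h with
  | zero =>
    have h1 := (Equiv.funUnique (Fin 1) ι).sum_comp (fun x => h x x)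
    simp only [Equiv.funUnique_apply] at h1
    simpa [Matrix.one_apply] using h1
  | succ q ih =>
    have h1 : ∑ j : Fin (q + 1 + 1) → ι, (∏ l : Fin (q + 1), A l (j l.castSucc) (j l.succ)) *
        h (j 0) (j (Fin.last (q + 1))) = ∑ j : Fin (q + 1) → ι,
          (∏ l : Fin q, A l (j l.castSucc) (j l.succ)) * ∑ y, A q (j (Fin.last q)) y * h (j 0) y := by
      rw [← (Fin.snocEquiv fun _ => ι).sum_comp, Fintype.sum_prod_type_right]
      refine Finset.sum_congr rfl fun j _ => ?_
      rw [Finset.mul_sum]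
      refine Finset.sum_congr rfl fun y _ => ?_
      rw [Fin.prod_univ_castSucc]
      have h0 : (Fin.snoc (α := fun _ => ι) j y : Fin (q + 2) → ι) 0 = j 0 := by
        rw [← Fin.castSucc_zero, Fin.snoc_castSucc]
      have h0' : ∀ l : Fin q, (Fin.snoc (α := fun _ => ι) j y : Fin (q + 2) → ι) l.castSucc.succ
          = j l.succ := by
        intro l
        rw [Fin.succ_castSucc, Fin.snoc_castSucc]
      simp only [Fin.snocEquiv, Equiv.coe_fn_mk, Fin.snoc_castSucc, h0, h0', Fin.val_castSucc,
        Fin.val_last, Fin.succ_last, Fin.snoc_last]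
      ring
    rw [h1, ih (fun x z => ∑ y, A q z y * h x y)]
    simp only [List.range_succ, List.map_append, List.prod_append, List.map_singleton,
      List.prod_singleton, Matrix.mul_apply, Finset.sum_mul, Finset.mul_sum]
    refine Finset.sum_congr rfl fun x _ => ?_
    rw [Finset.sum_comm]
    refine Finset.sum_congr rfl fun y _ => Finset.sum_congr rfl fun z _ => ?_
    ring

/-- A cycle is a path whose last matrix leads back to the starting point: this is `sum_path_eq` with
`h x y = A q y x`. -/
theorem sum_cycle_eq_trace (p : ℕ) (hp : 0 < p) (A : ℕ → Matrix ι ι R) (s : Fin p → Fin p)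
    (hs : ∀ l, ((s l : Fin p) : ℕ) = (l + 1) % p) :
    ∑ j : Fin p → ι, ∏ l : Fin p, A l (j l) (j (s l)) = ((List.range p).map A).prod.trace := by
  obtain ⟨q, rfl⟩ := Nat.exists_eq_succ_of_ne_zero hp.ne'
  simp only [Nat.succ_eq_add_one] at *
  have hs1 : ∀ l : Fin q, s l.castSucc = l.succ := by
    intro l
    ext
    rw [hs]
    simp
  have hs2 : s (Fin.last q) = 0 := by
    ext
    rw [hs]
    simp
  have := sum_path_eq q A (fun x y => A q y x)
  rw [List.range_succ, List.map_append, List.prod_append]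
  simp only [List.map_singleton, List.prod_singleton, Matrix.trace, Matrix.diag, Matrix.mul_apply]
  rw [← this]
  refine Finset.sum_congr rfl fun j _ => ?_
  rw [Fin.prod_univ_castSucc]
  simp [hs1, hs2]

/-- A sum over labellings of the points of a permutation is a product of traces over its cycles. -/
theorem sum_labellings_eq_prod_trace {k : ℕ} (π : Equiv.Perm (Fin k))
    (M : Fin k → Fin k → Matrix ι ι R) :
    ∑ i : Fin k → ι, ∏ a, M a (π a) (i a) (i (π a)) =
      ∏ r ∈ cycleReps π, (((List.range (Function.minimalPeriod π r)).map
        fun l => M ((π ^ l) r) ((π ^ (l + 1)) r)).prod).trace := by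
  classical
  set e := Equiv.ofBijective _ (bijective_cycle_enumeration π) with he
  have hstep : ∀ (r : cycleReps π) (l : Fin (Function.minimalPeriod π r)),
      π (e ⟨r, l⟩) = e ⟨r, ⟨(l + 1) % Function.minimalPeriod π r,
        Nat.mod_lt _ (minimalPeriod_pos_of_perm π r)⟩⟩ := by
    intro r l
    simp only [he, Equiv.ofBijective_apply]
    rw [← Equiv.Perm.mul_apply, ← pow_succ']
    exact (Function.iterate_mod_minimalPeriod_eq (f := π)).symm
  have h1 : ∑ i : Fin k → ι, ∏ a, M a (π a) (i a) (i (π a)) =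
      ∑ j : (r : cycleReps π) → Fin (Function.minimalPeriod π r) → ι,
        ∏ r : cycleReps π, ∏ l : Fin (Function.minimalPeriod π r),
          M ((π ^ (l : ℕ)) r) ((π ^ ((l : ℕ) + 1)) r) (j r l)
            (j r ⟨(l + 1) % Function.minimalPeriod π r,
              Nat.mod_lt _ (minimalPeriod_pos_of_perm π r)⟩) := by
    refine Fintype.sum_equiv ((e.arrowCongr (Equiv.refl ι)).symm.trans (Equiv.piCurry
      fun (r : cycleReps π) (_ : Fin (Function.minimalPeriod π r)) => ι)) _ _ ?_
    intro i
    rw [← e.prod_comp, Fintype.prod_sigma]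
    refine Finset.prod_congr rfl fun r _ => Finset.prod_congr rfl fun l _ => ?_
    rw [hstep r l]
    have h2 : e ⟨r, l⟩ = (π ^ (l : ℕ)) r := rfl
    have h3 : e ⟨r, ⟨(l + 1) % Function.minimalPeriod π r,
        Nat.mod_lt _ (minimalPeriod_pos_of_perm π r)⟩⟩ = (π ^ ((l : ℕ) + 1)) r := by
      rw [← hstep r l, h2, pow_succ', Equiv.Perm.mul_apply]
    simp [Sigma.curry, h2, h3]
  rw [h1, ← Finset.prod_coe_sort]
  have h4 := Finset.prod_univ_sum (R := R)
    (fun r : cycleReps π => (Finset.univ : Finset (Fin (Function.minimalPeriod π r) → ι)))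
    (fun r j => ∏ l : Fin (Function.minimalPeriod π r),
          M ((π ^ (l : ℕ)) r) ((π ^ ((l : ℕ) + 1)) r) (j l)
            (j ⟨(l + 1) % Function.minimalPeriod π r,
              Nat.mod_lt _ (minimalPeriod_pos_of_perm π r)⟩))
  rw [Fintype.piFinset_univ] at h4
  rw [← h4]
  refine Finset.prod_congr rfl fun r _ => ?_
  exact sum_cycle_eq_trace _ (minimalPeriod_pos_of_perm π r)
    (fun l => M ((π ^ l) r) ((π ^ (l + 1)) r)) _ fun l => rfl

/-- With identity matrices in `sum_labellings_eq_prod_trace`, every cycle contributes the trace of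
`1`. This produces the factor (number of copies)^(number of cycles) below. -/
theorem sum_constant_on_cycles {k : ℕ} (π : Equiv.Perm (Fin k)) :
    ∑ c : Fin k → ι, ∏ a, (if c a = c (π a) then (1 : R) else 0) =
      (Fintype.card ι : R) ^ (cycleReps π).card := by
  have h := sum_labellings_eq_prod_trace π (fun _ _ => (1 : Matrix ι ι R))
  simp only [Matrix.one_apply] at h
  rw [h]
  simp

end Trace

/-! ### Symmetrization of the ordered cycle products of a self-dual matrix -/

section Flip

variable {k : ℕ}

open Classical in
/-- The permutation `π` with the cycle through `a` inverted. -/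
noncomputable def flipCycle (a : Fin k) (π : Equiv.Perm (Fin k)) : Equiv.Perm (Fin k) :=
  π * (π.cycleOf a)⁻¹ * (π.cycleOf a)⁻¹

/-- On the cycle through `a` each of the two factors `(π.cycleOf a)⁻¹` acts as `π⁻¹`, and π π⁻² =
π⁻¹. -/
theorem flipCycle_apply_of_sameCycle {a b : Fin k} {π : Equiv.Perm (Fin k)}
    (h : π.SameCycle a b) : flipCycle a π b = π⁻¹ b := by
  classical
  have h1 : ∀ c, π.SameCycle a c → (π.cycleOf a)⁻¹ c = π⁻¹ c := by
    intro c hc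
    rw [Equiv.Perm.cycleOf_inv, Equiv.Perm.SameCycle.cycleOf_apply]
    exact Equiv.Perm.sameCycle_inv.2 hc
  have h2 : π.SameCycle a (π⁻¹ b) := by
    rw [← Equiv.Perm.sameCycle_apply_right]
    simpa using h
  simp only [flipCycle, Equiv.Perm.mul_apply]
  rw [h1 b h, h1 _ h2]
  simp

theorem flipCycle_apply_of_not_sameCycle {a b : Fin k} {π : Equiv.Perm (Fin k)}
    (h : ¬ π.SameCycle a b) : flipCycle a π b = π b := by
  classical
  have h1 : (π.cycleOf a)⁻¹ b = b := by
    rw [Equiv.Perm.cycleOf_inv, Equiv.Perm.cycleOf_apply_of_not_sameCycle]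
    rwa [Equiv.Perm.sameCycle_inv]
  simp only [flipCycle, Equiv.Perm.mul_apply, h1]

theorem flipCycle_pow_of_sameCycle {a b : Fin k} {π : Equiv.Perm (Fin k)}
    (h : π.SameCycle a b) (l : ℕ) : (flipCycle a π ^ l) b = (π⁻¹ ^ l) b := by
  induction l with
  | zero => rfl
  | succ l ih =>
    rw [pow_succ', Equiv.Perm.mul_apply, ih, flipCycle_apply_of_sameCycle, pow_succ',
      Equiv.Perm.mul_apply]
    rw [← Equiv.Perm.sameCycle_inv, Equiv.Perm.sameCycle_pow_right, Equiv.Perm.sameCycle_inv]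
    exact h

theorem flipCycle_pow_of_not_sameCycle {a b : Fin k} {π : Equiv.Perm (Fin k)}
    (h : ¬ π.SameCycle a b) (l : ℕ) : (flipCycle a π ^ l) b = (π ^ l) b := by
  induction l with
  | zero => rfl
  | succ l ih =>
    rw [pow_succ', Equiv.Perm.mul_apply, ih, flipCycle_apply_of_not_sameCycle, pow_succ',
      Equiv.Perm.mul_apply]
    rwa [Equiv.Perm.sameCycle_pow_right]

theorem sameCycle_flipCycle {a b c : Fin k} {π : Equiv.Perm (Fin k)} :
    (flipCycle a π).SameCycle b c ↔ π.SameCycle b c := by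
  by_cases h : π.SameCycle a b
  · constructor
    · intro h1
      obtain ⟨i, -, hi⟩ := h1.exists_pow_eq'
      rw [flipCycle_pow_of_sameCycle h] at hi
      rw [← Equiv.Perm.sameCycle_inv]
      exact ⟨i, by simpa using hi⟩
    · intro h1
      obtain ⟨i, -, hi⟩ := (Equiv.Perm.sameCycle_inv.2 h1).exists_pow_eq'
      rw [← flipCycle_pow_of_sameCycle h] at hi
      exact ⟨i, by simpa using hi⟩
  · constructor
    · intro h1
      obtain ⟨i, -, hi⟩ := h1.exists_pow_eq'
      rw [flipCycle_pow_of_not_sameCycle h] at hi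
      exact ⟨i, by simpa using hi⟩
    · intro h1
      obtain ⟨i, -, hi⟩ := h1.exists_pow_eq'
      rw [← flipCycle_pow_of_not_sameCycle h] at hi
      exact ⟨i, by simpa using hi⟩

/-- Inverting a cycle keeps its underlying set. Starting points, order of the factors and sign in
`Tdet` are therefore the same for `π` and `flipCycle a π`. -/
theorem cycleReps_flipCycle (a : Fin k) (π : Equiv.Perm (Fin k)) :
    cycleReps (flipCycle a π) = cycleReps π := by
  ext b
  simp only [mem_cycleReps, sameCycle_flipCycle]

theorem flipCycle_flipCycle (a : Fin k) (π : Equiv.Perm (Fin k)) :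
    flipCycle a (flipCycle a π) = π := by
  ext b
  congr 1
  by_cases h : π.SameCycle a b
  · rw [flipCycle_apply_of_sameCycle (sameCycle_flipCycle.2 h), Equiv.Perm.inv_eq_iff_eq,
      flipCycle_apply_of_sameCycle]
    · simp
    · simpa using h
  · rw [flipCycle_apply_of_not_sameCycle (by rwa [sameCycle_flipCycle]),
      flipCycle_apply_of_not_sameCycle h]

theorem cycleProd_flipCycle_of_not_sameCycle (Q : Matrix (Fin k) (Fin k) ℍ[ℂ]) {a b : Fin k}
    {π : Equiv.Perm (Fin k)} (h : ¬ π.SameCycle a b) :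
    cycleProd Q (flipCycle a π) b = cycleProd Q π b := by
  have : Function.minimalPeriod (flipCycle a π) b = Function.minimalPeriod π b := by
    rw [Function.minimalPeriod_eq_minimalPeriod_iff]
    intro n
    simp only [Function.IsPeriodicPt, Function.IsFixedPt, Equiv.Perm.iterate_eq_pow,
      flipCycle_pow_of_not_sameCycle h]
  simp only [cycleProd, this, flipCycle_pow_of_not_sameCycle h]

theorem star_list_prod_eq (l : List ℍ[ℂ]) :
    star l.prod = (l.map star).reverse.prod := by
  induction l with
  | nil => simp
  | cons a l ih => simp [ih]

/-- The inverted cycle runs through the same entries in reverse order with transposed indices. The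
dual is an anti-automorphism, and self-duality exchanges the two indices of every entry. -/
theorem cycleProd_flipCycle_self {Q : Matrix (Fin k) (Fin k) ℍ[ℂ]} (hQ : IsSelfDual Q)
    (a : Fin k) (π : Equiv.Perm (Fin k)) :
    cycleProd Q (flipCycle a π) a = star (cycleProd Q π a) := by
  have hs := Equiv.Perm.SameCycle.refl π a
  have hp : Function.minimalPeriod (flipCycle a π) a = Function.minimalPeriod π a := by
    rw [Function.minimalPeriod_eq_minimalPeriod_iff]
    intro n
    simp only [Function.IsPeriodicPt, Function.IsFixedPt, Equiv.Perm.iterate_eq_pow,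
      flipCycle_pow_of_sameCycle hs, inv_pow]
    rw [Equiv.Perm.inv_eq_iff_eq, eq_comm]
  unfold cycleProd
  refine Eq.trans ?_ (star_list_prod_eq _).symm
  rw [hp]
  congr 1
  have hper : (π ^ Function.minimalPeriod π a) a = a :=
    Function.iterate_minimalPeriod (f := π) (x := a)
  have key : ∀ l ≤ Function.minimalPeriod π a,
      (π⁻¹ ^ l) a = (π ^ (Function.minimalPeriod π a - l)) a := by
    intro l hl
    rw [inv_pow, Equiv.Perm.inv_eq_iff_eq, ← Equiv.Perm.mul_apply, ← pow_add,
      Nat.add_sub_cancel' hl, hper]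
  apply List.ext_getElem
  · simp
  · intro l h1 h2
    simp only [List.length_map, List.length_range] at h1
    simp only [List.getElem_map, List.getElem_range, List.getElem_reverse, List.length_map,
      List.length_range, flipCycle_pow_of_sameCycle hs]
    rw [hQ, key l h1.le, key (l + 1) h1]
    congr 3 <;> omega

end Flip

/-- Noncommutative multilinearity: since the list has no repetitions, the products differ in a
single factor. The doubled form of the average avoids a division. -/
theorem List.prod_map_add_of_eqOn_ne {α R : Type*} [Semiring R] {l : List α}
    (hl : l.Nodup) {a : α} (ha : a ∈ l) {G G' H : α → R} (h1 : ∀ b ∈ l, b ≠ a → G b = H b)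
    (h2 : ∀ b ∈ l, b ≠ a → G' b = H b) (h3 : G a + G' a = H a + H a) :
    (l.map G).prod + (l.map G').prod = (l.map H).prod + (l.map H).prod := by
  induction l with
  | nil => simp at ha
  | cons c l ih =>
    simp only [List.map_cons, List.prod_cons]
    rw [List.nodup_cons] at hl
    by_cases hc : c = a
    · subst hc
      have e1 : l.map G = l.map H := List.map_congr_left fun b hb =>
        h1 b (List.mem_cons_of_mem _ hb) (by rintro rfl; exact hl.1 hb)
      have e2 : l.map G' = l.map H := List.map_congr_left fun b hb =>
        h2 b (List.mem_cons_of_mem _ hb) (by rintro rfl; exact hl.1 hb)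
      rw [e1, e2, ← add_mul, h3, add_mul]
    · rw [h1 c (by simp) hc, h2 c (by simp) hc, ← mul_add,
        ih hl.2 (by simpa [Ne.symm hc] using ha) (fun b hb => h1 b (List.mem_cons_of_mem _ hb))
          (fun b hb => h2 b (List.mem_cons_of_mem _ hb)), mul_add]

theorem quaternion_add_self_injective {p q : ℍ[ℂ]} (h : p + p = q + q) : p = q := by
  have hc : ∀ z w : ℂ, z + z = w + w → z = w := fun z w h => by linear_combination h / 2
  ext1
  · exact hc _ _ (congrArg QuaternionAlgebra.re h)
  · exact hc _ _ (congrArg QuaternionAlgebra.imI h)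
  · exact hc _ _ (congrArg QuaternionAlgebra.imJ h)
  · exact hc _ _ (congrArg QuaternionAlgebra.imK h)

/-! ### Dyson's determinant through scalar parts and traces -/

section

variable {k : ℕ} {Q : Matrix (Fin k) (Fin k) ℍ[ℂ]}

open Classical in
-- The cycle products are replaced by their scalar parts one starting point at a time. Adding `a` to
-- `s` amounts to averaging over the inversion of the cycle that starts at `a`, because a quaternion
-- plus its dual is twice its scalar part.
theorem Tdet_eq_sum_re_on (hQ : IsSelfDual Q) (s : Finset (Fin k)) :
    Tdet Q = ∑ π : Equiv.Perm (Fin k), (-1) ^ (k - (cycleReps π).card) *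
      (((cycleReps π).sort (· ≤ ·)).map fun a =>
        if a ∈ s then (((cycleProd Q π a).re : ℂ) : ℍ[ℂ]) else cycleProd Q π a).prod := by
  induction s using Finset.induction_on with
  | empty => simp [Tdet]
  | insert a s ha ih =>
    rw [ih]
    set f : Equiv.Perm (Fin k) → ℍ[ℂ] := fun π => (-1) ^ (k - (cycleReps π).card) *
      (((cycleReps π).sort (· ≤ ·)).map fun a =>
        if a ∈ s then (((cycleProd Q π a).re : ℂ) : ℍ[ℂ]) else cycleProd Q π a).prod with hf
    set g : Equiv.Perm (Fin k) → ℍ[ℂ] := fun π => (-1) ^ (k - (cycleReps π).card) *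
      (((cycleReps π).sort (· ≤ ·)).map fun b =>
        if b ∈ insert a s then (((cycleProd Q π b).re : ℂ) : ℍ[ℂ]) else cycleProd Q π b).prod with hg
    -- If `a` is not the smallest element of its cycle, no factor starts at `a`, and nothing has to
    -- be changed.
    let F : Equiv.Perm (Fin k) → Equiv.Perm (Fin k) := fun π =>
      if a ∈ cycleReps π then flipCycle a π else π
    have hF : Function.Involutive F := by
      intro π
      by_cases h : a ∈ cycleReps π
      · simp [F, h, cycleReps_flipCycle, flipCycle_flipCycle]
      · simp [F, h]
    have hsum : ∑ π, f (F π) = ∑ π, f π := Equiv.sum_comp hF.toPerm f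
    have hfg : ∀ π, f π + f (F π) = g π + g π := by
      intro π
      by_cases h : a ∈ cycleReps π
      · simp only [hf, hg, F, h, if_true, cycleReps_flipCycle]
        rw [← mul_add, ← mul_add]
        congr 1
        refine List.prod_map_add_of_eqOn_ne (Finset.sort_nodup _ _) (a := a) (by simpa using h)
          ?_ ?_ ?_
        · intro b _ hb
          simp [hb]
        · intro b hb' hb
          have hbr : ¬ π.SameCycle a b := fun hab =>
            hb (cycleReps_eq_of_sameCycle π h (by simpa using hb') hab).symm
          simp [hb, cycleProd_flipCycle_of_not_sameCycle Q hbr]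
        · simp only [ha, if_false, Finset.mem_insert, true_or, if_true,
            cycleProd_flipCycle_self hQ]
          ext <;> simp
      · simp only [F, h, if_false]
        have : f π = g π := by
          simp only [hf, hg]
          congr 2
          refine List.map_congr_left fun b hb => ?_
          have hba : b ≠ a := by
            rintro rfl
            exact h (by simpa using hb)
          simp [hba]
        rw [this]
    apply quaternion_add_self_injective
    -- Only one of the two copies of the sum is reindexed by the involution, so that each `π` is
    -- paired with `F π`.
    nth_rewrite 2 [← hsum]
    rw [← Finset.sum_add_distrib, ← Finset.sum_add_distrib]
    exact Finset.sum_congr rfl fun π _ => hfg π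

theorem matrixRep_mul (p q : ℍ[ℂ]) : matrixRep (p * q) = matrixRep p * matrixRep q := by
  have hI : Complex.I * Complex.I = -1 := Complex.I_mul_I
  ext i j
  fin_cases i <;> fin_cases j <;> simp [matrixRep, Matrix.mul_apply, Fin.sum_univ_two]
  · linear_combination (-(p.imJ * q.imJ) - p.imK * q.imK) * hI
  · linear_combination (p.imK * q.imJ - p.imJ * q.imK) * hI
  · linear_combination (-(p.imK * q.imJ) + p.imJ * q.imK) * hI
  · linear_combination (-(p.imJ * q.imJ) - p.imK * q.imK) * hI

theorem matrixRep_one : matrixRep 1 = 1 := by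
  ext i j
  fin_cases i <;> fin_cases j <;> simp [matrixRep]

theorem trace_matrixRep (q : ℍ[ℂ]) : (matrixRep q).trace = 2 * q.re := by
  simp [matrixRep, Matrix.trace, Fin.sum_univ_two]
  ring

theorem matrixRep_list_prod (l : List ℍ[ℂ]) : matrixRep l.prod = (l.map matrixRep).prod := by
  induction l with
  | nil => simp [matrixRep_one]
  | cons a l ih => simp [matrixRep_mul, ih]

/-- Dyson's determinant as a sum over labellings of the indices by `Fin 2`. -/
theorem Tdet_eq_sum_labellings (hQ : IsSelfDual Q) :
    Tdet Q = ((∑ π : Equiv.Perm (Fin k), ((Equiv.Perm.sign π : ℤ) : ℂ) *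
      ((1 / 2) ^ (cycleReps π).card * ∑ i : Fin k → Fin 2,
        ∏ a, matrixRep (Q a (π a)) (i a) (i (π a))) : ℂ) : ℍ[ℂ]) := by
  rw [Tdet_eq_sum_re_on hQ Finset.univ]
  have h : ∀ π : Equiv.Perm (Fin k), (1 / 2 : ℂ) ^ (cycleReps π).card * ∑ i : Fin k → Fin 2,
      ∏ a, matrixRep (Q a (π a)) (i a) (i (π a)) = ∏ r ∈ cycleReps π, (cycleProd Q π r).re := by
    intro π
    rw [sum_labellings_eq_prod_trace π fun a b => matrixRep (Q a b), ← Finset.prod_const,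
      ← Finset.prod_mul_distrib]
    refine Finset.prod_congr rfl fun r _ => ?_
    have e : ((List.range (Function.minimalPeriod π r)).map
        fun l => matrixRep (Q ((π ^ l) r) ((π ^ (l + 1)) r))) =
        ((List.range (Function.minimalPeriod π r)).map
          fun l => Q ((π ^ l) r) ((π ^ (l + 1)) r)).map matrixRep := by
      rw [List.map_map]
      rfl
    rw [e, ← matrixRep_list_prod, trace_matrixRep, cycleProd]
    ring
  simp only [h]
  -- Once all factors are scalars the order of the cycles is irrelevant, and the ordered list
  -- product becomes a product over a finite set.
  have hc : ∀ (l : List (Fin k)) (f : Fin k → ℂ),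
      (l.map fun a => ((f a : ℂ) : ℍ[ℂ])).prod = (((l.map f).prod : ℂ) : ℍ[ℂ]) := by
    intro l f
    induction l with
    | nil => simp
    | cons a l ih => simp [ih]
  have hs : ∀ (f : Equiv.Perm (Fin k) → ℂ), ((∑ π, f π : ℂ) : ℍ[ℂ]) = ∑ π, (f π : ℍ[ℂ]) := fun f =>
    map_sum (algebraMap ℂ ℍ[ℂ]) f _
  rw [hs]
  refine Finset.sum_congr rfl fun π _ => ?_
  simp only [Finset.mem_univ, if_true]
  rw [hc, sign_eq_neg_one_pow_cycleReps π]
  have h6 : (((cycleReps π).sort (· ≤ ·)).map fun a => (cycleProd Q π a).re).prod =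
      ∏ r ∈ cycleReps π, (cycleProd Q π r).re := by
    rw [← Finset.prod_map_toList]
    exact ((Finset.sort_perm_toList _ _).map _).prod_eq
  rw [h6]
  push_cast
  simp

end

/-! ### Square roots of determinants `det (1 + U Q)` -/

section DetSqrt

variable {σ K : Type*} [Fintype σ] [DecidableEq σ] [Field K]

/-- Rows outside `s` are rows of the identity, so the matrix is block triangular and only the
principal minor on `s` remains. The map `f` lists `s`, so that the minor can be written as a
submatrix. -/
theorem det_piecewise_one {κ : Type*} [Fintype κ] [DecidableEq κ] {R : Type*} [CommRing R]
    (M : Matrix κ κ R) (s : Finset κ) (f : σ → κ) (hf : Function.Injective f)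
    (hs : s = Finset.univ.image f) :
    Matrix.det (Matrix.of fun i j => if i ∈ s then M i j else (1 : Matrix κ κ R) i j) =
      (M.submatrix f f).det := by
  rw [Matrix.twoBlockTriangular_det _ (fun i => i ∈ s)]
  · have h2 : Matrix.toSquareBlockProp (Matrix.of fun i j =>
        if i ∈ s then M i j else (1 : Matrix κ κ R) i j) (fun i => ¬ i ∈ s) = 1 := by
      ext ⟨i, hi⟩ ⟨j, hj⟩
      simp [Matrix.toSquareBlockProp, hi, Matrix.one_apply]
    rw [h2, Matrix.det_one, mul_one]
    have hmem : ∀ a, f a ∈ s := fun a => by rw [hs]; simp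
    let e : σ ≃ {i // i ∈ s} := Equiv.ofBijective (fun a => ⟨f a, hmem a⟩)
      ⟨fun a b h => hf (by simpa using h), fun ⟨x, hx⟩ => by
        rw [hs] at hx
        obtain ⟨a, -, rfl⟩ := Finset.mem_image.1 hx
        exact ⟨a, rfl⟩⟩
    -- Quantifying over the instances makes the reindexing apply to whichever ones
    -- `Matrix.twoBlockTriangular_det` has produced.
    have key : ∀ (i1 : Fintype {i // i ∈ s}) (i2 : DecidableEq {i // i ∈ s})
        (A : Matrix {i // i ∈ s} {i // i ∈ s} R), A.det = (A.submatrix e e).det :=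
      fun i1 i2 A => (Matrix.det_submatrix_equiv_self e A).symm
    refine (key _ _ _).trans (congrArg Matrix.det ?_)
    ext a b
    simp [Matrix.toSquareBlockProp, e]
    rfl
  · intro i hi j hj
    have : i ≠ j := by rintro rfl; exact hi hj
    simp [hi, Matrix.one_apply, this]

/-- Multilinearity in the rows: every row is either a row of `c M` or a row of the identity. This is
the expansion of det(1 + cM) in principal minors. -/
theorem det_add_rows {κ : Type*} [Fintype κ] [DecidableEq κ] {R : Type*} [CommRing R]
    (c : κ → R) (M : Matrix κ κ R) :
    Matrix.det (1 + Matrix.of fun x y => c x * M x y) = ∑ s : Finset κ, (∏ x ∈ s, c x) *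
      Matrix.det (Matrix.of fun i j => if i ∈ s then M i j else (1 : Matrix κ κ R) i j) := by
  let D := (Matrix.detRowAlternating (n := κ) (R := R)).toMultilinearMap
  have hD : ∀ v : κ → κ → R, D v = Matrix.det (Matrix.of v) := fun v => rfl
  let m : κ → κ → R := fun x y => M x y
  let w : κ → κ → R := fun x y => (1 : Matrix κ κ R) x y
  have h := D.map_add_univ (fun x => c x • m x) w
  have e : (1 + Matrix.of fun x y => c x * M x y) = Matrix.of ((fun x => c x • m x) + w) := by
    ext x y
    simp [m, w, add_comm]
  rw [e, ← hD, h]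
  refine Finset.sum_congr rfl fun s _ => ?_
  have h2 := D.map_piecewise_smul c (s.piecewise m w) s
  have e2 : s.piecewise (fun i => c i • (s.piecewise m w) i) (s.piecewise m w) =
      s.piecewise (fun x => c x • m x) w := by
    ext1 x
    by_cases hx : x ∈ s <;> simp [hx]
  rw [e2] at h2
  rw [h2, smul_eq_mul, hD]
  congr 2
  ext x y
  by_cases hx : x ∈ s <;> simp [hx, m, w]

/-- The exponent of the monomial in which every variable occurs once. -/
noncomputable def onesExp (σ : Type*) [Fintype σ] : σ →₀ ℕ := Finsupp.equivFunOnFinite.symm fun _ => 1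

/-- The minor on `s` carries the monomial ∏_{x ∈ s} X_{x.1}. It is the product of all variables
exactly when `s` has one element over each `a`, that is, when `s` is the graph of a map `c`. -/
theorem coeff_ones_det_one_add {τ : Type*} [Fintype τ] [DecidableEq τ]
    (M : Matrix (σ × τ) (σ × τ) K) :
    MvPolynomial.coeff (onesExp σ) (Matrix.det (1 + Matrix.of fun x y =>
      (MvPolynomial.X x.1 * MvPolynomial.C (M x y) : MvPolynomial σ K))) =
      ∑ c : σ → τ, (M.submatrix (fun a => (a, c a)) (fun a => (a, c a))).det := by
  classical
  have h1 : Matrix.det (1 + Matrix.of fun x y =>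
      (MvPolynomial.X x.1 * MvPolynomial.C (M x y) : MvPolynomial σ K)) =
      ∑ s : Finset (σ × τ), (∏ x ∈ s, MvPolynomial.X x.1) *
        MvPolynomial.C (Matrix.det (Matrix.of fun i j =>
          if i ∈ s then M i j else (1 : Matrix _ _ K) i j)) := by
    refine (det_add_rows (fun x : σ × τ => (MvPolynomial.X x.1 : MvPolynomial σ K))
      (M.map MvPolynomial.C)).trans ?_
    refine Finset.sum_congr rfl fun s _ => ?_
    rw [RingHom.map_det]
    congr 2
    ext1 x y
    by_cases hx : x ∈ s
    · simp [hx]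
    · by_cases hxy : x = y
      · subst hxy
        simp [hx]
      · simp [hx, hxy, Matrix.one_apply]
  have hcoeff : ∀ (s : Finset (σ × τ)) (d : K), MvPolynomial.coeff (onesExp σ)
      ((∏ x ∈ s, MvPolynomial.X x.1) * MvPolynomial.C d) =
      if (∑ x ∈ s, Finsupp.single x.1 1) = onesExp σ then d else 0 := by
    intro s d
    have : (∏ x ∈ s, (MvPolynomial.X x.1 : MvPolynomial σ K)) =
        MvPolynomial.monomial (∑ x ∈ s, Finsupp.single x.1 1) 1 := by
      rw [MvPolynomial.monomial_sum_one]
      rfl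
    rw [this, mul_comm, MvPolynomial.C_mul_monomial, MvPolynomial.coeff_monomial, mul_one]
  rw [h1, MvPolynomial.coeff_sum]
  simp only [hcoeff]
  have hinj : ∀ c : σ → τ, Function.Injective fun a => (a, c a) := fun c a b h =>
    congrArg Prod.fst h
  refine (Finset.sum_of_injOn (fun c : σ → τ => Finset.univ.image fun a => (a, c a))
    ?_ ?_ ?_ ?_).symm
  · intro c _ c' _ h
    funext a
    have : (a, c a) ∈ Finset.univ.image fun a => (a, c' a) := by
      simp only at h
      rw [← h]
      simp
    simp only [Finset.mem_image, Finset.mem_univ, true_and, Prod.mk.injEq] at this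
    obtain ⟨b, rfl, hb⟩ := this
    exact hb.symm
  · intro c _
    simp
  · intro s _ hs
    rw [if_neg]
    intro h
    apply hs
    have hcard : ∀ a, (s.filter fun x => x.1 = a).card = 1 := by
      intro a
      have := DFunLike.congr_fun h a
      simp only [Finsupp.coe_finsetSum, Finset.sum_apply, Finsupp.single_apply, onesExp,
        Finsupp.equivFunOnFinite_symm_apply_apply] at this
      rw [Finset.card_filter]
      exact this
    have hex : ∀ a, ∃ b, (a, b) ∈ s ∧ ∀ b', (a, b') ∈ s → b' = b := by
      intro a
      obtain ⟨⟨a', b⟩, hb⟩ := Finset.card_eq_one.1 (hcard a)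
      have h1 : (a', b) ∈ s.filter fun x => x.1 = a := by rw [hb]; simp
      rw [Finset.mem_filter] at h1
      obtain ⟨h1, h1'⟩ := h1
      simp only at h1'
      subst h1'
      refine ⟨b, h1, fun b' hb' => ?_⟩
      have h2 : (a', b') ∈ s.filter fun x => x.1 = a' := by simp [hb']
      rw [hb] at h2
      simpa using h2
    choose c hc hc' using hex
    refine ⟨c, by simp, ?_⟩
    ext ⟨a, b⟩
    simp only [Finset.mem_image, Finset.mem_univ, true_and, Prod.mk.injEq]
    constructor
    · rintro ⟨a', rfl, rfl⟩
      exact hc _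
    · intro hab
      exact ⟨a, rfl, (hc' a b hab).symm⟩
  · intro c _
    rw [if_pos]
    · exact (det_piecewise_one M _ _ (hinj c) rfl).symm
    · rw [Finset.sum_image fun a _ b _ h => hinj c h]
      ext a
      simp [onesExp, Finsupp.single_apply]

omit [Fintype σ] in
-- Without a constant term, `B ^ j` has no monomials of degree below `j`.
theorem coeff_pow_eq_zero {B : MvPolynomial σ K} (hB : MvPolynomial.coeff 0 B = 0) (j : ℕ) :
    ∀ d : σ →₀ ℕ, d.degree < j → MvPolynomial.coeff d (B ^ j) = 0 := by
  induction j with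
  | zero => intro d hd; omega
  | succ j ih =>
    intro d hd
    rw [pow_succ, MvPolynomial.coeff_mul]
    refine Finset.sum_eq_zero fun p hp => ?_
    replace hp : p.1 + p.2 = d := by simpa using hp
    by_cases h : p.2 = 0
    · rw [h, hB, mul_zero]
    · rw [ih p.1, zero_mul]
      have h1 : p.1.degree + p.2.degree = d.degree := by rw [← hp, map_add]
      have h2 : p.2.degree ≠ 0 := by rwa [Ne, Finsupp.degree_eq_zero_iff]
      omega

omit [Fintype σ] in
-- Binomial expansion of (1 + B)^m with `B = P - 1`: the coefficients `m.choose j` are polynomials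
-- in `m`, and by `coeff_pow_eq_zero` only the terms with `j` at most the degree of `d` contribute.
theorem exists_polynomial_coeff_pow [CharZero K] {P : MvPolynomial σ K}
    (hP : MvPolynomial.coeff 0 P = 1) (d : σ →₀ ℕ) :
    ∃ p : Polynomial K, ∀ m : ℕ, p.eval (m : K) = MvPolynomial.coeff d (P ^ m) := by
  set B := P - 1 with hB
  have hB0 : MvPolynomial.coeff 0 B = 0 := by simp [hB, hP]
  refine ⟨∑ j ∈ Finset.range (d.degree + 1),
    Polynomial.C (MvPolynomial.coeff d (B ^ j) * ((j ! : ℕ) : K)⁻¹) * descPochhammer K j, fun m => ?_⟩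
  have hPB : P = B + 1 := by rw [hB]; ring
  have h1 : MvPolynomial.coeff d (P ^ m) =
      ∑ j ∈ Finset.range (m + 1), MvPolynomial.coeff d (B ^ j) * (m.choose j : K) := by
    rw [hPB, add_pow, MvPolynomial.coeff_sum]
    refine Finset.sum_congr rfl fun j _ => ?_
    rw [one_pow, mul_one, ← map_natCast (MvPolynomial.C (σ := σ) (R := K)), mul_comm,
      MvPolynomial.coeff_C_mul, mul_comm]
  have h2 : ∑ j ∈ Finset.range (m + 1), MvPolynomial.coeff d (B ^ j) * (m.choose j : K) =
      ∑ j ∈ Finset.range (m + 1 + (d.degree + 1)), MvPolynomial.coeff d (B ^ j) * (m.choose j : K) := by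
    refine Finset.sum_subset (Finset.range_mono (by omega)) fun j _ hj => ?_
    rw [Finset.mem_range, not_lt] at hj
    rw [Nat.choose_eq_zero_of_lt (by omega)]
    simp
  have h3 : ∑ j ∈ Finset.range (d.degree + 1), MvPolynomial.coeff d (B ^ j) * (m.choose j : K) =
      ∑ j ∈ Finset.range (m + 1 + (d.degree + 1)), MvPolynomial.coeff d (B ^ j) * (m.choose j : K) := by
    refine Finset.sum_subset (Finset.range_mono (by omega)) fun j _ hj => ?_
    rw [Finset.mem_range, not_lt] at hj
    rw [coeff_pow_eq_zero hB0 j d (by omega), zero_mul]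
  rw [h1, h2, ← h3, Polynomial.eval_finsetSum]
  refine Finset.sum_congr rfl fun j _ => ?_
  rw [Polynomial.eval_mul, Polynomial.eval_C, descPochhammer_eval_eq_descFactorial,
    Nat.descFactorial_eq_factorial_mul_choose]
  have : ((j ! : ℕ) : K) ≠ 0 := Nat.cast_ne_zero.2 j.factorial_ne_zero
  push_cast
  field_simp

/-- If `P(u)² = det (1 + u Q)` and `P(0) = 1`, the coefficient of `∏ u_a` in `P` is a sum over
permutations in which every cycle carries a factor `1 / 2`. -/
theorem coeff_ones_of_sq_eq_det [CharZero K] {k : ℕ} {ι : Type*} [Fintype ι] [DecidableEq ι]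
    (A : Matrix (Fin k × ι) (Fin k × ι) K) (P : MvPolynomial (Fin k) K)
    (hP : MvPolynomial.coeff 0 P = 1)
    (hsq : P ^ 2 = Matrix.det (1 + Matrix.of fun x y =>
      (MvPolynomial.X x.1 * MvPolynomial.C (A x y) : MvPolynomial (Fin k) K))) :
    MvPolynomial.coeff (onesExp (Fin k)) P = ∑ π : Equiv.Perm (Fin k),
      ((Equiv.Perm.sign π : ℤ) : K) * ((1 / 2) ^ (cycleReps π).card *
        ∑ i : Fin k → ι, ∏ a, A (a, i a) (π a, i (π a))) := by
  obtain ⟨p, hp⟩ := exists_polynomial_coeff_pow hP (onesExp (Fin k))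
  set q : Polynomial K := ∑ π : Equiv.Perm (Fin k), Polynomial.C (((Equiv.Perm.sign π : ℤ) : K) *
    ((1 / 2) ^ (cycleReps π).card * ∑ i : Fin k → ι, ∏ a, A (a, i a) (π a, i (π a)))) *
      Polynomial.X ^ (cycleReps π).card with hq
  -- For even exponents P^{2m} = det(1 + uQ)^m is the determinant of `m` diagonal copies, to which
  -- `coeff_ones_det_one_add` applies with labels in `ι × Fin m`.
  have key : ∀ m : ℕ, p.eval ((2 * m : ℕ) : K) = q.eval ((2 * m : ℕ) : K) := by
    intro m
    rw [hp, pow_mul, hsq]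
    have h1 : (Matrix.det (1 + Matrix.of fun x y =>
        (MvPolynomial.X x.1 * MvPolynomial.C (A x y) : MvPolynomial (Fin k) K))) ^ m =
        Matrix.det (1 + Matrix.of fun (x y : Fin k × (ι × Fin m)) =>
          (MvPolynomial.X x.1 * MvPolynomial.C (if x.2.2 = y.2.2 then
            A (x.1, x.2.1) (y.1, y.2.1) else 0) : MvPolynomial (Fin k) K)) := by
      set B := 1 + Matrix.of fun x y =>
        (MvPolynomial.X x.1 * MvPolynomial.C (A x y) : MvPolynomial (Fin k) K) with hB
      have h3 : B.det ^ m = (Matrix.blockDiagonal fun _ : Fin m => B).det := by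
        rw [Matrix.det_blockDiagonal, Finset.prod_const, Finset.card_fin]
      rw [h3, ← Matrix.det_submatrix_equiv_self (Equiv.prodAssoc (Fin k) ι (Fin m))]
      refine congrArg Matrix.det (Matrix.ext fun x y => ?_)
      obtain ⟨⟨a, i⟩, r⟩ := x
      obtain ⟨⟨b, j⟩, s⟩ := y
      simp only [hB, Matrix.blockDiagonal_apply, Matrix.add_apply, Matrix.of_apply,
        Matrix.submatrix_apply, Equiv.prodAssoc_apply, Matrix.one_apply, Prod.mk.injEq]
      by_cases h : r = s <;> simp [h]
    rw [h1]
    refine (coeff_ones_det_one_add (Matrix.of fun (x y : Fin k × (ι × Fin m)) =>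
      if x.2.2 = y.2.2 then A (x.1, x.2.1) (y.1, y.2.1) else 0)).trans ?_
    -- Transposition makes the entries run from `a` to `π a`, the direction in which the cycle
    -- products are read.
    simp only [← Matrix.det_transpose (Matrix.submatrix _ _ _), Matrix.det_apply']
    rw [Finset.sum_comm, hq, Polynomial.eval_finsetSum]
    refine Finset.sum_congr rfl fun π _ => ?_
    rw [← Finset.mul_sum, Polynomial.eval_mul, Polynomial.eval_C, Polynomial.eval_pow,
      Polynomial.eval_X, mul_assoc, mul_right_comm, ← mul_pow]
    -- The label of the copy must be constant along each cycle, so a cycle gains the factor m, which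
    -- is half of the exponent 2m.
    have h2 : (1 / 2 : K) * ((2 * m : ℕ) : K) = (Fintype.card (Fin m) : K) := by
      rw [Fintype.card_fin]; push_cast; ring
    rw [h2, ← sum_constant_on_cycles (R := K) π, Finset.sum_mul_sum, Finset.sum_comm,
      ← Fintype.sum_prod_type']
    congr 1
    refine Fintype.sum_equiv (Equiv.arrowProdEquivProdArrow _ _ _) _ _ fun c => ?_
    rw [← Finset.prod_mul_distrib]
    refine Finset.prod_congr rfl fun a _ => ?_
    simp only [Matrix.transpose_apply, Matrix.submatrix_apply, Matrix.of_apply,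
      Equiv.arrowProdEquivProdArrow, Equiv.coe_fn_mk]
    change (if (c a).2 = (c (π a)).2 then _ else _) =
      (if (c a).2 = (c (π a)).2 then (1 : K) else 0) * _
    split_ifs <;> simp
  -- Agreement at all even natural numbers makes the polynomials equal; the exponent of interest, 1,
  -- is not among these numbers.
  have hpq : p = q := by
    refine Polynomial.eq_of_infinite_eval_eq p q ?_
    refine Set.Infinite.mono (s := Set.range fun m : ℕ => ((2 * m : ℕ) : K)) ?_ ?_
    · rintro _ ⟨m, rfl⟩
      exact key m
    · refine Set.infinite_range_of_injective fun a b h => ?_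
      have := Nat.cast_injective (R := K) h
      omega
  have h1 := hp 1
  rw [pow_one] at h1
  rw [← h1, hpq, hq, Polynomial.eval_finsetSum]
  refine Finset.sum_congr rfl fun π _ => ?_
  rw [Polynomial.eval_mul, Polynomial.eval_C, Polynomial.eval_pow, Polynomial.eval_X, Nat.cast_one,
    one_pow, mul_one]

end DetSqrt

/-! ### Pfaffians -/

section Pfaffian

variable {ι κ R : Type*} [Fintype ι] [DecidableEq ι] [Fintype κ] [DecidableEq κ] [CommRing R]

/-- `2ⁿ n!` times the Pfaffian of an alternating matrix whose index set is paired by `e`. -/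
def pfSum (e : ι × Fin 2 ≃ κ) (A : Matrix κ κ R) : R :=
  ∑ σ : Equiv.Perm κ, ((Equiv.Perm.sign σ : ℤ) : R) * ∏ k, A (σ (e (k, 0))) (σ (e (k, 1)))

omit [DecidableEq ι] in
theorem pfSum_submatrix (e : ι × Fin 2 ≃ κ) (A : Matrix κ κ R) (τ : Equiv.Perm κ) :
    pfSum e (A.submatrix τ τ) = ((Equiv.Perm.sign τ : ℤ) : R) * pfSum e A := by
  unfold pfSum
  rw [Finset.mul_sum]
  refine Fintype.sum_equiv (Equiv.mulLeft τ) _ _ fun σ => ?_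
  simp only [Matrix.submatrix_apply, Equiv.coe_mulLeft, Equiv.Perm.sign_mul, Equiv.Perm.mul_apply,
    Units.val_mul, Int.cast_mul]
  rw [← mul_assoc, ← mul_assoc, ← Int.cast_mul, ← Units.val_mul, Int.units_mul_self]
  simp

omit [DecidableEq ι] [DecidableEq κ] in
theorem prod_pairs (e : ι × Fin 2 ≃ κ) (g : κ → R) :
    ∏ i, g i = ∏ k, (g (e (k, 0)) * g (e (k, 1))) := by
  rw [← e.prod_comp, Fintype.prod_prod_type]
  simp [Fin.prod_univ_two]

/-- Expanding `B A Bᵀ` gives a sum over all maps `f` from `κ` to itself, weighted by the determinant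
of the columns of `B` selected by `f`. Repeated columns remove all `f` but the permutations. -/
theorem pfSum_mul_mul_transpose (e : ι × Fin 2 ≃ κ) (A B : Matrix κ κ R) :
    pfSum e (B * A * B.transpose) = B.det * pfSum e A := by
  have h1 : ∀ σ : Equiv.Perm κ, ∏ k, (B * A * B.transpose) (σ (e (k, 0))) (σ (e (k, 1))) =
      ∑ f : κ → κ, (∏ k, A (f (e (k, 0))) (f (e (k, 1)))) * ∏ i, B (σ i) (f i) := by
    intro σ
    have h2 : ∀ i j, (B * A * B.transpose) i j = ∑ g : Fin 2 → κ, A (g 0) (g 1) * (B i (g 0) * B j (g 1)) := by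
      intro i j
      rw [← (finTwoArrowEquiv κ).symm.sum_comp, Fintype.sum_prod_type_right]
      simp only [Matrix.mul_apply, Matrix.transpose_apply, Finset.sum_mul]
      refine Finset.sum_congr rfl fun p _ => Finset.sum_congr rfl fun q _ => ?_
      simp [finTwoArrowEquiv]
      ring
    simp only [h2]
    have h3 := Finset.prod_univ_sum (R := R) (fun _ : ι => (Finset.univ : Finset (Fin 2 → κ)))
      (fun k g => A (g 0) (g 1) * (B (σ (e (k, 0))) (g 0) * B (σ (e (k, 1))) (g 1)))
    rw [Fintype.piFinset_univ] at h3
    rw [h3]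
    refine Fintype.sum_equiv ((Equiv.curry ι (Fin 2) κ).symm.trans (e.arrowCongr (Equiv.refl κ)))
      _ _ fun g => ?_
    rw [prod_pairs e, ← Finset.prod_mul_distrib]
    refine Finset.prod_congr rfl fun k _ => ?_
    simp [Equiv.arrowCongr]
  unfold pfSum
  simp only [h1, Finset.mul_sum]
  rw [Finset.sum_comm]
  have h4 : ∀ f : κ → κ, ∑ σ : Equiv.Perm κ, ((Equiv.Perm.sign σ : ℤ) : R) *
      ((∏ k, A (f (e (k, 0))) (f (e (k, 1)))) * ∏ i, B (σ i) (f i)) =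
      (∏ k, A (f (e (k, 0))) (f (e (k, 1)))) * (B.submatrix id f).det := by
    intro f
    rw [Matrix.det_apply', Finset.mul_sum]
    refine Finset.sum_congr rfl fun σ _ => ?_
    simp
    ring
  simp only [h4]
  symm
  refine Finset.sum_of_injOn (fun σ : Equiv.Perm κ => (σ : κ → κ)) ?_ ?_ ?_ ?_
  · intro σ _ τ _ h
    exact DFunLike.coe_injective h
  · intro _ _
    simp
  · intro f _ hf
    have hni : ¬ Function.Injective f := by
      intro hi
      exact hf ⟨Equiv.ofBijective f (Finite.injective_iff_bijective.1 hi), by simp, rfl⟩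
    simp only [Function.Injective, not_forall] at hni
    obtain ⟨i, j, hij, hne⟩ := hni
    rw [Matrix.det_zero_of_column_eq hne, mul_zero]
    intro l
    simp [hij]
  · intro σ _
    rw [Matrix.det_permute']
    ring

/-- The standard symplectic `2 × 2` matrix. -/
def symplTwo (a b : Fin 2) : ℤ := if a < b then 1 else if b < a then -1 else 0

/-- The block diagonal matrix with blocks `d_k` times the standard symplectic matrix. -/
def symplDiag (e : ι × Fin 2 ≃ κ) (d : ι → R) : Matrix κ κ R :=
  Matrix.of fun i j => if (e.symm i).1 = (e.symm j).1 then
    d (e.symm i).1 * (symplTwo (e.symm i).2 (e.symm j).2 : ℤ) else 0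

theorem symplTwo_perm (f : Equiv.Perm (Fin 2)) :
    symplTwo (f 0) (f 1) = (Equiv.Perm.sign f : ℤ) := by
  revert f
  decide

/-- Only permutations that carry pairs to pairs contribute. They consist of a permutation of the
pairs, which is even because it moves both members at once, and of a permutation inside each pair,
whose sign is cancelled by `symplTwo`. There are `2 ^ n * n !` of them for `n` pairs. -/
theorem pfSum_symplDiag (e : ι × Fin 2 ≃ κ) (d : ι → R) :
    pfSum e (symplDiag e d) = 2 ^ Fintype.card ι * (Fintype.card ι)! * ∏ k, d k := by
  let G : Equiv.Perm ι × (ι → Equiv.Perm (Fin 2)) → Equiv.Perm κ := fun p =>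
    e.permCongr ((Equiv.prodCongrLeft fun _ : Fin 2 => p.1) * Equiv.prodCongrRight p.2)
  have hG : ∀ p k a, e.symm (G p (e (k, a))) = (p.1 k, p.2 k a) := by
    intro p k a
    simp [G, Equiv.permCongr_apply, Equiv.prodCongrLeft, Equiv.prodCongrRight]
  have hsign : ∀ p, ((Equiv.Perm.sign (G p) : ℤˣ)) = ∏ k, Equiv.Perm.sign (p.2 k) := by
    intro p
    simp only [G, Equiv.Perm.sign_permCongr, Equiv.Perm.sign_mul, Equiv.Perm.sign_prodCongrLeft,
      Equiv.Perm.sign_prodCongrRight, Finset.prod_const, Finset.card_univ, Fintype.card_fin]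
    rw [sq, Int.units_mul_self, one_mul]
  have hsum : ∑ p : Equiv.Perm ι × (ι → Equiv.Perm (Fin 2)), ∏ k, d k =
      pfSum e (symplDiag e d) := by
    refine Finset.sum_of_injOn G ?_ ?_ ?_ ?_
    · intro p _ q _ h
      have h1 : ∀ k a, (p.1 k, p.2 k a) = (q.1 k, q.2 k a) := by
        intro k a
        rw [← hG, ← hG, h]
      refine Prod.ext (Equiv.ext fun k => (Prod.ext_iff.1 (h1 k 0)).1)
        (funext fun k => Equiv.ext fun a => (Prod.ext_iff.1 (h1 k a)).2)
    · intro _ _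
      simp
    · intro σ _ hσ
      by_cases hp : ∀ k, (e.symm (σ (e (k, 0)))).1 = (e.symm (σ (e (k, 1)))).1
      · exfalso
        apply hσ
        have hp' : ∀ k a, (e.symm (σ (e (k, a)))).1 = (e.symm (σ (e (k, 0)))).1 := by
          intro k a
          fin_cases a
          · rfl
          · exact (hp k).symm
        have hτ : Function.Surjective fun k => (e.symm (σ (e (k, 0)))).1 := by
          intro m
          refine ⟨(e.symm (σ.symm (e (m, 0)))).1, ?_⟩
          simp only
          rw [← hp' _ (e.symm (σ.symm (e (m, 0)))).2]
          simp
        have hf : ∀ k, Function.Injective fun a => (e.symm (σ (e (k, a)))).2 := by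
          intro k a b hab
          have h2 : e.symm (σ (e (k, a))) = e.symm (σ (e (k, b))) :=
            Prod.ext ((hp' k a).trans (hp' k b).symm) hab
          have h3 := e.injective (σ.injective (e.symm.injective h2))
          exact (Prod.ext_iff.1 h3).2
        refine ⟨⟨Equiv.ofBijective _ (Finite.surjective_iff_bijective.1 hτ),
          fun k => Equiv.ofBijective _ (Finite.injective_iff_bijective.1 (hf k))⟩, by simp, ?_⟩
        refine Equiv.ext fun i => e.symm.injective ?_
        obtain ⟨⟨k, a⟩, rfl⟩ := e.surjective i
        rw [hG]
        exact Prod.ext (hp' k a).symm rfl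
      · push Not at hp
        obtain ⟨k, hk⟩ := hp
        have : ∏ k, symplDiag e d (σ (e (k, 0))) (σ (e (k, 1))) = 0 :=
          Finset.prod_eq_zero (Finset.mem_univ k) (by simp [symplDiag, hk])
        rw [this, mul_zero]
    · intro p _
      rw [hsign]
      simp only [symplDiag, Matrix.of_apply, hG, if_true, symplTwo_perm]
      rw [Finset.prod_mul_distrib, Units.coe_prod, Int.cast_prod, mul_left_comm,
        ← Finset.prod_mul_distrib]
      have : ∀ k, ((Equiv.Perm.sign (p.2 k) : ℤ) : R) * ((Equiv.Perm.sign (p.2 k) : ℤ) : R) = 1 := by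
        intro k
        rw [← Int.cast_mul, ← Units.val_mul, Int.units_mul_self]
        simp
      simp only [this, Finset.prod_const_one, mul_one]
      exact (Equiv.prod_comp p.1 d).symm
  rw [← hsum]
  simp only [Finset.sum_const, Finset.card_univ, Fintype.card_prod, Fintype.card_perm,
    Fintype.card_fun, Fintype.card_fin, nsmul_eq_mul]
  push_cast
  simp [Nat.factorial]
  ring

theorem det_symplDiag (e : ι × Fin 2 ≃ κ) (d : ι → R) :
    (symplDiag e d).det = ∏ k, d k ^ 2 := by
  rw [← Matrix.det_submatrix_equiv_self ((Equiv.prodComm _ _).trans e)]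
  have : (symplDiag e d).submatrix ((Equiv.prodComm (Fin 2) ι).trans e)
      ((Equiv.prodComm (Fin 2) ι).trans e) =
      Matrix.blockDiagonal fun k => !![0, d k; -d k, 0] := by
    ext ⟨a, k⟩ ⟨b, l⟩
    simp only [symplDiag, Matrix.submatrix_apply, Matrix.of_apply, Matrix.blockDiagonal_apply,
      Equiv.trans_apply, Equiv.prodComm_apply, Prod.swap_prod_mk, Equiv.symm_apply_apply]
    by_cases h : k = l
    · fin_cases a <;> fin_cases b <;> simp [h, symplTwo]
    · simp [h]
  rw [this, Matrix.det_blockDiagonal]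
  simp [Matrix.det_fin_two, sq]

/-- The alternating matrix with entries `1` above the diagonal. -/
def signMatrix (k : ℕ) : Matrix (Fin k) (Fin k) R :=
  Matrix.of fun i j => if i < j then 1 else if j < i then -1 else 0

/-- The sign matrix is `B J Bᵀ` with `J` the standard symplectic matrix and `B` lower unitriangular,
so its Pfaffian is 1. -/
theorem pfSum_signMatrix (n : ℕ) :
    pfSum (finProdFinEquiv : Fin n × Fin 2 ≃ Fin (n * 2)) (signMatrix (R := R) (n * 2)) =
      2 ^ n * n ! := by
  let e : Fin n × Fin 2 ≃ Fin (n * 2) := finProdFinEquiv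
  -- A row of `B` is the identity in its own pair and (-1, 1) in all earlier pairs. Two such rows
  -- have skew product 0 on pairs preceding both and 1 on the pair of the smaller row, if the pairs
  -- differ.
  let B' : Fin n × Fin 2 → Fin n × Fin 2 → R := fun p q =>
    if p.1 = q.1 then (if p.2 = q.2 then 1 else 0) else
      if q.1 < p.1 then (if q.2 = 0 then -1 else 1) else 0
  let B : Matrix (Fin (n * 2)) (Fin (n * 2)) R := Matrix.of fun i j => B' (e.symm i) (e.symm j)
  have hlt : ∀ p q : Fin n × Fin 2, e p < e q ↔ p.1 < q.1 ∨ (p.1 = q.1 ∧ p.2 < q.2) := by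
    rintro ⟨k, a⟩ ⟨l, b⟩
    have ha := a.2
    have hb := b.2
    simp only [e, finProdFinEquiv, Equiv.coe_fn_mk, Fin.lt_def, Fin.ext_iff]
    omega
  have hdet : B.det = 1 := by
    rw [Matrix.det_of_isLowerTriangular]
    · refine Finset.prod_eq_one fun i _ => ?_
      simp [B, B']
    · intro i j hij
      obtain ⟨p, rfl⟩ := e.surjective i
      obtain ⟨q, rfl⟩ := e.surjective j
      have hij' : e p < e q := hij
      rw [hlt] at hij'
      simp only [B, Matrix.of_apply, Equiv.symm_apply_apply, B']
      rcases hij' with h | ⟨h, h'⟩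
      · rw [if_neg h.ne, if_neg h.not_gt]
      · rw [if_pos h, if_neg h'.ne]
  have hO : signMatrix (R := R) (n * 2) = B * symplDiag e (fun _ => (1 : R)) * B.transpose := by
    ext i j
    obtain ⟨p, rfl⟩ := e.surjective i
    obtain ⟨q, rfl⟩ := e.surjective j
    have h1 : (B * symplDiag e (fun _ => (1 : R)) * B.transpose) (e p) (e q) =
        ∑ l : Fin n, (B' p (l, 0) * B' q (l, 1) - B' p (l, 1) * B' q (l, 0)) := by
      simp only [Matrix.mul_apply, Matrix.transpose_apply]
      rw [← e.sum_comp, Fintype.sum_prod_type]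
      refine Finset.sum_congr rfl fun l _ => ?_
      simp only [← e.sum_comp, Fintype.sum_prod_type, Fin.sum_univ_two, symplDiag, Matrix.of_apply,
        B, Equiv.symm_apply_apply]
      simp [symplTwo]
      ring
    rw [h1]
    simp only [signMatrix, Matrix.of_apply, hlt]
    obtain ⟨k, a⟩ := p
    obtain ⟨k', a'⟩ := q
    rcases lt_trichotomy k k' with h | h | h
    · rw [Finset.sum_eq_single k]
      · fin_cases a <;> simp [B', h, h.ne']
      · intro l _ hl
        simp only [B', hl.symm, if_false]
        by_cases hlk : l < k
        · simp [hlk, hlk.trans h, (hlk.trans h).ne']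
        · simp [hlk]
      · simp
    · subst h
      rw [Finset.sum_eq_single k]
      · fin_cases a <;> fin_cases a' <;> simp [B']
      · intro l _ hl
        simp only [B', hl.symm, if_false]
        by_cases hlk : l < k
        · simp [hlk]
        · simp [hlk]
      · simp
    · rw [Finset.sum_eq_single k']
      · fin_cases a' <;> simp [B', h, h.ne', h.not_gt]
      · intro l _ hl
        simp only [B', hl.symm, if_false]
        by_cases hlk : l < k'
        · simp [hlk, hlk.trans h, (hlk.trans h).ne']
        · simp [hlk]
      · simp
  rw [hO, pfSum_mul_mul_transpose, hdet, one_mul, pfSum_symplDiag]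
  simp

end Pfaffian

/-! ### Symplectic bases and the square of the Pfaffian -/

section SymplecticBasis

variable {K V : Type*} [Field K] [AddCommGroup V] [Module K V] [FiniteDimensional K V]

/-- Symplectic Gram–Schmidt. The dimension leaves a nonzero `x` orthogonal to the pairs already
found; nondegeneracy provides a partner, which is normalized and then corrected. -/
theorem exists_symplectic_family (ω : LinearMap.BilinForm K V) (halt : ω.IsAlt)
    (hnd : ∀ x, x ≠ 0 → ∃ w, ω x w ≠ 0) (m : ℕ) (hm : m * 2 ≤ Module.finrank K V) :
    ∃ v : Fin m → Fin 2 → V, ∀ k a l b,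
      ω (v k a) (v l b) = if k = l then ((symplTwo a b : ℤ) : K) else 0 := by
  induction m with
  | zero => exact ⟨fun k => k.elim0, fun k => k.elim0⟩
  | succ m ih =>
    obtain ⟨v, hv⟩ := ih (by omega)
    let T : V →ₗ[K] (Fin m × Fin 2 → K) := LinearMap.pi fun p => ω (v p.1 p.2)
    have hker : LinearMap.ker T ≠ ⊥ := by
      apply LinearMap.ker_ne_bot_of_finrank_lt
      simp
      omega
    obtain ⟨x, hx, hx0⟩ := Submodule.exists_mem_ne_zero_of_ne_bot hker
    have hvx : ∀ k a, ω (v k a) x = 0 := fun k a =>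
      congrFun (LinearMap.mem_ker.1 hx) (k, a)
    have hxv : ∀ k a, ω x (v k a) = 0 := fun k a => by
      rw [← LinearMap.BilinForm.IsAlt.neg_eq halt, hvx, neg_zero]
    obtain ⟨w0, hw0⟩ := hnd x hx0
    set w1 := (ω x w0)⁻¹ • w0 with hw1
    have hxw1 : ω x w1 = 1 := by simp [hw1, hw0]
    -- The components along the earlier pairs are removed. As `x` is orthogonal to these pairs, its
    -- product with the partner remains 1.
    set w := w1 - ∑ k, (ω (v k 0) w1 • v k 1 - ω (v k 1) w1 • v k 0) with hw
    have hxw : ω x w = 1 := by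
      simp [hw, hxw1, hxv]
    have hvw : ∀ k a, ω (v k a) w = 0 := by
      intro k a
      simp only [hw, map_sub, map_sum, map_smul, hv, smul_eq_mul]
      rw [Finset.sum_eq_single k]
      · fin_cases a <;> simp [symplTwo]
      · intro l _ hl
        simp [hl.symm]
      · simp
    have hwv : ∀ k a, ω w (v k a) = 0 := fun k a => by
      rw [← LinearMap.BilinForm.IsAlt.neg_eq halt, hvw, neg_zero]
    have hwx : ω w x = -1 := by rw [← LinearMap.BilinForm.IsAlt.neg_eq halt, hxw]
    refine ⟨Fin.snoc v ![x, w], ?_⟩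
    intro k a l b
    induction k using Fin.lastCases with
    | last =>
      induction l using Fin.lastCases with
      | last =>
        fin_cases a <;> fin_cases b <;> simp [symplTwo, hxw, hwx, halt.self_eq_zero]
      | cast l =>
        rw [if_neg (Fin.castSucc_lt_last l).ne']
        fin_cases a <;> simp [hxv, hwv]
    | cast k =>
      induction l using Fin.lastCases with
      | last =>
        rw [if_neg (Fin.castSucc_lt_last k).ne]
        fin_cases b <;> simp [hvx, hvw]
      | cast l => simp [hv]

/-- A symplectic basis gives `B` with B A Bᵀ = J. Then det B times the Pfaffian sum of `A` is `2 ^ n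
* n !`, and (det B)² det A = 1; eliminating det B gives the claim. -/
theorem pfSum_sq [CharZero K] {κ : Type*} [Fintype κ] [DecidableEq κ] {n : ℕ} (e : Fin n × Fin 2 ≃ κ)
    (A : Matrix κ κ K) (hA : ∀ i j, A j i = -A i j) (hdet : A.det ≠ 0) :
    pfSum e A ^ 2 = (2 ^ n * n !) ^ 2 * A.det := by
  have halt : (Matrix.toBilin' A).IsAlt := by
    intro x
    rw [Matrix.toBilin'_apply]
    have h1 : ∑ i, ∑ j, x i * A i j * x j = -∑ i, ∑ j, x i * A i j * x j := by
      conv_lhs => rw [Finset.sum_comm]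
      rw [← Finset.sum_neg_distrib]
      refine Finset.sum_congr rfl fun i _ => ?_
      rw [← Finset.sum_neg_distrib]
      refine Finset.sum_congr rfl fun j _ => ?_
      rw [hA i j]
      ring
    exact self_eq_neg.1 h1
  have hnd : ∀ x : κ → K, x ≠ 0 → ∃ w, Matrix.toBilin' A x w ≠ 0 := by
    intro x hx
    by_contra! h
    apply hx
    apply Matrix.eq_zero_of_vecMul_eq_zero hdet
    funext j
    have := h (Pi.single j 1)
    rw [Matrix.toBilin'_apply', Matrix.dotProduct_mulVec] at this
    simpa using this
  have hcard : Fintype.card κ = n * 2 := by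
    rw [← Fintype.card_congr e]; simp
  obtain ⟨v, hv⟩ := exists_symplectic_family (Matrix.toBilin' A) halt hnd n (by simp [hcard])
  let B : Matrix κ κ K := Matrix.of fun i => v (e.symm i).1 (e.symm i).2
  have hB : B * A * B.transpose = symplDiag e (fun _ => 1) := by
    ext i j
    rw [symplDiag, Matrix.of_apply, one_mul, ← hv, Matrix.toBilin'_apply]
    simp only [Matrix.mul_apply, Matrix.transpose_apply, Finset.sum_mul, B, Matrix.of_apply]
    rw [Finset.sum_comm]
  have h1 := pfSum_mul_mul_transpose e A B
  have h2 : (B * A * B.transpose).det = B.det ^ 2 * A.det := by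
    rw [Matrix.det_mul, Matrix.det_mul, Matrix.det_transpose]; ring
  rw [hB, pfSum_symplDiag] at h1
  rw [hB, det_symplDiag] at h2
  simp only [Finset.prod_const_one, mul_one, one_pow, Fintype.card_fin] at h1 h2
  have hBd : B.det ≠ 0 := by
    intro h
    rw [h] at h2
    simp at h2
  rw [h1]
  have : pfSum e A ^ 2 = (pfSum e A) ^ 2 * (B.det ^ 2 * A.det) := by rw [← h2, mul_one]
  rw [this]
  ring

end SymplecticBasis

/-! ### The determinant of a perturbed skew matrix -/

section DetIdentity

variable {κ α K : Type*} [Fintype κ] [DecidableEq κ] [Fintype α] [DecidableEq α] [Field K]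

open Matrix in
-- The perturbation is written as a product `Z * X` of a row and a column of two blocks. Sylvester's
-- identity moves the determinant to det(1 + X A₀⁻¹ Z), and a block triangular factor `L` of
-- determinant 1 turns this into the matrix with the kernel blocks. In the application `P` holds the
-- heat kernels between points at different times and `v` solves v = R + v U P.
theorem det_perturbed_skew (A₀ : Matrix κ κ K) (hA₀ : A₀.det ≠ 0) (R Φ v : Matrix κ α K)
    (U P F : Matrix α α K) (hU : Uᵀ = U) (hv : v * (1 - U * P) = R) (hP : (1 - U * P).det = 1) :
    (A₀ + Φ * U * vᵀ - v * U * Φᵀ + v * U * F * U * vᵀ).det =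
      A₀.det * (1 + fromBlocks U 0 0 U *
        fromBlocks (-(Φᵀ * A₀⁻¹ * R) - P) (Φᵀ * A₀⁻¹ * Φ + F)
          (-(Rᵀ * A₀⁻¹ * R)) (Rᵀ * A₀⁻¹ * Φ - Pᵀ)).det := by
  have hu : IsUnit A₀.det := isUnit_iff_ne_zero.2 hA₀
  have hD : (1 - U * Pᵀ).det = 1 := by
    have h1 : (1 - U * Pᵀ).det = (1 - P * U).det := by
      rw [← det_transpose (1 - P * U)]
      simp [hU]
    have h2 : (1 - P * U).det = (1 - U * P).det := by
      have := det_one_add_mul_comm (-P) U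
      simpa [sub_eq_add_neg] using this
    rw [h1, h2, hP]
  have hDu : IsUnit (1 - U * Pᵀ).det := by rw [hD]; exact isUnit_one
  -- This `z` is the solution of Z L = (-R, Φ): the factor `L` replaces the transported values `v`
  -- by the plain values `R`.
  set z := (Φ + v * U * F) * (1 - U * Pᵀ)⁻¹ with hz
  have hzD : z * (1 - U * Pᵀ) = Φ + v * U * F := by
    rw [hz, Matrix.mul_assoc, nonsing_inv_mul _ hDu, Matrix.mul_one]
  have hUv : (1 - U * Pᵀ) * (U * vᵀ) = U * Rᵀ := by
    rw [← hv]
    simp only [transpose_mul, transpose_sub, transpose_one, hU, Matrix.sub_mul, Matrix.mul_sub,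
      Matrix.one_mul, Matrix.mul_assoc]
  have hzR : z * (U * Rᵀ) = (Φ + v * U * F) * (U * vᵀ) := by
    rw [← hUv, ← Matrix.mul_assoc, hzD]
  set L := fromBlocks (1 - U * P) (U * F) 0 (1 - U * Pᵀ) with hL
  have hLdet : L.det = 1 := by
    rw [hL, det_fromBlocks_zero₂₁, hP, hD, one_mul]
  set X := fromRows (U * Φᵀ) (U * Rᵀ) with hX
  set Z := fromCols (-v) z with hZ
  have hZL : Z * L = fromCols (-R) Φ := by
    rw [hZ, hL, fromCols_mul_fromBlocks, hzD]
    congr 1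
    · rw [Matrix.mul_zero, add_zero, Matrix.neg_mul, hv]
    · rw [Matrix.neg_mul, ← Matrix.mul_assoc]
      abel
  have hZX : Z * X = Φ * U * vᵀ - v * U * Φᵀ + v * U * F * U * vᵀ := by
    rw [hZ, hX, fromCols_mul_fromRows, hzR]
    simp only [Matrix.neg_mul, Matrix.add_mul, Matrix.mul_assoc]
    abel
  have hmain : 1 + fromBlocks U 0 0 U *
        fromBlocks (-(Φᵀ * A₀⁻¹ * R) - P) (Φᵀ * A₀⁻¹ * Φ + F)
          (-(Rᵀ * A₀⁻¹ * R)) (Rᵀ * A₀⁻¹ * Φ - Pᵀ) = (1 + X * A₀⁻¹ * Z) * L := by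
    rw [Matrix.add_mul, Matrix.one_mul, Matrix.mul_assoc (X * A₀⁻¹), hZL, hX, hL, fromRows_mul,
      fromRows_mul_fromCols, fromBlocks_add, fromBlocks_multiply, ← fromBlocks_one, fromBlocks_add]
    congr 1 <;> simp only [Matrix.mul_sub, Matrix.mul_add, Matrix.mul_neg, Matrix.zero_mul,
      Matrix.mul_assoc] <;> abel
  rw [hmain, det_mul, hLdet, mul_one, Matrix.mul_assoc X, det_one_add_mul_comm,
    Matrix.mul_assoc A₀⁻¹, hZX, ← det_mul, Matrix.mul_add, Matrix.mul_one, ← Matrix.mul_assoc A₀,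
    mul_nonsing_inv _ hu, Matrix.one_mul]
  congr 1
  abel

/-- `P` leads only from smaller to larger values of `τ`, so the matrix is block triangular with
identity blocks on the diagonal. -/
theorem det_one_sub_mul_strictly_triangular {β : Type*} [LinearOrder β] (τ : α → β)
    (u : α → K) (P : Matrix α α K) (hP : ∀ a b, ¬ τ a < τ b → P a b = 0) :
    (1 - Matrix.diagonal u * P).det = 1 := by
  have hbt : (1 - Matrix.diagonal u * P).BlockTriangular τ := by
    intro a b hab
    have : a ≠ b := by rintro rfl; exact lt_irrefl _ hab
    simp [this, hP a b hab.not_gt]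
  rw [hbt.det]
  refine Finset.prod_eq_one fun c _ => ?_
  have h1 : (1 - Matrix.diagonal u * P).toSquareBlock τ c = 1 := by
    ext ⟨a, ha⟩ ⟨b, hb⟩
    simp [Matrix.toSquareBlock_def, Matrix.one_apply, hP a b (by rw [ha, hb]; exact lt_irrefl _)]
  rw [h1, Matrix.det_one]

end DetIdentity

/-! ### The heat semigroup -/

section Heat

theorem heat_eq_gaussianPDFReal {t : ℝ} (ht : 0 < t) (x y : ℝ) :
    heat t x y = gaussianPDFReal x t.toNNReal y := by
  rw [heat, gaussianPDFReal, Real.coe_toNNReal t ht.le, one_div]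
  congr 3
  ring

theorem heat_symm (t x y : ℝ) : heat t x y = heat t y x := by
  unfold heat
  congr 3
  ring

theorem heat_nonneg (t x y : ℝ) : 0 ≤ heat t x y := by
  unfold heat
  positivity

theorem heat_le {t : ℝ} (ht : 0 < t) (x y : ℝ) : heat t x y ≤ 1 / Real.sqrt (2 * Real.pi * t) := by
  unfold heat
  refine mul_le_of_le_one_right (by positivity) (Real.exp_le_one_iff.2 ?_)
  rw [neg_div]
  have : 0 ≤ (x - y) ^ 2 / (2 * t) := by positivity
  linarith

theorem measurable_heat (t : ℝ) : Measurable fun p : ℝ × ℝ => heat t p.1 p.2 := by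
  unfold heat
  fun_prop

theorem continuous_heat (t : ℝ) : Continuous fun p : ℝ × ℝ => heat t p.1 p.2 := by
  unfold heat
  fun_prop

theorem integrable_heat {t : ℝ} (ht : 0 < t) (x : ℝ) : Integrable fun y => heat t x y := by
  simp only [heat_eq_gaussianPDFReal ht]
  exact integrable_gaussianPDFReal x _

theorem integral_heat {t : ℝ} (ht : 0 < t) (x : ℝ) : ∫ y, heat t x y = 1 := by
  simp only [heat_eq_gaussianPDFReal ht]
  exact integral_gaussianPDFReal_eq_one x (by simpa using ht)

theorem integral_heatMeasure {t : ℝ} (ht : 0 < t) (x : ℝ) (g : ℝ → ℝ) :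
    ∫ y, g y ∂heatMeasure t x = ∫ y, heat t x y * g y := by
  rw [heatMeasure, integral_gaussianReal_eq_integral_smul (by simpa using ht)]
  simp only [heat_eq_gaussianPDFReal ht, smul_eq_mul]

instance (t x : ℝ) : IsProbabilityMeasure (heatMeasure t x) := by
  unfold heatMeasure
  infer_instance

theorem heatMeasure_zero (x : ℝ) : heatMeasure 0 x = Measure.dirac x := by
  simp [heatMeasure, gaussianReal_zero_var]

/-- Product of two heat kernels: the law of a Brownian bridge. -/
theorem heat_mul_heat {s t : ℝ} (hs : 0 < s) (ht : 0 < t) (x y z : ℝ) :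
    heat s x y * heat t y z =
      heat (s + t) x z * heat (s * t / (s + t)) ((t * x + s * z) / (s + t)) y := by
  have hst : 0 < s + t := add_pos hs ht
  unfold heat
  have h1 : Real.sqrt (2 * Real.pi * s) * Real.sqrt (2 * Real.pi * t) =
      Real.sqrt (2 * Real.pi * (s + t)) * Real.sqrt (2 * Real.pi * (s * t / (s + t))) := by
    rw [← Real.sqrt_mul (by positivity), ← Real.sqrt_mul (by positivity)]
    congr 1
    field_simp
  have h2 : Real.exp (-(x - y) ^ 2 / (2 * s)) * Real.exp (-(y - z) ^ 2 / (2 * t)) =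
      Real.exp (-(x - z) ^ 2 / (2 * (s + t))) *
        Real.exp (-((t * x + s * z) / (s + t) - y) ^ 2 / (2 * (s * t / (s + t)))) := by
    rw [← Real.exp_add, ← Real.exp_add]
    congr 1
    field_simp
    ring
  rw [mul_mul_mul_comm, h2, mul_mul_mul_comm (1 / Real.sqrt (2 * Real.pi * (s + t))),
    one_div_mul_one_div, one_div_mul_one_div, h1]

/-- Chapman–Kolmogorov: in the bridge factorization only the second factor depends on the
intermediate point, and it integrates to 1. -/
theorem integral_heat_mul_heat {s t : ℝ} (hs : 0 < s) (ht : 0 < t) (x z : ℝ) :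
    ∫ y, heat s x y * heat t y z = heat (s + t) x z := by
  simp only [heat_mul_heat hs ht]
  rw [integral_const_mul, integral_heat (by positivity), mul_one]

/-- The heat semigroup. -/
noncomputable def heatOp (t : ℝ) (g : ℝ → ℝ) (x : ℝ) : ℝ := ∫ y, g y ∂heatMeasure t x

theorem heatOp_zero (g : ℝ → ℝ) : heatOp 0 g = g := by
  funext x
  rw [heatOp, heatMeasure_zero, integral_dirac]

theorem heatOp_of_pos {t : ℝ} (ht : 0 < t) (g : ℝ → ℝ) (x : ℝ) :
    heatOp t g x = ∫ y, heat t x y * g y :=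
  integral_heatMeasure ht x g

theorem integrable_heat_mul {t : ℝ} (ht : 0 < t) {g : ℝ → ℝ} (hg : Integrable g) (x : ℝ) :
    Integrable fun y => heat t x y * g y := by
  refine hg.bdd_mul (c := 1 / Real.sqrt (2 * Real.pi * t)) ?_ ?_
  · exact ((measurable_heat t).comp measurable_prodMk_left).aestronglyMeasurable
  · refine Filter.Eventually.of_forall fun y => ?_
    rw [Real.norm_of_nonneg (heat_nonneg t x y)]
    exact heat_le ht x y

/-- Zero times are included because t_m - t₁ and T - t_m vanish at the first and last times; there
`heatOp` is the identity. -/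
theorem heatOp_heatOp {s t : ℝ} (hs : 0 ≤ s) (ht : 0 ≤ t) {g : ℝ → ℝ} (hg : Integrable g) (x : ℝ) :
    heatOp s (heatOp t g) x = heatOp (s + t) g x := by
  rcases hs.eq_or_lt with rfl | hs
  · rw [heatOp_zero, zero_add]
  rcases ht.eq_or_lt with rfl | ht
  · rw [heatOp_zero, add_zero]
  rw [heatOp_of_pos hs, heatOp_of_pos (add_pos hs ht)]
  simp only [heatOp_of_pos ht, ← integral_const_mul]
  rw [integral_integral_swap]
  · refine integral_congr_ae (Filter.Eventually.of_forall fun z => ?_)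
    simp only [← mul_assoc]
    rw [integral_mul_const, integral_heat_mul_heat hs ht]
  · have h1 : Integrable (fun p : ℝ × ℝ => heat s x p.1 * g p.2) (volume.prod volume) :=
      (integrable_heat hs x).mul_prod hg
    have h2 := h1.bdd_mul (f := fun p : ℝ × ℝ => heat t p.1 p.2)
      (c := 1 / Real.sqrt (2 * Real.pi * t))
      (measurable_heat t).aestronglyMeasurable (Filter.Eventually.of_forall fun p => by
        rw [Real.norm_of_nonneg (heat_nonneg t _ _)]
        exact heat_le ht _ _)
    refine h2.congr (Filter.Eventually.of_forall fun p => ?_)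
    simp only [Function.uncurry]
    ring

theorem integrable_heat_mul_prod {t : ℝ} (ht : 0 < t) {g : ℝ → ℝ} (hg : Integrable g) :
    Integrable (fun p : ℝ × ℝ => heat t p.1 p.2 * g p.2) (volume.prod volume) := by
  have hm : AEStronglyMeasurable (fun p : ℝ × ℝ => heat t p.1 p.2 * g p.2)
      (volume.prod volume) :=
    (measurable_heat t).aestronglyMeasurable.mul hg.aestronglyMeasurable.comp_snd
  rw [integrable_prod_iff' hm]
  constructor
  · refine Filter.Eventually.of_forall fun y => ?_
    simp only [heat_symm t _ y]
    exact (integrable_heat ht y).mul_const _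
  · refine hg.norm.congr (Filter.Eventually.of_forall fun y => ?_)
    simp only [norm_mul, Real.norm_of_nonneg (heat_nonneg t _ _)]
    rw [integral_mul_const]
    simp only [heat_symm t _ y]
    rw [integral_heat ht, one_mul]

theorem integrable_heatOp {t : ℝ} (ht : 0 ≤ t) {g : ℝ → ℝ} (hg : Integrable g) :
    Integrable (heatOp t g) := by
  rcases ht.eq_or_lt with rfl | ht
  · rwa [heatOp_zero]
  · have := (integrable_heat_mul_prod ht hg).integral_prod_left
    exact this.congr (Filter.Eventually.of_forall fun x => (heatOp_of_pos ht g x).symm)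

theorem measurable_heatOp {t : ℝ} (ht : 0 ≤ t) {g : ℝ → ℝ} (hg : Measurable g) :
    Measurable (heatOp t g) := by
  rcases ht.eq_or_lt with rfl | ht
  · rwa [heatOp_zero]
  · have h1 : StronglyMeasurable (fun p : ℝ × ℝ => heat t p.1 p.2 * g p.2) :=
      ((measurable_heat t).mul (hg.comp measurable_snd)).stronglyMeasurable
    have h2 := (h1.integral_prod_right' (ν := volume)).measurable
    convert h2 using 2 with x
    rw [heatOp_of_pos ht]

/-- The heat semigroup is symmetric. -/
theorem integral_heatOp_mul {t : ℝ} (ht : 0 ≤ t) {g ψ : ℝ → ℝ} (hg : Integrable g)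
    (hψ : Measurable ψ) {c : ℝ} (hc : ∀ x, |ψ x| ≤ c) :
    ∫ x, heatOp t g x * ψ x = ∫ x, g x * heatOp t ψ x := by
  rcases ht.eq_or_lt with rfl | ht
  · rw [heatOp_zero, heatOp_zero]
  simp only [heatOp_of_pos ht]
  simp only [← integral_mul_const, ← integral_const_mul]
  rw [integral_integral_swap]
  · refine integral_congr_ae (Filter.Eventually.of_forall fun x => ?_)
    refine integral_congr_ae (Filter.Eventually.of_forall fun y => ?_)
    simp only [heat_symm t y x]
    ring
  · refine ((integrable_heat_mul_prod ht hg).bdd_mul (f := fun p : ℝ × ℝ => ψ p.1) (c := c)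
      (hψ.comp measurable_fst).aestronglyMeasurable
      (Filter.Eventually.of_forall fun p => hc _)).congr (Filter.Eventually.of_forall fun p => ?_)
    simp only [Function.uncurry]
    ring

/-! ### The sign kernel -/

/-- `sgn (y - x)`. -/
noncomputable def signKernel (x y : ℝ) : ℝ := if x < y then 1 else if y < x then -1 else 0

theorem abs_signKernel_le (x y : ℝ) : |signKernel x y| ≤ 1 := by
  unfold signKernel
  split_ifs <;> simp

theorem signKernel_swap (x y : ℝ) : signKernel y x = -signKernel x y := by
  unfold signKernel
  rcases lt_trichotomy x y with h | h | h
  · simp [h, h.not_gt]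
  · simp [h]
  · simp [h, h.not_gt]

theorem measurable_signKernel : Measurable fun p : ℝ × ℝ => signKernel p.1 p.2 := by
  unfold signKernel
  refine Measurable.ite (measurableSet_lt measurable_fst measurable_snd) measurable_const ?_
  exact Measurable.ite (measurableSet_lt measurable_snd measurable_fst) measurable_const
    measurable_const

/-- This connects `kernelF`, a difference of two probabilities, with integration of the sign kernel,
also when one of the laws is a unit mass. -/
theorem integral_signKernel_prod (μ ν : Measure ℝ) [IsProbabilityMeasure μ]
    [IsProbabilityMeasure ν] :
    ∫ z, ∫ w, signKernel z w ∂ν ∂μ =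
      (μ.prod ν).real {v | v.1 < v.2} - (μ.prod ν).real {v | v.2 < v.1} := by
  have hint : Integrable (fun p : ℝ × ℝ => signKernel p.1 p.2) (μ.prod ν) :=
    (integrable_const (1 : ℝ)).mono' measurable_signKernel.aestronglyMeasurable
      (Filter.Eventually.of_forall fun p => abs_signKernel_le _ _)
  rw [← integral_prod (fun p : ℝ × ℝ => signKernel p.1 p.2) hint]
  have h1 : (fun p : ℝ × ℝ => signKernel p.1 p.2) = fun p =>
      Set.indicator {v : ℝ × ℝ | v.1 < v.2} 1 p - Set.indicator {v : ℝ × ℝ | v.2 < v.1} 1 p := by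
    funext p
    simp only [signKernel, Set.indicator_apply, Set.mem_ofPred_eq, Pi.one_apply]
    rcases lt_trichotomy p.1 p.2 with h | h | h
    · simp [h, h.not_gt]
    · simp [h]
    · simp [h, h.not_gt]
  have hm1 : MeasurableSet {v : ℝ × ℝ | v.1 < v.2} := measurableSet_lt measurable_fst measurable_snd
  have hm2 : MeasurableSet {v : ℝ × ℝ | v.2 < v.1} := measurableSet_lt measurable_snd measurable_fst
  rw [h1, integral_sub, integral_indicator_one hm1, integral_indicator_one hm2]
  · exact (integrable_const (1 : ℝ)).indicator hm1
  · exact (integrable_const (1 : ℝ)).indicator hm2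

theorem measurable_integral_signKernel (ν : Measure ℝ) [IsProbabilityMeasure ν] :
    Measurable fun z => ∫ w, signKernel z w ∂ν :=
  (measurable_signKernel.stronglyMeasurable.integral_prod_right' (ν := ν)).measurable

theorem abs_integral_signKernel_le (ν : Measure ℝ) [IsProbabilityMeasure ν] (z : ℝ) :
    |∫ w, signKernel z w ∂ν| ≤ 1 := by
  have := norm_integral_le_of_norm_le_const (μ := ν) (f := fun w => signKernel z w) (C := 1)
    (Filter.Eventually.of_forall fun w => abs_signKernel_le z w)
  simpa using this

end Heat

/-! ### Hermite polynomials and Gaussian integrals -/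

section Hermite

open Polynomial

theorem derivative_hermiteH_succ (j : ℕ) :
    derivative (hermiteH (j + 1)) = (2 * (j + 1) : ℝ) • hermiteH j := by
  induction j with
  | zero => simp [hermiteH, smul_eq_C_mul, map_ofNat C 2]
  | succ j ih =>
    have h1 : hermiteH (j + 1 + 1) = 2 * X * hermiteH (j + 1) - derivative (hermiteH (j + 1)) := rfl
    have h2 : hermiteH (j + 1) = 2 * X * hermiteH j - derivative (hermiteH j) := rfl
    have h3 : derivative (derivative (hermiteH (j + 1))) =
        (2 * (j + 1) : ℝ) • derivative (hermiteH j) := by rw [ih, derivative_smul]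
    rw [h1, derivative_sub, h3, derivative_mul, ih]
    have h4 : derivative (2 * X : ℝ[X]) = 2 := by simp
    rw [h4]
    have h5 : derivative (hermiteH j) = 2 * X * hermiteH j - hermiteH (j + 1) := by rw [h2]; ring
    rw [h5]
    simp only [smul_eq_C_mul]
    push_cast
    simp only [C_add, C_mul, C_1, map_natCast, map_ofNat]
    ring

theorem hermiteH_succ_succ (j : ℕ) :
    hermiteH (j + 2) = 2 * X * hermiteH (j + 1) - (2 * (j + 1) : ℝ) • hermiteH j := by
  rw [← derivative_hermiteH_succ]
  rfl

theorem hermiteH_eval_neg (j : ℕ) (x : ℝ) :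
    (hermiteH j).eval (-x) = (-1) ^ j * (hermiteH j).eval x := by
  induction j using Nat.twoStepInduction with
  | zero => simp [hermiteH]
  | one => simp [hermiteH]
  | more j ih1 ih2 =>
    rw [hermiteH_succ_succ]
    simp only [eval_sub, eval_mul, eval_smul, eval_X, eval_ofNat, ih1, ih2, smul_eq_mul]
    ring

theorem hermiteH_coeff_natDegree (j : ℕ) :
    (hermiteH j).natDegree ≤ j ∧ (hermiteH j).coeff j = 2 ^ j := by
  induction j with
  | zero => simp [hermiteH]
  | succ j ih =>
    have h2 : hermiteH (j + 1) = C 2 * (X * hermiteH j) - derivative (hermiteH j) := by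
      rw [show (C 2 : ℝ[X]) = 2 from map_ofNat C 2]
      simp only [hermiteH]
      ring
    have hd : (derivative (hermiteH j)).natDegree ≤ j :=
      (natDegree_derivative_le _).trans (by have := ih.1; omega)
    constructor
    · rw [h2]
      refine (natDegree_sub_le _ _).trans (max_le ?_ (hd.trans (by omega)))
      refine (natDegree_C_mul_le _ _).trans ?_
      refine (natDegree_mul_le).trans ?_
      rw [natDegree_X]
      have := ih.1
      omega
    · rw [h2, coeff_sub, coeff_C_mul, coeff_X_mul, ih.2,
        coeff_eq_zero_of_natDegree_lt (lt_of_le_of_lt hd (by omega))]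
      ring

theorem integrable_polynomial_gaussianReal (q : ℝ[X]) (μ : ℝ) (v : NNReal) :
    Integrable (fun x => q.eval x) (gaussianReal μ v) := by
  induction q using Polynomial.induction_on' with
  | add p q hp hq =>
    simp only [eval_add]
    exact hp.add hq
  | monomial n a =>
    simp only [eval_monomial]
    refine Integrable.const_mul ?_ a
    have h := (memLp_id_gaussianReal (μ := μ) (v := v) (n : NNReal))
    have := h.integrable_norm_pow' (p := n)
    refine this.mono' (by fun_prop) (Filter.Eventually.of_forall fun x => ?_)
    simp

theorem integrable_heat_mul_polynomial {t : ℝ} (ht : 0 < t) (q : ℝ[X]) (x : ℝ) :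
    Integrable fun y => heat t x y * q.eval y := by
  have h := integrable_polynomial_gaussianReal q x t.toNNReal
  rw [gaussianReal_of_var_ne_zero x (by simpa using ht)] at h
  have hg : gaussianPDF x t.toNNReal = fun y => ENNReal.ofReal (heat t x y) := by
    funext y
    rw [gaussianPDF, heat_eq_gaussianPDFReal ht]
  rw [hg, integrable_withDensity_iff_integrable_smul'] at h
  · refine h.congr (Filter.Eventually.of_forall fun y => ?_)
    simp only [smul_eq_mul, ENNReal.toReal_ofReal (heat_nonneg t x y)]
  · exact ((measurable_heat t).comp measurable_prodMk_left).ennreal_ofReal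
  · exact Filter.Eventually.of_forall fun y => ENNReal.ofReal_lt_top

theorem hasDerivAt_heat {t : ℝ} (ht : 0 < t) (x y : ℝ) :
    HasDerivAt (fun y => heat t x y) (-((y - x) / t) * heat t x y) y := by
  unfold heat
  have h1 : HasDerivAt (fun y => -(x - y) ^ 2 / (2 * t)) (-((y - x) / t)) y := by
    have h2 : HasDerivAt (fun y => x - y) (-1) y := by
      simpa using (hasDerivAt_id y).const_sub x
    convert! ((h2.pow 2).neg.div_const (2 * t)) using 1
    field_simp
    ring
  convert! (h1.exp.const_mul (1 / Real.sqrt (2 * Real.pi * t))) using 1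
  ring

/-- Gaussian integration by parts. -/
theorem integral_heat_mul_X_mul {t : ℝ} (ht : 0 < t) (q : ℝ[X]) (x : ℝ) :
    ∫ y, heat t x y * (X * q).eval y =
      x * (∫ y, heat t x y * q.eval y) + t * ∫ y, heat t x y * (derivative q).eval y := by
  have h1 := integrable_heat_mul_polynomial ht q x
  have h2 := integrable_heat_mul_polynomial ht (derivative q) x
  have h3 := integrable_heat_mul_polynomial ht (X * q) x
  have hder : ∀ y, HasDerivAt (fun y => heat t x y * q.eval y)
      ((-(1 / t)) * (heat t x y * (X * q).eval y) + (x / t) * (heat t x y * q.eval y) +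
        heat t x y * (derivative q).eval y) y := by
    intro y
    convert! (hasDerivAt_heat ht x y).mul (q.hasDerivAt y) using 1
    simp only [eval_mul, eval_X]
    field_simp
    ring
  have h0 := integral_eq_zero_of_hasDerivAt_of_integrable hder
    (((h3.const_mul _).add (h1.const_mul _)).add h2) h1
  have h13 : Integrable fun y => (-(1 / t)) * (heat t x y * (X * q).eval y) +
      (x / t) * (heat t x y * q.eval y) := (h3.const_mul _).add (h1.const_mul _)
  rw [integral_add h13 h2, integral_add (h3.const_mul _) (h1.const_mul _), integral_const_mul, integral_const_mul] at h0
  field_simp at h0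
  linarith

theorem hermiteH_comp_succ_succ (j : ℕ) (c : ℝ) :
    (hermiteH (j + 2)).comp (C c * X) = C (2 * c) * (X * (hermiteH (j + 1)).comp (C c * X)) -
      C (2 * (j + 1) : ℝ) * (hermiteH j).comp (C c * X) := by
  rw [hermiteH_succ_succ]
  simp only [smul_eq_C_mul, sub_comp, mul_comp, X_comp, C_comp, ofNat_comp, C_mul, map_ofNat]
  ring

theorem derivative_hermiteH_comp (j : ℕ) (c : ℝ) :
    derivative ((hermiteH (j + 1)).comp (C c * X)) =
      C (c * (2 * (j + 1))) * (hermiteH j).comp (C c * X) := by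
  rw [derivative_comp, derivative_hermiteH_succ]
  simp [smul_eq_C_mul]
  ring

/-- The Gaussian transform of a Hermite polynomial. -/
theorem integral_heat_mul_hermiteH {v : ℝ} (hv : 0 < v) (c l : ℝ) (hl : l ≠ 0)
    (hcl : l ^ 2 = 1 - 2 * v * c ^ 2) (j : ℕ) (x : ℝ) :
    ∫ y, heat v x y * (hermiteH j).eval (c * y) = l ^ j * (hermiteH j).eval (x * c / l) := by
  -- Integration by parts turns the three-term recursion in `y` into one for the transforms. The
  -- derivative term contributes 2vc² times the coefficient of the lower Hermite polynomial, and by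
  -- `hcl` this leaves the factor `l ^ 2` of the rescaled recursion.
  have key : ∀ j, ∫ y, heat v x y * ((hermiteH j).comp (C c * X)).eval y =
      l ^ j * (hermiteH j).eval (x * c / l) := by
    intro j
    have hq := fun q => integrable_heat_mul_polynomial hv q x
    induction j using Nat.twoStepInduction with
    | zero => simp [hermiteH, integral_heat hv]
    | one =>
      have h1 : (hermiteH 1).comp (C c * X) = C (2 * c) * (X * 1) := by
        simp [hermiteH, map_ofNat C 2]
        ring
      rw [h1]
      simp only [eval_C_mul]
      have h2 : ∀ y, heat v x y * (2 * c * (X * (1 : ℝ[X])).eval y) =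
        2 * c * (heat v x y * (X * (1 : ℝ[X])).eval y) := fun y => by ring
      simp only [h2]
      rw [integral_const_mul, integral_heat_mul_X_mul hv]
      simp [integral_heat hv, hermiteH]
      field_simp
    | more j ih1 ih2 =>
      rw [hermiteH_comp_succ_succ]
      have h2 : ∀ y, heat v x y * (C (2 * c) * (X * (hermiteH (j + 1)).comp (C c * X)) -
          C (2 * (j + 1) : ℝ) * (hermiteH j).comp (C c * X)).eval y =
          2 * c * (heat v x y * (X * (hermiteH (j + 1)).comp (C c * X)).eval y) -
          (2 * (j + 1)) * (heat v x y * ((hermiteH j).comp (C c * X)).eval y) := by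
        intro y
        rw [eval_sub, eval_C_mul, eval_C_mul]
        ring
      simp only [h2]
      rw [integral_sub ((hq _).const_mul _) ((hq _).const_mul _), integral_const_mul,
        integral_const_mul, integral_heat_mul_X_mul hv, derivative_hermiteH_comp]
      have h3 : ∀ y, heat v x y * (C (c * (2 * (j + 1))) * (hermiteH j).comp (C c * X)).eval y =
          (c * (2 * (j + 1))) * (heat v x y * ((hermiteH j).comp (C c * X)).eval y) := by
        intro y
        rw [eval_C_mul]
        ring
      simp only [h3]
      rw [integral_const_mul, ih1, ih2, hermiteH_succ_succ]
      simp only [eval_sub, eval_mul, eval_smul, eval_X, eval_ofNat, smul_eq_mul]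
      have h4 : 2 * v * c ^ 2 = 1 - l ^ 2 := by rw [hcl]; ring
      have h5 : x * c / l * l = x * c := div_mul_cancel₀ _ hl
      linear_combination ((2 * (j + 1)) * l ^ j * (hermiteH j).eval (x * c / l)) * h4 -
        2 * l ^ (j + 1) * (hermiteH (j + 1)).eval (x * c / l) * h5
  rw [← key j]
  simp

/-- Orthogonality of the Hermite polynomials. -/
theorem integral_heat_hermiteH_mul {v c : ℝ} (hv : 0 < v) (hvc : 2 * v * c ^ 2 = 1) (j k : ℕ) :
    ∫ y, heat v 0 y * ((hermiteH j).eval (c * y) * (hermiteH k).eval (c * y)) =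
      if j = k then 2 ^ j * (j ! : ℝ) else 0 := by
  let H : ℕ → ℝ[X] := fun j => (hermiteH j).comp (C c * X)
  let E : ℝ[X] → ℝ := fun q => ∫ y, heat v 0 y * q.eval y
  have hq := fun q => integrable_heat_mul_polynomial hv q 0
  have hEsub : ∀ p q, E (p - q) = E p - E q := by
    intro p q
    simp only [E, eval_sub, mul_sub]
    exact integral_sub (hq p) (hq q)
  have hEC : ∀ a q, E (C a * q) = a * E q := by
    intro a q
    simp only [E, eval_C_mul, mul_left_comm _ a]
    exact integral_const_mul _ _
  have hEX : ∀ q, E (X * q) = v * E (derivative q) := by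
    intro q
    have := integral_heat_mul_X_mul hv q 0
    simpa [E] using this
  have hEadd : ∀ p q, E (p + q) = E p + E q := by
    intro p q
    simp only [E, eval_add, mul_add]
    exact integral_add (hq p) (hq q)
  have hc : 2 * c * v * c = 1 := by rw [← hvc]; ring
  have hc0 : c ≠ 0 := by rintro rfl; simp at hc
  have hH : ∀ j, H (j + 1) = C (2 * c) * (X * H j) - C (c⁻¹) * derivative (H j) := by
    intro j
    have h1 : C c * X * (1 : ℝ[X]) = C c * X := mul_one _
    simp only [H, hermiteH, derivative_comp, sub_comp, mul_comp, X_comp, ofNat_comp, C_mul, map_ofNat]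
    have h2 : C c⁻¹ * (derivative (C c * X : ℝ[X])) = 1 := by
      simp [← C_mul, inv_mul_cancel₀ hc0]
    linear_combination ((derivative (hermiteH j)).comp (C c * X)) * h2
  -- The raising operator is adjoint to `c⁻¹` times differentiation. Differentiating the other
  -- factor lowers its degree, which drives the induction.
  have step : ∀ j (q : ℝ[X]), E (H (j + 1) * q) = c⁻¹ * E (H j * derivative q) := by
    intro j q
    have h1 : H (j + 1) * q = C (2 * c) * (X * (H j * q)) - C (c⁻¹) * (derivative (H j) * q) := by
      rw [hH]; ring
    have h2 : 2 * c * v = c⁻¹ := by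
      field_simp
      linarith
    rw [h1, hEsub, hEC, hEC, hEX, derivative_mul, hEadd, ← mul_assoc, h2]
    ring
  have main : ∀ j k, E (H j * H k) = if j = k then 2 ^ j * (j ! : ℝ) else 0 := by
    intro j
    induction j with
    | zero =>
      intro k
      cases k with
      | zero => simp [E, H, hermiteH, integral_heat hv]
      | succ k =>
        rw [mul_comm, step]
        simp [H, hermiteH, E]
    | succ j ih =>
      intro k
      cases k with
      | zero =>
        rw [step]
        simp [H, hermiteH, E]
      | succ k =>
        rw [step, derivative_hermiteH_comp, mul_left_comm, hEC, ih]
        by_cases h : j = k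
        · subst h
          simp only [if_true, pow_succ, Nat.factorial_succ]
          push_cast
          field_simp
        · simp [h]
  rw [← main j k]
  simp [E, H]

end Hermite

/-! ### The skew orthogonal functions -/

section SkewForm

/-- `∬ f(x) g(y) sgn(y - x) dx dy`. -/
noncomputable def skewForm (f g : ℝ → ℝ) : ℝ := ∫ x, f x * ∫ y, g y * signKernel x y

/-- By integrability `f` vanishes at both ends, so each of the two half-lines contributes -f(x).
Integration against sgn thus inverts differentiation up to the factor -2. -/
theorem integral_deriv_mul_signKernel {f f' : ℝ → ℝ} (hf : ∀ x, HasDerivAt f (f' x) x)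
    (hint : Integrable f) (hint' : Integrable f') (x : ℝ) :
    ∫ y, f' y * signKernel x y = -2 * f x := by
  have hbot := tendsto_zero_of_hasDerivAt_of_integrableOn_Iic (a := x) (fun y _ => hf y)
    hint'.integrableOn hint.integrableOn
  have htop := tendsto_zero_of_hasDerivAt_of_integrableOn_Ioi (a := x) (fun y _ => hf y)
    hint'.integrableOn hint.integrableOn
  have h1 := integral_Iic_of_hasDerivAt_of_tendsto' (a := x) (fun y _ => hf y) hint'.integrableOn hbot
  have h2 := integral_Ioi_of_hasDerivAt_of_tendsto' (a := x) (fun y _ => hf y) hint'.integrableOn htop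
  have hmul : Integrable fun y => f' y * signKernel x y := by
    have := hint'.bdd_mul (f := fun y => signKernel x y) (c := 1)
      (measurable_signKernel.comp measurable_prodMk_left).aestronglyMeasurable
      (Filter.Eventually.of_forall fun y => abs_signKernel_le x y)
    simpa [mul_comm] using this
  rw [← setIntegral_univ, ← Set.Iic_union_Ioi (a := x),
    setIntegral_union (Set.Iic_disjoint_Ioi le_rfl) measurableSet_Ioi hmul.integrableOn
      hmul.integrableOn]
  have h3 : ∫ y in Set.Ioi x, f' y * signKernel x y = ∫ y in Set.Ioi x, f' y :=
    setIntegral_congr_fun measurableSet_Ioi fun y hy => by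
      simp [signKernel, Set.mem_Ioi.1 hy]
  have h4 : ∫ y in Set.Iic x, f' y * signKernel x y = -∫ y in Set.Iic x, f' y := by
    rw [integral_Iic_eq_integral_Iio, integral_Iic_eq_integral_Iio, ← integral_neg]
    refine setIntegral_congr_fun measurableSet_Iio fun y hy => ?_
    have : y < x := hy
    simp [signKernel, this, this.not_gt]
  rw [h3, h4, h1, h2]
  ring

theorem integral_mul_signKernel_neg (g : ℝ → ℝ) (x : ℝ) :
    ∫ y, g y * signKernel (-x) y = -∫ y, g (-y) * signKernel x y := by
  rw [← integral_neg_eq_self (fun y => g y * signKernel (-x) y), ← integral_neg]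
  refine integral_congr_ae (Filter.Eventually.of_forall fun y => ?_)
  simp only [signKernel, neg_lt_neg_iff]
  rcases lt_trichotomy x y with h | h | h
  · simp [h, h.not_gt]
  · simp [h]
  · simp [h, h.not_gt]

/-- Reflecting both variables changes the sign of sgn(y - x) but not of f(x) g(y) if the parities
are equal. -/
theorem skewForm_eq_zero_of_parity {f g : ℝ → ℝ} {ε : ℝ} (hε : ε * ε = 1)
    (hf : ∀ x, f (-x) = ε * f x) (hg : ∀ x, g (-x) = ε * g x) : skewForm f g = 0 := by
  have h1 : skewForm f g = -skewForm f g := by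
    conv_lhs => rw [skewForm, ← integral_neg_eq_self]
    rw [skewForm, ← integral_neg]
    refine integral_congr_ae (Filter.Eventually.of_forall fun x => ?_)
    simp only
    rw [integral_mul_signKernel_neg, hf]
    simp only [hg, mul_assoc]
    rw [integral_const_mul]
    linear_combination (-(f x * ∫ y, g y * signKernel x y)) * hε
  exact self_eq_neg.1 h1

theorem skewForm_antisymm {f g : ℝ → ℝ} (hf : Integrable f) (hg : Integrable g) :
    skewForm g f = -skewForm f g := by
  have h1 : Integrable (fun p : ℝ × ℝ => f p.1 * (g p.2 * signKernel p.1 p.2))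
      (volume.prod volume) := by
    have := (hf.mul_prod hg).bdd_mul (f := fun p : ℝ × ℝ => signKernel p.1 p.2) (c := 1)
      measurable_signKernel.aestronglyMeasurable
      (Filter.Eventually.of_forall fun p => abs_signKernel_le _ _)
    refine this.congr (Filter.Eventually.of_forall fun p => ?_)
    simp only
    ring
  unfold skewForm
  simp only [← integral_const_mul]
  rw [integral_integral_swap (f := fun x y => f x * (g y * signKernel x y)) h1, ← integral_neg]
  refine integral_congr_ae (Filter.Eventually.of_forall fun x => ?_)
  simp only
  rw [← integral_neg]
  refine integral_congr_ae (Filter.Eventually.of_forall fun y => ?_)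
  simp only
  rw [signKernel_swap]
  ring

end SkewForm

/-! ### Skew orthogonality at the final time and normalization -/

section SkewOrthogonal

open Polynomial

variable {M : ℕ} {t : Fin (M + 2) → ℝ}

theorem time_one_pos (ht₀ : t 0 = 0) (ht : StrictMono t) : 0 < t 1 := by
  rw [← ht₀]
  exact ht (by simp)

theorem time_one_lt_finalTime (hM : 1 ≤ M) (ht : StrictMono t) : t 1 < finalTime t := by
  refine ht ?_
  rw [Fin.lt_def]
  simp
  omega

theorem cOne_pos (hM : 1 ≤ M) (ht₀ : t 0 = 0) (ht : StrictMono t) : 0 < cOne t := by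
  have h1 := time_one_pos ht₀ ht
  have h2 := time_one_lt_finalTime hM ht
  have h3 : 0 < 2 * finalTime t - t 1 := by linarith
  have h4 : 0 < finalTime t := by linarith
  unfold cOne
  positivity

theorem zOne_pos (hM : 1 ≤ M) (ht₀ : t 0 = 0) (ht : StrictMono t) : 0 < zOne t := by
  have h1 := time_one_pos ht₀ ht
  have h2 := time_one_lt_finalTime hM ht
  have h3 : 0 < 2 * finalTime t - t 1 := by linarith
  unfold zOne
  positivity

theorem cOne_sq (hM : 1 ≤ M) (ht₀ : t 0 = 0) (ht : StrictMono t) :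
    cOne t ^ 2 = t 1 * (2 * finalTime t - t 1) / finalTime t := by
  have h1 := time_one_pos ht₀ ht
  have h2 := time_one_lt_finalTime hM ht
  have h3 : 0 < 2 * finalTime t - t 1 := by linarith
  have h4 : 0 < finalTime t := by linarith
  exact Real.sq_sqrt (by positivity)

theorem zOne_sq (hM : 1 ≤ M) (ht₀ : t 0 = 0) (ht : StrictMono t) :
    zOne t ^ 2 = (2 * finalTime t - t 1) / t 1 := by
  have h1 := time_one_pos ht₀ ht
  have h2 := time_one_lt_finalTime hM ht
  have h3 : 0 < 2 * finalTime t - t 1 := by linarith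
  exact Real.sq_sqrt (by positivity)

/-- This ratio is the combination of scales that survives the transport to the final time, where all
Hermite functions depend on x / √T. -/
theorem cOne_div_zOne (hM : 1 ≤ M) (ht₀ : t 0 = 0) (ht : StrictMono t) :
    cOne t / zOne t = t 1 / Real.sqrt (finalTime t) := by
  have h1 := time_one_pos ht₀ ht
  have h2 := time_one_lt_finalTime hM ht
  have h3 : 0 < 2 * finalTime t - t 1 := by linarith
  have h4 : 0 < finalTime t := by linarith
  have hc := cOne_pos hM ht₀ ht
  have hz := zOne_pos hM ht₀ ht
  rw [← sq_eq_sq₀ (by positivity) (by positivity), div_pow, div_pow, cOne_sq hM ht₀ ht,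
    zOne_sq hM ht₀ ht, Real.sq_sqrt h4.le]
  field_simp

theorem skewPoly_even (hM : 1 ≤ M) (ht₀ : t 0 = 0) (ht : StrictMono t) (k : ℕ) (x : ℝ) :
    skewPoly t (2 * k) x = (cOne t / 2) ^ (2 * k) * (hermiteH (2 * k)).eval (x / cOne t) := by
  have hz := (zOne_pos hM ht₀ ht).ne'
  unfold skewPoly alphaCoeff
  simp only [even_two_mul, if_true]
  rw [Finset.sum_eq_single (2 * k)]
  · simp only [if_true, div_pow]
    field_simp
  · intro j _ hj
    simp [hj.symm]
  · simp

theorem skewPoly_odd (hM : 1 ≤ M) (ht₀ : t 0 = 0) (ht : StrictMono t) (k : ℕ) (x : ℝ) :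
    skewPoly t (2 * k + 1) x = (cOne t / 2) ^ (2 * k + 1) *
      ((hermiteH (2 * k + 1)).eval (x / cOne t) -
        4 * k * (zOne t ^ 2)⁻¹ * (hermiteH (2 * k - 1)).eval (x / cOne t)) := by
  have hz := (zOne_pos hM ht₀ ht).ne'
  have hodd : ¬ Even (2 * k + 1) := by simp
  unfold skewPoly alphaCoeff
  simp only [hodd, if_false]
  have h1 : ∀ j, (2 ^ (2 * k + 1))⁻¹ * cOne t ^ (2 * k + 1) *
      ((if 2 * k + 1 = j then (1 : ℝ) else 0) -
        2 * (((2 * k + 1 : ℕ) : ℝ) - 1) * (if 2 * k + 1 = j + 2 then 1 else 0)) *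
      (hermiteH j).eval (x / cOne t) * zOne t ^ j =
      (if 2 * k + 1 = j then (2 ^ (2 * k + 1))⁻¹ * cOne t ^ (2 * k + 1) *
        (hermiteH j).eval (x / cOne t) * zOne t ^ j else 0) -
      (if 2 * k + 1 = j + 2 then (2 ^ (2 * k + 1))⁻¹ * cOne t ^ (2 * k + 1) * (4 * k) *
        (hermiteH j).eval (x / cOne t) * zOne t ^ j else 0) := by
    intro j
    push_cast
    split_ifs <;> ring
  simp only [h1]
  rw [Finset.sum_sub_distrib, Finset.sum_ite_eq, if_pos (Finset.self_mem_range_succ _)]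
  have h2 : ∑ j ∈ Finset.range (2 * k + 1 + 1), (if 2 * k + 1 = j + 2 then
      (2 ^ (2 * k + 1))⁻¹ * cOne t ^ (2 * k + 1) * (4 * k) *
        (hermiteH j).eval (x / cOne t) * zOne t ^ j else 0) =
      (2 ^ (2 * k + 1))⁻¹ * cOne t ^ (2 * k + 1) * (4 * k) *
        (hermiteH (2 * k - 1)).eval (x / cOne t) * zOne t ^ (2 * k - 1) := by
    -- For `k = 0` the index `2 * k - 1` is truncated to 0; the factor `4 * k` vanishes there.
    rw [Finset.sum_eq_single (2 * k - 1)]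
    · rcases Nat.eq_zero_or_pos k with rfl | hk
      · simp
      · rw [if_pos (by omega)]
    · intro j _ hj
      rw [if_neg (by omega)]
    · intro h
      exact absurd (Finset.mem_range.2 (by omega)) h
  rw [h2]
  rcases Nat.eq_zero_or_pos k with rfl | hk
  · simp
    field_simp
  · rw [div_pow]
    obtain ⟨m, rfl⟩ := Nat.exists_eq_add_of_le' hk
    have e1 : 2 * (m + 1) + 1 = 2 * m + 1 + 2 := by ring
    have e2 : 2 * (m + 1) - 1 = 2 * m + 1 := by omega
    rw [e1, e2, pow_add (zOne t)]
    field_simp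

/-- The monic polynomial of degree `k` defining `skewPoly t k`. -/
noncomputable def skewPolynomial (t : Fin (M + 2) → ℝ) (k : ℕ) : ℝ[X] :=
  C ((zOne t ^ k)⁻¹) * ∑ j ∈ Finset.range (k + 1),
    C (alphaCoeff t k j * zOne t ^ j) * (hermiteH j).comp (C (cOne t)⁻¹ * X)

theorem skewPolynomial_eval (t : Fin (M + 2) → ℝ) (k : ℕ) (x : ℝ) :
    (skewPolynomial t k).eval x = skewPoly t k x := by
  simp only [skewPolynomial, skewPoly, eval_mul, eval_C, eval_finsetSum, eval_comp, eval_X]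
  congr 1
  refine Finset.sum_congr rfl fun j _ => ?_
  rw [div_eq_inv_mul]
  ring

theorem natDegree_hermiteH_comp_le (j : ℕ) (c : ℝ) :
    ((hermiteH j).comp (C c * X)).natDegree ≤ j := by
  refine natDegree_comp_le.trans ?_
  refine (Nat.mul_le_mul (hermiteH_coeff_natDegree j).1 (natDegree_C_mul_le c X)).trans ?_
  simp

theorem coeff_hermiteH_comp (j : ℕ) (c : ℝ) :
    ((hermiteH j).comp (C c * X)).coeff j = (2 * c) ^ j := by
  rw [comp_C_mul_X_coeff, (hermiteH_coeff_natDegree j).2, mul_pow]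

theorem skewPolynomial_natDegree_le (t : Fin (M + 2) → ℝ) (k : ℕ) :
    (skewPolynomial t k).natDegree ≤ k := by
  refine (natDegree_C_mul_le _ _).trans (natDegree_sum_le_of_forall_le _ _ fun j hj => ?_)
  refine (natDegree_C_mul_le _ _).trans ((natDegree_hermiteH_comp_le j _).trans ?_)
  have := Finset.mem_range.1 hj
  omega

theorem skewPolynomial_coeff (hM : 1 ≤ M) (ht₀ : t 0 = 0) (ht : StrictMono t) (k : ℕ) :
    (skewPolynomial t k).coeff k = 1 := by
  have hz := (zOne_pos hM ht₀ ht).ne'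
  have hc := (cOne_pos hM ht₀ ht).ne'
  rw [skewPolynomial, coeff_C_mul, finsetSum_coeff, Finset.sum_eq_single k]
  · rw [coeff_C_mul, coeff_hermiteH_comp]
    have : alphaCoeff t k k = (2 ^ k)⁻¹ * cOne t ^ k := by
      unfold alphaCoeff
      by_cases h : Even k
      · simp [h]
      · simp [h]
    rw [this, mul_pow, inv_pow]
    field_simp
  · intro j hj hjk
    rw [coeff_C_mul, coeff_eq_zero_of_natDegree_lt, mul_zero]
    refine lt_of_le_of_lt (natDegree_hermiteH_comp_le j _) ?_
    have := Finset.mem_range.1 hj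
    omega
  · simp

theorem skewPolynomial_monic (hM : 1 ≤ M) (ht₀ : t 0 = 0) (ht : StrictMono t) (k : ℕ) :
    (skewPolynomial t k).Monic ∧ (skewPolynomial t k).natDegree = k := by
  have h1 := skewPolynomial_coeff hM ht₀ ht k
  have h2 : (skewPolynomial t k).natDegree = k :=
    le_antisymm (skewPolynomial_natDegree_le t k)
      (le_natDegree_of_ne_zero (by rw [h1]; exact one_ne_zero))
  exact ⟨by rw [Monic, leadingCoeff, h2, h1], h2⟩

/-- The function `R_k(y) p_{t₁}(0, y)`. -/
noncomputable def initialFn (t : Fin (M + 2) → ℝ) (k : ℕ) (y : ℝ) : ℝ :=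
  skewPoly t k y * heat (t 1) 0 y

theorem initialFn_eq (t : Fin (M + 2) → ℝ) (k : ℕ) (y : ℝ) :
    initialFn t k y = heat (t 1) 0 y * (skewPolynomial t k).eval y := by
  rw [initialFn, skewPolynomial_eval, mul_comm]

theorem integrable_initialFn (ht₀ : t 0 = 0) (ht : StrictMono t) (k : ℕ) :
    Integrable (initialFn t k) := by
  have := integrable_heat_mul_polynomial (time_one_pos ht₀ ht) (skewPolynomial t k) 0
  exact this.congr (Filter.Eventually.of_forall fun y => (initialFn_eq t k y).symm)

theorem measurable_initialFn (t : Fin (M + 2) → ℝ) (k : ℕ) : Measurable (initialFn t k) := by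
  have : initialFn t k = fun y => heat (t 1) 0 y * (skewPolynomial t k).eval y :=
    funext (initialFn_eq t k)
  rw [this]
  exact ((measurable_heat (t 1)).comp measurable_prodMk_left).mul
    (skewPolynomial t k).continuous.measurable

theorem transR_eq_heatOp (t : Fin (M + 2) → ℝ) (m : Fin (M + 1)) (k : ℕ) :
    transR t m k = heatOp (t m.succ - t 1) (initialFn t k) := rfl

/-- The transported functions at the final time. -/
noncomputable def finalFn (t : Fin (M + 2) → ℝ) (k : ℕ) : ℝ → ℝ :=
  heatOp (finalTime t - t 1) (initialFn t k)

/-- The mean and variance are those of a Brownian bridge from 0 to x over [0, T] at time t₁. The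
scales are matched: with v = (T - t₁) t₁ / T one has 1 - 2v / c₁² = z₁⁻². -/
theorem heatOp_hermiteH (hM : 1 ≤ M) (ht₀ : t 0 = 0) (ht : StrictMono t) (j : ℕ) (x : ℝ) :
    ∫ y, heat ((finalTime t - t 1) * t 1 / finalTime t) (t 1 * x / finalTime t) y *
      (hermiteH j).eval (y / cOne t) =
      ((zOne t)⁻¹) ^ j * (hermiteH j).eval (x / Real.sqrt (finalTime t)) := by
  have h1 := time_one_pos ht₀ ht
  have h2 := time_one_lt_finalTime hM ht
  have h2' : 0 < finalTime t - t 1 := by linarith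
  have h3 : 0 < 2 * finalTime t - t 1 := by linarith
  have h4 : 0 < finalTime t := by linarith
  have hc := cOne_pos hM ht₀ ht
  have hz := zOne_pos hM ht₀ ht
  have := integral_heat_mul_hermiteH (v := (finalTime t - t 1) * t 1 / finalTime t) (by positivity)
    (cOne t)⁻¹ (zOne t)⁻¹ (by positivity) (by
      rw [inv_pow, inv_pow, cOne_sq hM ht₀ ht, zOne_sq hM ht₀ ht]
      field_simp
      ring) j (t 1 * x / finalTime t)
  simp only [div_eq_inv_mul _ (cOne t)]
  rw [this]
  congr 2
  have h5 := cOne_div_zOne hM ht₀ ht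
  have h6 : (cOne t)⁻¹ / (zOne t)⁻¹ = Real.sqrt (finalTime t) / t 1 := by
    rw [inv_div_inv, ← inv_div, h5, inv_div]
  rw [mul_div_assoc, h6]
  have h7 := Real.mul_self_sqrt h4.le
  have h8 : 0 < Real.sqrt (finalTime t) := Real.sqrt_pos.2 h4
  rw [div_mul_div_comm, div_eq_div_iff (by positivity) (by positivity)]
  linear_combination (t 1 * x) * h7

theorem finalFn_eq_integral (hM : 1 ≤ M) (ht₀ : t 0 = 0) (ht : StrictMono t) (k : ℕ) (x : ℝ) :
    finalFn t k x = heat (finalTime t) 0 x *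
      ∫ y, heat ((finalTime t - t 1) * t 1 / finalTime t) (t 1 * x / finalTime t) y *
        skewPoly t k y := by
  have h1 := time_one_pos ht₀ ht
  have h2 := time_one_lt_finalTime hM ht
  rw [finalFn, heatOp_of_pos (by linarith), ← integral_const_mul]
  refine integral_congr_ae (Filter.Eventually.of_forall fun y => ?_)
  simp only [initialFn]
  have := heat_mul_heat (s := finalTime t - t 1) (t := t 1) (by linarith) h1 x y 0
  rw [sub_add_cancel, mul_zero, add_zero, heat_symm _ y 0, heat_symm _ x 0] at this
  linear_combination skewPoly t k y * this

theorem finalFn_even (hM : 1 ≤ M) (ht₀ : t 0 = 0) (ht : StrictMono t) (k : ℕ) (x : ℝ) :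
    finalFn t (2 * k) x = (t 1 / (2 * Real.sqrt (finalTime t))) ^ (2 * k) *
      (heat (finalTime t) 0 x * (hermiteH (2 * k)).eval (x / Real.sqrt (finalTime t))) := by
  rw [finalFn_eq_integral hM ht₀ ht]
  simp only [skewPoly_even hM ht₀ ht, mul_left_comm _ ((cOne t / 2) ^ (2 * k))]
  rw [integral_const_mul, heatOp_hermiteH hM ht₀ ht]
  have h5 := cOne_div_zOne hM ht₀ ht
  have : t 1 / (2 * Real.sqrt (finalTime t)) = cOne t / 2 * (zOne t)⁻¹ := by
    rw [mul_comm, ← div_div, ← h5]; ring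
  rw [this, mul_pow]
  ring

/-- The correction term in `alphaCoeff` for odd indices becomes exactly the derivative of H_{2k}, as
4k H_{2k-1} = H_{2k}'. This makes the odd function a derivative in `hasDerivAt_finalFn`. -/
theorem finalFn_odd (hM : 1 ≤ M) (ht₀ : t 0 = 0) (ht : StrictMono t) (k : ℕ) (x : ℝ) :
    finalFn t (2 * k + 1) x = (t 1 / (2 * Real.sqrt (finalTime t))) ^ (2 * k + 1) *
      (heat (finalTime t) 0 x * ((hermiteH (2 * k + 1)).eval (x / Real.sqrt (finalTime t)) -
        (derivative (hermiteH (2 * k))).eval (x / Real.sqrt (finalTime t)))) := by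
  have h1 := time_one_pos ht₀ ht
  have h2 := time_one_lt_finalTime hM ht
  have h2' : 0 < finalTime t - t 1 := by linarith
  have h4 : 0 < finalTime t := by linarith
  have hz := (zOne_pos hM ht₀ ht).ne'
  rw [finalFn_eq_integral hM ht₀ ht]
  simp only [skewPoly_odd hM ht₀ ht, mul_left_comm _ ((cOne t / 2) ^ (2 * k + 1))]
  rw [integral_const_mul]
  simp only [mul_sub, mul_left_comm _ (4 * (k : ℝ) * (zOne t ^ 2)⁻¹)]
  have hint : ∀ j, Integrable fun y =>
      heat ((finalTime t - t 1) * t 1 / finalTime t) (t 1 * x / finalTime t) y *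
        (hermiteH j).eval (y / cOne t) := by
    intro j
    have := integrable_heat_mul_polynomial (t := (finalTime t - t 1) * t 1 / finalTime t)
      (by positivity) ((hermiteH j).comp (C (cOne t)⁻¹ * X)) (t 1 * x / finalTime t)
    refine this.congr (Filter.Eventually.of_forall fun y => ?_)
    simp [div_eq_inv_mul]
  rw [integral_sub (hint _) ((hint _).const_mul _), integral_const_mul,
    heatOp_hermiteH hM ht₀ ht, heatOp_hermiteH hM ht₀ ht]
  have h5 := cOne_div_zOne hM ht₀ ht
  have : t 1 / (2 * Real.sqrt (finalTime t)) = cOne t / 2 * (zOne t)⁻¹ := by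
    rw [mul_comm, ← div_div, ← h5]; ring
  rw [this, mul_pow]
  rcases Nat.eq_zero_or_pos k with rfl | hk
  · simp [hermiteH]
    ring
  · obtain ⟨m, rfl⟩ := Nat.exists_eq_add_of_le' hk
    have e1 : 2 * (m + 1) = 2 * m + 1 + 1 := by ring
    have e2 : 2 * (m + 1) - 1 = 2 * m + 1 := by omega
    rw [e2, e1, derivative_hermiteH_succ, eval_smul, smul_eq_mul, inv_pow, inv_pow]
    push_cast
    field_simp
    ring

theorem hasDerivAt_finalFn (hM : 1 ≤ M) (ht₀ : t 0 = 0) (ht : StrictMono t) (k : ℕ) (x : ℝ) :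
    HasDerivAt (finalFn t (2 * k)) (-(t 1)⁻¹ * finalFn t (2 * k + 1) x) x := by
  have h1 := time_one_pos ht₀ ht
  have h2 := time_one_lt_finalTime hM ht
  have h4 : 0 < finalTime t := by linarith
  have h7 := Real.mul_self_sqrt h4.le
  have h8 : 0 < Real.sqrt (finalTime t) := Real.sqrt_pos.2 h4
  have hf : finalFn t (2 * k) = fun x => (t 1 / (2 * Real.sqrt (finalTime t))) ^ (2 * k) *
      (heat (finalTime t) 0 x * (hermiteH (2 * k)).eval (x / Real.sqrt (finalTime t))) :=
    funext (finalFn_even hM ht₀ ht k)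
  rw [hf, finalFn_odd hM ht₀ ht]
  have hd : HasDerivAt (fun x => (hermiteH (2 * k)).eval (x / Real.sqrt (finalTime t)))
      ((derivative (hermiteH (2 * k))).eval (x / Real.sqrt (finalTime t)) *
        (1 / Real.sqrt (finalTime t))) x :=
    HasDerivAt.comp (h₂ := fun y => (hermiteH (2 * k)).eval y) x
      ((hermiteH (2 * k)).hasDerivAt (x / Real.sqrt (finalTime t)))
      ((hasDerivAt_id x).div_const _)
  convert! (((hasDerivAt_heat h4 0 x).mul hd).const_mul
    ((t 1 / (2 * Real.sqrt (finalTime t))) ^ (2 * k))) using 1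
  have h9 : hermiteH (2 * k + 1) = 2 * X * hermiteH (2 * k) - derivative (hermiteH (2 * k)) := rfl
  rw [h9, pow_succ]
  simp only [eval_sub, eval_mul, eval_X, eval_ofNat]
  generalize eval (x / √(finalTime t)) (hermiteH (2 * k)) = a
  generalize eval (x / √(finalTime t)) (derivative (hermiteH (2 * k))) = b
  generalize heat (finalTime t) 0 x = h
  have h10 : x / finalTime t = x / (√(finalTime t) * √(finalTime t)) := by rw [h7]
  rw [sub_zero, h10]
  field_simp
  ring

theorem finalFn_neg (hM : 1 ≤ M) (ht₀ : t 0 = 0) (ht : StrictMono t) (k : ℕ) (x : ℝ) :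
    finalFn t k (-x) = (-1) ^ k * finalFn t k x := by
  have hh : heat (finalTime t) 0 (-x) = heat (finalTime t) 0 x := by
    unfold heat
    congr 3
    ring
  rcases Nat.even_or_odd' k with ⟨j, rfl | rfl⟩
  · rw [finalFn_even hM ht₀ ht, finalFn_even hM ht₀ ht, hh, neg_div, hermiteH_eval_neg]
    ring
  · rw [finalFn_odd hM ht₀ ht, finalFn_odd hM ht₀ ht, hh, neg_div, hermiteH_eval_neg]
    have : (derivative (hermiteH (2 * j))).eval (-(x / Real.sqrt (finalTime t))) =
        (-1) ^ (2 * j + 1) * (derivative (hermiteH (2 * j))).eval (x / Real.sqrt (finalTime t)) := by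
      rcases Nat.eq_zero_or_pos j with rfl | hj
      · simp [hermiteH]
      · obtain ⟨m, rfl⟩ := Nat.exists_eq_add_of_le' hj
        have e1 : 2 * (m + 1) = 2 * m + 1 + 1 := by ring
        rw [e1, derivative_hermiteH_succ, eval_smul, eval_smul, hermiteH_eval_neg]
        simp only [smul_eq_mul]
        ring
    rw [this]
    ring

theorem integrable_finalFn (hM : 1 ≤ M) (ht₀ : t 0 = 0) (ht : StrictMono t) (k : ℕ) :
    Integrable (finalFn t k) :=
  integrable_heatOp (by have := time_one_lt_finalTime hM ht; linarith)
    (integrable_initialFn ht₀ ht k)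

/-- The odd function is a derivative, so integrating it against sgn yields 2 t₁ times the even one.
The square of the Gaussian weight is a Gaussian of variance T/2, for which the Hermite polynomials
in x / √T are orthogonal. -/
theorem skewForm_finalFn_even_odd (hM : 1 ≤ M) (ht₀ : t 0 = 0) (ht : StrictMono t) (j k : ℕ) :
    skewForm (finalFn t (2 * j)) (finalFn t (2 * k + 1)) = if j = k then skewNorm t k else 0 := by
  have h1 := time_one_pos ht₀ ht
  have h2 := time_one_lt_finalTime hM ht
  have h4 : 0 < finalTime t := by linarith
  have h7 := Real.mul_self_sqrt h4.le
  have h8 : 0 < Real.sqrt (finalTime t) := Real.sqrt_pos.2 h4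
  have hstep : ∀ x, ∫ y, finalFn t (2 * k + 1) y * signKernel x y = 2 * t 1 * finalFn t (2 * k) x := by
    intro x
    have h := integral_deriv_mul_signKernel (hasDerivAt_finalFn hM ht₀ ht k)
      (integrable_finalFn hM ht₀ ht _) ((integrable_finalFn hM ht₀ ht _).const_mul _) x
    simp only [mul_assoc] at h
    rw [integral_const_mul] at h
    field_simp at h
    linarith
  unfold skewForm
  simp only [hstep]
  have hsq : ∀ x, heat (finalTime t) 0 x * heat (finalTime t) 0 x =
      1 / (2 * Real.sqrt (Real.pi * finalTime t)) * heat (finalTime t / 2) 0 x := by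
    intro x
    unfold heat
    rw [mul_mul_mul_comm, ← Real.exp_add, one_div_mul_one_div, Real.mul_self_sqrt (by positivity),
      ← mul_assoc, one_div_mul_one_div]
    have e1 : 2 * Real.pi * (finalTime t / 2) = Real.pi * finalTime t := by ring
    have hpi := Real.pi_pos
    have e3 : -(0 - x) ^ 2 / (2 * finalTime t) + -(0 - x) ^ 2 / (2 * finalTime t) =
        -(0 - x) ^ 2 / (2 * (finalTime t / 2)) := by
      field_simp
      ring
    rw [e1, mul_assoc 2, mul_assoc 2, Real.mul_self_sqrt (by positivity), e3]
  have hint : ∀ x, finalFn t (2 * j) x * (2 * t 1 * finalFn t (2 * k) x) =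
      (2 * t 1 * (t 1 / (2 * Real.sqrt (finalTime t))) ^ (2 * j) *
        (t 1 / (2 * Real.sqrt (finalTime t))) ^ (2 * k) *
        (1 / (2 * Real.sqrt (Real.pi * finalTime t)))) *
      (heat (finalTime t / 2) 0 x * ((hermiteH (2 * j)).eval ((Real.sqrt (finalTime t))⁻¹ * x) *
        (hermiteH (2 * k)).eval ((Real.sqrt (finalTime t))⁻¹ * x))) := by
    intro x
    rw [finalFn_even hM ht₀ ht, finalFn_even hM ht₀ ht, ← div_eq_inv_mul]
    linear_combination (2 * t 1 * (t 1 / (2 * Real.sqrt (finalTime t))) ^ (2 * j) *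
      (t 1 / (2 * Real.sqrt (finalTime t))) ^ (2 * k) *
      (hermiteH (2 * j)).eval (x / Real.sqrt (finalTime t)) *
      (hermiteH (2 * k)).eval (x / Real.sqrt (finalTime t))) * hsq x
  simp only [hint]
  rw [integral_const_mul, integral_heat_hermiteH_mul (by positivity) (by
    rw [inv_pow, Real.sq_sqrt h4.le]
    field_simp)]
  by_cases hjk : j = k
  · subst hjk
    simp only [if_true]
    -- Legendre's duplication formula brings the Gamma factors of `skewNorm` to the factorial in the
    -- Hermite norm.
    have hΓ : Real.Gamma ((j : ℝ) + 1 / 2) * Real.Gamma ((j : ℝ) + 1) =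
        ((2 * j)! : ℝ) * (2 : ℝ) ^ (-(2 * (j : ℝ))) * Real.sqrt Real.pi := by
      have h := Real.Gamma_mul_Gamma_add_half ((j : ℝ) + 1 / 2)
      have e1 : (j : ℝ) + 1 / 2 + 1 / 2 = j + 1 := by ring
      have e2 : 2 * ((j : ℝ) + 1 / 2) = ((2 * j : ℕ) : ℝ) + 1 := by push_cast; ring
      rw [e1, e2, Real.Gamma_nat_eq_factorial (2 * j)] at h
      rw [h]
      congr 3
      push_cast
      ring
    have hp : (2 : ℝ) ^ (-(2 * (j : ℝ))) = ((2 : ℝ) ^ (2 * j))⁻¹ := by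
      rw [Real.rpow_neg (by norm_num)]
      congr 1
      rw [← Real.rpow_natCast]
      push_cast
      rfl
    have hr : (t 1 ^ 2 / finalTime t) ^ (2 * (j : ℝ) + 1 / 2) =
        (t 1 / Real.sqrt (finalTime t)) ^ (4 * j + 1) := by
      have e3 : t 1 ^ 2 / finalTime t = (t 1 / Real.sqrt (finalTime t)) ^ (2 : ℝ) := by
        rw [Real.rpow_two, div_pow, Real.sq_sqrt h4.le]
      rw [e3, ← Real.rpow_mul (by positivity), ← Real.rpow_natCast]
      congr 1
      push_cast
      ring
    rw [skewNorm, hΓ, hp, hr, Real.sqrt_mul Real.pi_pos.le]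
    have hpi := Real.mul_self_sqrt Real.pi_pos.le
    have hpi' : 0 < Real.sqrt Real.pi := Real.sqrt_pos.2 Real.pi_pos
    rw [← hpi, show 4 * j + 1 = 2 * j + 2 * j + 1 by ring, pow_succ, pow_add, div_pow, div_pow,
      mul_pow]
    rw [hpi]
    field_simp
    rw [Real.sq_sqrt Real.pi_pos.le]
  · have : 2 * j ≠ 2 * k := by omega
    simp [hjk, this]

theorem skewForm_finalFn (hM : 1 ≤ M) (ht₀ : t 0 = 0) (ht : StrictMono t) {n : ℕ}
    (i j : Fin (n * 2)) :
    skewForm (finalFn t i) (finalFn t j) =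
      symplDiag (finProdFinEquiv : Fin n × Fin 2 ≃ Fin (n * 2)) (fun k => skewNorm t k) i j := by
  obtain ⟨⟨k, a⟩, rfl⟩ := finProdFinEquiv.surjective i
  obtain ⟨⟨l, b⟩, rfl⟩ := finProdFinEquiv.surjective j
  have hv : ∀ (k : Fin n) (a : Fin 2),
      ((finProdFinEquiv (k, a) : Fin (n * 2)) : ℕ) = a + 2 * k := fun k a => rfl
  simp only [symplDiag, Matrix.of_apply, Equiv.symm_apply_apply, hv, Fin.ext_iff]
  have hpar : ∀ (ε : ℝ) (p q : ℕ), ε * ε = 1 → (-1) ^ p = ε → (-1) ^ q = ε →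
      skewForm (finalFn t p) (finalFn t q) = 0 := by
    intro ε p q hε hp hq
    exact skewForm_eq_zero_of_parity hε (fun x => by rw [finalFn_neg hM ht₀ ht, hp])
      (fun x => by rw [finalFn_neg hM ht₀ ht, hq])
  fin_cases a <;> fin_cases b
  · simp only [Fin.zero_eta, zero_add, symplTwo, lt_irrefl, if_false]
    rw [hpar 1 _ _ (by norm_num) (by simp) (by simp)]
    simp
  · simp only [Fin.zero_eta, Fin.mk_one, zero_add]
    rw [add_comm 1, skewForm_finalFn_even_odd hM ht₀ ht]
    by_cases h : (k : ℕ) = l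
    · simp [h, symplTwo]
    · simp [h]
  · simp only [Fin.zero_eta, Fin.mk_one, zero_add]
    rw [add_comm 1, skewForm_antisymm (integrable_finalFn hM ht₀ ht _)
      (integrable_finalFn hM ht₀ ht _), skewForm_finalFn_even_odd hM ht₀ ht]
    by_cases h : (k : ℕ) = l
    · simp [h, symplTwo]
    · simp [h, Ne.symm h]
  · simp only [Fin.mk_one, symplTwo, lt_irrefl, if_false]
    rw [hpar (-1) _ _ (by norm_num) (by simp [pow_add]) (by simp [pow_add])]
    simp

theorem skewNorm_pos (hM : 1 ≤ M) (ht₀ : t 0 = 0) (ht : StrictMono t) (k : ℕ) :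
    0 < skewNorm t k := by
  have h1 := time_one_pos ht₀ ht
  have h2 := time_one_lt_finalTime hM ht
  have h4 : 0 < finalTime t := by linarith
  have h5 := Real.Gamma_pos_of_pos (s := (k : ℝ) + 1 / 2) (by positivity)
  have h6 := Real.Gamma_pos_of_pos (s := (k : ℝ) + 1) (by positivity)
  unfold skewNorm
  have := Real.pi_pos
  positivity

/-- The normalization of the multitime density. -/
theorem originConst_mul_prod_skewNorm (hM : 1 ≤ M) (ht₀ : t 0 = 0) (ht : StrictMono t) (n : ℕ) :
    originConst (n * 2) (finalTime t) (t 1) * ∏ k : Fin n, skewNorm t k = 1 := by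
  have h1 := time_one_pos ht₀ ht
  have h2 := time_one_lt_finalTime hM ht
  have h4 : 0 < finalTime t := by linarith
  rw [Fin.prod_univ_eq_prod_range]
  induction n with
  | zero => simp [originConst]
  | succ n ih =>
    rw [Finset.prod_range_succ, ← mul_assoc]
    -- One more pair of particles adds two Gamma factors and powers of π, T and t₁ to the constant;
    -- they cancel against the next norm.
    have hstep : originConst ((n + 1) * 2) (finalTime t) (t 1) * skewNorm t n =
        originConst (n * 2) (finalTime t) (t 1) := by
      unfold originConst skewNorm
      have hG1 : 0 < Real.Gamma ((n : ℝ) + 1 / 2) := Real.Gamma_pos_of_pos (by positivity)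
      have hG2 : 0 < Real.Gamma ((n : ℝ) + 1) := Real.Gamma_pos_of_pos (by positivity)
      rw [show (n + 1) * 2 = n * 2 + 1 + 1 by ring, Finset.prod_Icc_succ_top (by omega),
        Finset.prod_Icc_succ_top (by omega)]
      have e1 : (((n * 2 + 1 : ℕ) : ℝ)) / 2 = n + 1 / 2 := by push_cast; ring
      have e2 : (((n * 2 + 1 + 1 : ℕ) : ℝ)) / 2 = n + 1 := by push_cast; ring
      have e3 : (((n * 2 : ℕ) : ℝ)) / 2 = n := by push_cast; ring
      rw [e1, e2, e3]
      rw [Real.rpow_add Real.pi_pos, Real.rpow_one]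
      have e4 : (((n * 2 + 1 + 1 : ℕ) : ℝ)) * (((n * 2 + 1 + 1 : ℕ) : ℝ) - 1) / 4 =
          ((n * 2 : ℕ) : ℝ) * (((n * 2 : ℕ) : ℝ) - 1) / 4 + (2 * n + 1 / 2) := by
        push_cast; ring
      have e5 : -((((n * 2 + 1 + 1 : ℕ) : ℝ)) * (((n * 2 + 1 + 1 : ℕ) : ℝ) - 1) / 2) =
          -(((n * 2 : ℕ) : ℝ) * (((n * 2 : ℕ) : ℝ) - 1) / 2) + -(2 * (2 * n + 1 / 2)) := by
        push_cast; ring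
      have e6 : (t 1 ^ 2 / finalTime t) ^ (2 * (n : ℝ) + 1 / 2) =
          t 1 ^ (2 * (2 * (n : ℝ) + 1 / 2)) * (finalTime t ^ (2 * (n : ℝ) + 1 / 2))⁻¹ := by
        rw [Real.div_rpow (by positivity) h4.le, Real.rpow_mul h1.le, Real.rpow_two]
        rfl
      rw [e4, e5, e6, Real.rpow_add h4, Real.rpow_add h1, Real.rpow_neg h1.le (2 * (2 * (n : ℝ) + 1 / 2))]
      have hp1 : 0 < t 1 ^ (2 * (2 * (n : ℝ) + 1 / 2)) := Real.rpow_pos_of_pos h1 _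
      have hp2 : 0 < finalTime t ^ (2 * (n : ℝ) + 1 / 2) := Real.rpow_pos_of_pos h4 _
      have hpi := Real.pi_pos
      field_simp
    rw [mul_right_comm, hstep, ih]

end SkewOrthogonal

/-! ### The survival probability does not vanish -/

section Survival

theorem strictMono_tail {k : ℕ} {f : Fin (k + 1) → ℝ} (hf : StrictMono f) :
    StrictMono fun i : Fin k => f i.succ :=
  fun _ _ h => hf (Fin.succ_lt_succ_iff.2 h)

/-- A nontrivial combination of `k` exponentials has fewer than `k` zeros. -/
theorem exponential_sum_eq_zero : ∀ (k : ℕ) (l y c : Fin k → ℝ), StrictMono l → StrictMono y →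
    (∀ j, ∑ i, c i * Real.exp (l i * y j) = 0) → ∀ i, c i = 0
  | 0, _, _, _, _, _, _ => fun i => i.elim0
  | k + 1, l, y, c, hl, hy, h => by
    -- After division by exp(l₀ z) the first term is constant. Differentiation removes it, and
    -- Rolle's theorem provides `k` zeros for the `k` remaining exponentials.
    set g : ℝ → ℝ := fun z => ∑ i, c i * Real.exp ((l i - l 0) * z) with hg
    set g' : ℝ → ℝ := fun z => ∑ i, c i * (Real.exp ((l i - l 0) * z) * (l i - l 0)) with hg'
    have hd : ∀ z, HasDerivAt g (g' z) z := fun z =>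
      HasDerivAt.fun_sum fun i _ =>
        ((((hasDerivAt_id z).const_mul (l i - l 0)).exp).const_mul (c i)).congr_deriv (by simp)
    have hz : ∀ j, g (y j) = 0 := by
      intro j
      have : g (y j) = (∑ i, c i * Real.exp (l i * y j)) * Real.exp (-(l 0 * y j)) := by
        rw [Finset.sum_mul]
        refine Finset.sum_congr rfl fun i _ => ?_
        rw [mul_assoc, ← Real.exp_add]
        congr 2
        ring
      rw [this, h j, zero_mul]
    have hroll : ∀ j : Fin k, ∃ z ∈ Set.Ioo (y j.castSucc) (y j.succ), g' z = 0 := fun j =>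
      exists_hasDerivAt_eq_zero (hy Fin.castSucc_lt_succ)
        (fun z _ => (hd z).continuousAt.continuousWithinAt) (by rw [hz, hz]) fun z _ => hd z
    choose z hz1 hz2 using hroll
    have hzm : StrictMono z := by
      intro i j hij
      refine (hz1 i).2.trans (lt_of_le_of_lt (hy.monotone ?_) (hz1 j).1)
      rw [Fin.le_def]
      simpa using hij
    have hsucc := exponential_sum_eq_zero k (fun i => l i.succ - l 0) z
      (fun i => c i.succ * (l i.succ - l 0))
      (fun i j hij => sub_lt_sub_right (strictMono_tail hl hij) _) hzm (by
        intro j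
        have := hz2 j
        simp only [hg', Fin.sum_univ_succ, sub_self, mul_zero, zero_add] at this
        rw [← this]
        exact Finset.sum_congr rfl fun i _ => by ring)
    have hc : ∀ i : Fin k, c i.succ = 0 := by
      intro i
      have hne : l i.succ - l 0 ≠ 0 := (sub_pos.2 (hl (Fin.succ_pos i))).ne'
      exact (mul_eq_zero.1 (hsucc i)).resolve_right hne
    intro i
    refine Fin.cases ?_ hc i
    have := hz 0
    simpa [hg, Fin.sum_univ_succ, hc] using this

/-- A dependence between the rows is a combination of heat kernels with `N` zeros. Dividing out the
Gaussian factor in y leaves exponentials with the distinct exponents x_i / t. -/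
theorem absorbedDensity_ne_zero {N : ℕ} {t : ℝ} (ht : 0 < t) {x y : Fin N → ℝ}
    (hx : StrictMono x) (hy : StrictMono y) : absorbedDensity t x y ≠ 0 := by
  intro h0
  obtain ⟨v, hv, hv0⟩ := Matrix.exists_vecMul_eq_zero_iff.2 h0
  refine hv (funext fun i => ?_)
  have hx' : StrictMono fun i => x i / t := fun i j hij => div_lt_div_of_pos_right (hx hij) ht
  have := exponential_sum_eq_zero N _ y (fun i => v i * Real.exp (-(x i) ^ 2 / (2 * t))) hx' hy (by
    intro j
    have h1 := congrFun hv0 j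
    have h2 : (∑ i, v i * heat t (x i) (y j)) = 0 := h1
    have h3 : ∑ i, v i * Real.exp (-(x i) ^ 2 / (2 * t)) * Real.exp (x i / t * y j) =
        (∑ i, v i * heat t (x i) (y j)) *
          (Real.sqrt (2 * Real.pi * t) * Real.exp ((y j) ^ 2 / (2 * t))) := by
      rw [Finset.sum_mul]
      refine Finset.sum_congr rfl fun i _ => ?_
      have hs : 0 < Real.sqrt (2 * Real.pi * t) :=
        Real.sqrt_pos.2 (by have := Real.pi_pos; positivity)
      have h4 : Real.exp (-(x i) ^ 2 / (2 * t)) * Real.exp (x i / t * y j) =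
          Real.exp (-(x i - y j) ^ 2 / (2 * t)) * Real.exp ((y j) ^ 2 / (2 * t)) := by
        rw [← Real.exp_add, ← Real.exp_add]
        congr 1
        field_simp
        ring
      rw [mul_assoc, h4, heat]
      field_simp
    rw [h3, h2, zero_mul]) i
  exact (mul_eq_zero.1 this).resolve_right (Real.exp_pos _).ne'

theorem isOpen_weylChamber (N : ℕ) : IsOpen (weylChamber N) := by
  have : weylChamber N = ⋂ i, ⋂ j, {x : Fin N → ℝ | i < j → x i < x j} := by
    ext x
    simp only [weylChamber, Set.mem_iInter, Set.mem_ofPred_eq]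
    exact Iff.rfl
  rw [this]
  refine isOpen_iInter_of_finite fun i => isOpen_iInter_of_finite fun j => ?_
  by_cases h : i < j
  · simp only [h, true_imp_iff]
    exact isOpen_lt (continuous_apply i) (continuous_apply j)
  · simp [h]

theorem convex_weylChamber (N : ℕ) : Convex ℝ (weylChamber N) := by
  intro x hx y hy a b ha hb hab i j hij
  have h1 := (show StrictMono x from hx) hij
  have h2 := (show StrictMono y from hy) hij
  simp only [Pi.add_apply, Pi.smul_apply, smul_eq_mul]
  rcases ha.eq_or_lt with rfl | ha
  · have : b = 1 := by linarith
    subst this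
    linarith
  · nlinarith

theorem continuous_absorbedDensity {N : ℕ} (t : ℝ) (x : Fin N → ℝ) :
    Continuous fun y => absorbedDensity t x y := by
  unfold absorbedDensity
  refine Continuous.matrix_det ?_
  refine continuous_matrix fun i j => ?_
  exact (continuous_heat t).comp (continuous_const.prodMk (continuous_apply j))

theorem integrable_absorbedDensity {N : ℕ} {t : ℝ} (ht : 0 < t) (x : Fin N → ℝ) :
    Integrable fun y => absorbedDensity t x y := by
  unfold absorbedDensity
  simp only [Matrix.det_apply', Matrix.of_apply]
  refine integrable_finsetSum _ fun σ _ => Integrable.const_mul ?_ _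
  exact Integrable.fintype_prod (f := fun i z => heat t (x (σ i)) z)
    fun i => integrable_heat ht _

/-- The density has no zeros on the chamber, which is connected, so it has constant sign there.
Nonvanishing of its integral is all that the telescoping quotients need; the sign itself is left
open. -/
theorem survivalProb_ne_zero {N : ℕ} {t : ℝ} (ht : 0 ≤ t) {x : Fin N → ℝ} (hx : StrictMono x) :
    survivalProb t x ≠ 0 := by
  unfold survivalProb
  split_ifs with h0
  · exact one_ne_zero
  have ht' : 0 < t := lt_of_le_of_ne ht (Ne.symm h0)
  have hpos : 0 < volume (weylChamber N) :=
    (isOpen_weylChamber N).measure_pos volume ⟨x, hx⟩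
  have hms : MeasurableSet (weylChamber N) := (isOpen_weylChamber N).measurableSet
  have key : ∀ f : (Fin N → ℝ) → ℝ, Integrable f → (∀ y ∈ weylChamber N, 0 < f y) →
      0 < ∫ y in weylChamber N, f y := by
    intro f hf h
    rw [setIntegral_pos_iff_support_of_nonneg_ae
      ((ae_restrict_iff' hms).2 (Filter.Eventually.of_forall fun y hy => (h y hy).le))
      hf.integrableOn]
    have hsub : weylChamber N ⊆ Function.support f := fun y hy => (h y hy).ne'
    rwa [Set.inter_eq_right.2 hsub]
  have hpre : IsPreconnected ((fun y => absorbedDensity t x y) '' weylChamber N) :=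
    (convex_weylChamber N).isPreconnected.image _ (continuous_absorbedDensity t x).continuousOn
  have hne : ∀ y ∈ weylChamber N, absorbedDensity t x y ≠ 0 := fun y hy =>
    absorbedDensity_ne_zero ht' hx hy
  rcases lt_or_gt_of_ne (hne x hx) with hlt | hgt
  · have := key (fun y => -absorbedDensity t x y) (integrable_absorbedDensity ht' x).neg (by
      intro y hy
      by_contra hcon
      have h1 : 0 ≤ absorbedDensity t x y := by linarith
      obtain ⟨z, hz, hz0⟩ := hpre.ordConnected.out (Set.mem_image_of_mem _ hx)
        (Set.mem_image_of_mem _ hy) ⟨hlt.le, h1⟩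
      exact hne z hz hz0)
    rw [integral_neg] at this
    exact (neg_pos.1 this).ne
  · refine (key (fun y => absorbedDensity t x y) (integrable_absorbedDensity ht' x) ?_).ne'
    intro y hy
    by_contra hcon
    obtain ⟨z, hz, hz0⟩ := hpre.ordConnected.out (Set.mem_image_of_mem _ hy)
      (Set.mem_image_of_mem _ hx) ⟨not_lt.1 hcon, hgt.le⟩
    exact hne z hz hz0

end Survival

/-! ### The multitime density as a product of determinants and a Pfaffian -/

section Density

theorem config_comp_equiv {k l : ℕ} (x : Fin k → ℝ) (e : Fin l ≃ Fin k) :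
    config (x ∘ e) = config x := by
  ext z
  simp only [config, Finset.mem_image, Finset.mem_univ, true_and, Function.comp_apply]
  exact ⟨fun ⟨i, hi⟩ => ⟨e i, hi⟩, fun ⟨i, hi⟩ => ⟨e.symm i, by simpa using hi⟩⟩

theorem card_config_eq_iff {k : ℕ} (x : Fin k → ℝ) :
    (config x).card = k ↔ Function.Injective x := by
  have := Finset.card_image_iff (s := Finset.univ) (f := x)
  rw [Finset.card_univ, Fintype.card_fin, Finset.coe_univ, Set.injOn_univ] at this
  exact this

theorem orderEmbOfFin_config {k : ℕ} {x : Fin k → ℝ} (hx : StrictMono x)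
    (h : (config x).card = k) : ((config x).orderEmbOfFin h : Fin k → ℝ) = x :=
  (Finset.orderEmbOfFin_unique h (fun i => Finset.mem_image_of_mem x (Finset.mem_univ i)) hx).symm

theorem configTransDensity_of_card_ne {N : ℕ} {T s t : ℝ} {ξ η : Finset ℝ} (h : η.card ≠ N) :
    configTransDensity N T s ξ t η = 0 := by
  unfold configTransDensity
  rw [dif_neg (fun h' => h h'.2.2), dif_neg (fun h' => h h'.2.2)]

theorem configTransDensity_config {N : ℕ} {T s t : ℝ} (hs : 0 < s) {x y : Fin N → ℝ}
    (hx : StrictMono x) (hy : StrictMono y) :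
    configTransDensity N T s (config x) t (config y) = transDensity T s x t y := by
  have h : 0 < s ∧ (config x).card = N ∧ (config y).card = N :=
    ⟨hs, (card_config_eq_iff x).2 hx.injective, (card_config_eq_iff y).2 hy.injective⟩
  unfold configTransDensity
  rw [dif_pos h, orderEmbOfFin_config hx, orderEmbOfFin_config hy]

theorem configTransDensity_origin {N : ℕ} {T t : ℝ} {y : Fin N → ℝ} (hy : StrictMono y) :
    configTransDensity N T 0 {0} t (config y) = originDensity T t y := by
  have h : (0 : ℝ) = 0 ∧ ({0} : Finset ℝ) = {0} ∧ (config y).card = N :=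
    ⟨rfl, rfl, (card_config_eq_iff y).2 hy.injective⟩
  unfold configTransDensity
  rw [dif_neg (fun h' => lt_irrefl _ h'.1), dif_pos h, orderEmbOfFin_config hy]

theorem vandermondeProd_eq_det {N : ℕ} (x : Fin N → ℝ) :
    vandermondeProd x = (Matrix.vandermonde x).det := (Matrix.det_vandermonde x).symm

variable {M : ℕ} {t : Fin (M + 2) → ℝ}

/-- Since the polynomials are monic of degrees 0, 1, …, column operations reduce their determinant
to Vandermonde's. -/
theorem det_initialFn (hM : 1 ≤ M) (ht₀ : t 0 = 0) (ht : StrictMono t) {N : ℕ} (x : Fin N → ℝ) :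
    (Matrix.of fun i j : Fin N => initialFn t j (x i)).det =
      vandermondeProd x * ∏ i, heat (t 1) 0 (x i) := by
  rw [vandermondeProd_eq_det, Matrix.det_eval_matrixOfPolynomials_eq_det_vandermonde x
    (fun j : Fin N => skewPolynomial t j) (fun j => (skewPolynomial_monic hM ht₀ ht j).2)
    (fun j => (skewPolynomial_monic hM ht₀ ht j).1), mul_comm]
  refine Eq.trans ?_ (Matrix.det_mul_column (fun i => heat (t 1) 0 (x i))
    (Matrix.of fun i j : Fin N => (skewPolynomial t j).eval (x i)))
  congr 1
  exact Matrix.ext fun i j => initialFn_eq t j (x i)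

/-- The sign of the Vandermonde product, up to the factor `2ⁿ n!`, as a Pfaffian. -/
noncomputable def signPf {n : ℕ} (x : Fin (n * 2) → ℝ) : ℝ :=
  pfSum finProdFinEquiv (Matrix.of fun i j => signKernel (x i) (x j))

theorem signPf_comp {n : ℕ} (x : Fin (n * 2) → ℝ) (σ : Equiv.Perm (Fin (n * 2))) :
    signPf (x ∘ σ) = ((Equiv.Perm.sign σ : ℤ) : ℝ) * signPf x :=
  pfSum_submatrix finProdFinEquiv (Matrix.of fun i j => signKernel (x i) (x j)) σ

theorem signPf_of_strictMono {n : ℕ} {x : Fin (n * 2) → ℝ} (hx : StrictMono x) :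
    signPf x = 2 ^ n * n ! := by
  rw [← pfSum_signMatrix (R := ℝ) n, signPf]
  congr 1
  refine Matrix.ext fun i j => ?_
  simp [signKernel, signMatrix, hx.lt_iff_lt]

/-- The density of the paths, up to a constant, as an antisymmetric function of the particles at
every time. -/
noncomputable def pathWeight {n : ℕ} (t : Fin (M + 2) → ℝ) (X : Fin (M + 1) → Fin (n * 2) → ℝ) : ℝ :=
  (Matrix.of fun i j : Fin (n * 2) => initialFn t j (X 0 i)).det *
    (∏ m : Fin M, absorbedDensity (t m.succ.succ - t m.castSucc.succ) (X m.castSucc) (X m.succ)) *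
    signPf (X (Fin.last M))

theorem absorbedDensity_comp {N : ℕ} (s : ℝ) (x y : Fin N → ℝ) (σ τ : Equiv.Perm (Fin N)) :
    absorbedDensity s (x ∘ σ) (y ∘ τ) =
      ((Equiv.Perm.sign σ : ℤ) : ℝ) * (((Equiv.Perm.sign τ : ℤ) : ℝ) * absorbedDensity s x y) := by
  have h1 := Matrix.det_permute σ (Matrix.of fun i j => heat s (x i) (y (τ j)))
  have h2 := Matrix.det_permute' τ (Matrix.of fun i j => heat s (x i) (y j))
  unfold absorbedDensity
  exact h1.trans (congrArg _ h2)

/-- The particles of each time occur in exactly two antisymmetric factors, the one leading to that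
time and the one leaving it, so the signs cancel in pairs. -/
theorem pathWeight_comp {n : ℕ} (X : Fin (M + 1) → Fin (n * 2) → ℝ)
    (σ : Fin (M + 1) → Equiv.Perm (Fin (n * 2))) :
    pathWeight t (fun m => X m ∘ σ m) = pathWeight t X := by
  have h1 : (Matrix.of fun i j : Fin (n * 2) => initialFn t j ((X 0 ∘ σ 0) i)).det =
      ((Equiv.Perm.sign (σ 0) : ℤ) : ℝ) *
        (Matrix.of fun i j : Fin (n * 2) => initialFn t j (X 0 i)).det :=
    Matrix.det_permute (σ 0) (Matrix.of fun i j : Fin (n * 2) => initialFn t j (X 0 i))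
  unfold pathWeight
  rw [h1, signPf_comp]
  simp only [absorbedDensity_comp, Finset.prod_mul_distrib]
  have h2 := Fin.prod_univ_succ (fun m => (((Equiv.Perm.sign (σ m) : ℤ)) : ℝ))
  have h3 := Fin.prod_univ_castSucc (fun m => (((Equiv.Perm.sign (σ m) : ℤ)) : ℝ))
  have h4 : (∏ m, (((Equiv.Perm.sign (σ m) : ℤ)) : ℝ)) * ∏ m, (((Equiv.Perm.sign (σ m) : ℤ)) : ℝ)
      = 1 := by
    rw [← Finset.prod_mul_distrib]
    refine Finset.prod_eq_one fun m _ => ?_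
    rw [← Int.cast_mul, ← Units.val_mul, Int.units_mul_self]
    simp
  have h5 := h4
  nth_rewrite 1 [h2] at h5
  rw [h3] at h5
  linear_combination ((Matrix.of fun i j : Fin (n * 2) => initialFn t j (X 0 i)).det *
    (∏ m : Fin M, absorbedDensity (t m.succ.succ - t m.castSucc.succ) (X m.castSucc) (X m.succ)) *
    signPf (X (Fin.last M))) * h5

theorem multitimeDensity_of_strictMono (hM : 1 ≤ M) (ht₀ : t 0 = 0) (ht : StrictMono t) {n : ℕ}
    {X : Fin (M + 1) → Fin (n * 2) → ℝ} (hX : ∀ m, StrictMono (X m)) :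
    multitimeDensity (n * 2) t (fun m => config (X m)) =
      originConst (n * 2) (finalTime t) (t 1) / (2 ^ n * n !) * pathWeight t X := by
  have hpos : ∀ m : Fin (M + 1), 0 < t m.succ := fun m => by
    rw [← ht₀]
    exact ht (Fin.succ_pos m)
  set S : Fin (M + 1) → ℝ := fun m => survivalProb (finalTime t - t m.succ) (X m) with hS
  have hS0 : ∀ m, S m ≠ 0 := fun m =>
    survivalProb_ne_zero (sub_nonneg.2 (ht.monotone (Fin.le_last _))) (hX m)
  have hSl : S (Fin.last M) = 1 := by
    simp [hS, survivalProb, finalTime, Fin.succ_last]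
  have hstep : ∀ m : Fin M, configTransDensity (n * 2) (finalTime t) (t m.succ.castSucc)
      ((Fin.cons {0} (fun m => config (X m)) : Fin (M + 2) → Finset ℝ) m.succ.castSucc)
      (t m.succ.succ) (config (X m.succ)) =
      absorbedDensity (t m.succ.succ - t m.castSucc.succ) (X m.castSucc) (X m.succ) *
        (S m.succ / S m.castSucc) := by
    intro m
    rw [← Fin.succ_castSucc, Fin.cons_succ,
      configTransDensity_config (hpos _) (hX _) (hX _), transDensity, mul_div_assoc]
  -- The survival probabilities telescope from the first time to the last one, where the probability
  -- is 1.
  have htel : S 0 * ∏ m : Fin M, S m.succ / S m.castSucc = 1 := by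
    have h2 := Fin.prod_univ_succ S
    have h3 := Fin.prod_univ_castSucc S
    have h4 : ∏ m : Fin M, S m.castSucc ≠ 0 := Finset.prod_ne_zero_iff.2 fun m _ => hS0 _
    rw [Finset.prod_div_distrib, ← mul_div_assoc, ← h2, h3, hSl, mul_one, div_self h4]
  have hone : (Fin.succ 0 : Fin (M + 2)) = 1 := rfl
  have hfac : (n ! : ℝ) ≠ 0 := by exact_mod_cast Nat.factorial_ne_zero n
  unfold multitimeDensity
  rw [Fin.prod_univ_succ]
  simp only [hstep]
  rw [Finset.prod_mul_distrib, Fin.castSucc_zero, Fin.cons_zero, ht₀,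
    configTransDensity_origin (hX 0), originDensity, pathWeight, det_initialFn hM ht₀ ht,
    signPf_of_strictMono (hX _), hone]
  have hS0' : survivalProb (finalTime t - t 1) (X 0) = S 0 := rfl
  rw [hS0']
  field_simp
  linear_combination (originConst (n * 2) (finalTime t) (t 1) * vandermondeProd (X 0) *
    (∏ m : Fin M, absorbedDensity (t m.succ.succ - t m.castSucc.succ) (X m.castSucc) (X m.succ)) *
    ∏ i, heat (t 1) 0 (X 0 i)) * htel

theorem pathWeight_of_not_injective {n : ℕ}
    {X : Fin (M + 1) → Fin (n * 2) → ℝ} {m : Fin (M + 1)} (hX : ¬ Function.Injective (X m)) :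
    pathWeight t X = 0 := by
  unfold pathWeight
  obtain ⟨i, j, hij, hne⟩ : ∃ i j, X m i = X m j ∧ i ≠ j := by
    simpa [Function.Injective] using hX
  revert hij hX
  refine Fin.cases ?_ (fun m => ?_) m
  · intro _ hij
    rw [Matrix.det_zero_of_row_eq hne, zero_mul, zero_mul]
    funext k
    simp [hij]
  · intro _ hij
    rw [Finset.prod_eq_zero (Finset.mem_univ m), mul_zero, zero_mul]
    unfold absorbedDensity
    refine Matrix.det_zero_of_column_eq hne fun k => ?_
    simp [hij]

/-- Distinct particles can be sorted at each time without changing either side. If two particles of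
one time coincide, both sides vanish, the left one because the configuration has too few points. -/
theorem multitimeDensity_config (hM : 1 ≤ M) (ht₀ : t 0 = 0) (ht : StrictMono t) {n : ℕ}
    (X : Fin (M + 1) → Fin (n * 2) → ℝ) :
    multitimeDensity (n * 2) t (fun m => config (X m)) =
      originConst (n * 2) (finalTime t) (t 1) / (2 ^ n * n !) * pathWeight t X := by
  by_cases hX : ∀ m, Function.Injective (X m)
  · have hs : ∀ m, StrictMono (X m ∘ Tuple.sort (X m)) := fun m =>
      (Tuple.monotone_sort (X m)).strictMono_of_injective
        ((hX m).comp (Tuple.sort (X m)).injective)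
    have := multitimeDensity_of_strictMono hM ht₀ ht hs
    rw [pathWeight_comp] at this
    simpa only [config_comp_equiv] using this
  · push Not at hX
    obtain ⟨m, hm⟩ := hX
    rw [pathWeight_of_not_injective hm, mul_zero]
    exact Finset.prod_eq_zero (Finset.mem_univ m)
      (configTransDensity_of_card_ne fun h => hm ((card_config_eq_iff _).1 h))

end Density

/-! ### Integrals of determinants and Pfaffians -/

section Andreief

variable {E κ ι : Type*} [MeasurableSpace E] [Fintype κ] [DecidableEq κ] [Fintype ι] [DecidableEq ι]
  (ν : Measure E) [SigmaFinite ν]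

omit [DecidableEq κ] in
theorem measurePreserving_pi_comp (σ : Equiv.Perm κ) :
    MeasurePreserving (fun y : κ → E => y ∘ σ) (Measure.pi fun _ => ν) (Measure.pi fun _ => ν) := by
  have hm : Measurable fun y : κ → E => y ∘ σ :=
    measurable_pi_lambda _ fun i => measurable_pi_apply (σ i)
  refine ⟨hm, (Measure.pi_eq fun s hs => ?_).symm⟩
  rw [Measure.map_apply hm (MeasurableSet.univ_pi hs)]
  have : (fun y : κ → E => y ∘ σ) ⁻¹' Set.univ.pi s = Set.univ.pi fun i => s (σ.symm i) := by
    ext y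
    simp only [Set.mem_preimage, Set.mem_univ_pi, Function.comp_apply]
    exact ⟨fun h i => by simpa using h (σ.symm i), fun h i => by simpa using h (σ i)⟩
  rw [this, Measure.pi_pi]
  exact Equiv.prod_comp σ.symm fun i => ν (s i)

/-- An antisymmetric factor absorbs the sign of each permuted term, so all terms have the same
integral. Both the Andréief and the de Bruijn identity follow from this. -/
theorem integral_antisymm_mul_sum {a g : (κ → E) → ℝ}
    (ha : ∀ (σ : Equiv.Perm κ) y, a (y ∘ σ) = ((Equiv.Perm.sign σ : ℤ) : ℝ) * a y)
    (hag : Integrable (fun y => a y * g y) (Measure.pi fun _ => ν)) :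
    ∫ y, a y * ∑ σ : Equiv.Perm κ, ((Equiv.Perm.sign σ : ℤ) : ℝ) * g (y ∘ σ)
      ∂(Measure.pi fun _ => ν) =
      ((Fintype.card κ)! : ℝ) * ∫ y, a y * g y ∂(Measure.pi fun _ => ν) := by
  have h1 : ∀ (σ : Equiv.Perm κ) y, a y * (((Equiv.Perm.sign σ : ℤ) : ℝ) * g (y ∘ σ)) =
      a (y ∘ σ) * g (y ∘ σ) := by
    intro σ y
    rw [ha]
    ring
  have h2 : ∀ σ : Equiv.Perm κ, Integrable (fun y => a (y ∘ σ) * g (y ∘ σ))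
      (Measure.pi fun _ => ν) := fun σ =>
    (measurePreserving_pi_comp ν σ).integrable_comp_of_integrable hag
  have h3 : ∀ σ : Equiv.Perm κ, ∫ y, a (y ∘ σ) * g (y ∘ σ) ∂(Measure.pi fun _ => ν) =
      ∫ y, a y * g y ∂(Measure.pi fun _ => ν) := by
    intro σ
    have hp := measurePreserving_pi_comp ν σ
    have := integral_map (μ := Measure.pi fun _ : κ => ν) (f := fun y => a y * g y)
      hp.measurable.aemeasurable (by rw [hp.map_eq]; exact hag.aestronglyMeasurable)
    rw [hp.map_eq] at this
    exact this.symm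
  simp only [Finset.mul_sum, h1]
  rw [integral_finsetSum _ fun σ _ => h2 σ]
  simp only [h3]
  rw [Finset.sum_const, Finset.card_univ, Fintype.card_perm, nsmul_eq_mul]

theorem det_eq_sum_prod_row {R : Type*} [CommRing R] (A : Matrix κ κ R) :
    A.det = ∑ σ : Equiv.Perm κ, ((Equiv.Perm.sign σ : ℤ) : R) * ∏ i, A i (σ i) := by
  rw [← Matrix.det_transpose, Matrix.det_apply']
  rfl

theorem integrable_det {f : κ → κ → E → ℝ} (hf : ∀ i j, Integrable (f i j) ν) :
    Integrable (fun y : κ → E => (Matrix.of fun i j => f i j (y i)).det)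
      (Measure.pi fun _ => ν) := by
  simp only [det_eq_sum_prod_row, Matrix.of_apply]
  exact integrable_finsetSum _ fun σ _ =>
    (Integrable.fintype_prod (f := fun i z => f i (σ i) z) fun i => hf i (σ i)).const_mul _

theorem integral_det {f : κ → κ → E → ℝ} (hf : ∀ i j, Integrable (f i j) ν) :
    ∫ y : κ → E, (Matrix.of fun i j => f i j (y i)).det ∂(Measure.pi fun _ => ν) =
      (Matrix.of fun i j => ∫ z, f i j z ∂ν).det := by
  simp only [det_eq_sum_prod_row, Matrix.of_apply]
  rw [integral_finsetSum _ fun σ _ =>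
    (Integrable.fintype_prod (f := fun i z => f i (σ i) z) fun i => hf i (σ i)).const_mul _]
  refine Finset.sum_congr rfl fun σ _ => ?_
  rw [integral_const_mul, integral_fintype_prod_eq_prod (fun i z => f i (σ i) z)]

omit [MeasurableSpace E] in
theorem det_of_comp_perm (q : κ → E → ℝ) (σ : Equiv.Perm κ) (y : κ → E) :
    (Matrix.of fun i j => q j ((y ∘ σ) i)).det =
      ((Equiv.Perm.sign σ : ℤ) : ℝ) * (Matrix.of fun i j => q j (y i)).det :=
  Matrix.det_permute σ (Matrix.of fun i j => q j (y i))

/-- The Andréief identity. -/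
theorem integral_det_mul_det {q k : κ → E → ℝ} (h : ∀ i j, Integrable (fun z => k i z * q j z) ν) :
    ∫ y : κ → E, (Matrix.of fun i j => q j (y i)).det * (Matrix.of fun i j => k j (y i)).det
      ∂(Measure.pi fun _ => ν) =
      ((Fintype.card κ)! : ℝ) * (Matrix.of fun i j => ∫ z, k i z * q j z ∂ν).det := by
  have h1 : ∀ y : κ → E, (Matrix.of fun i j => q j (y i)).det * ∏ i, k i (y i) =
      (Matrix.of fun i j => k i (y i) * q j (y i)).det := by
    intro y
    rw [mul_comm]
    exact (Matrix.det_mul_column (fun i => k i (y i)) (Matrix.of fun i j => q j (y i))).symm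
  have h2 := integral_antisymm_mul_sum ν (a := fun y => (Matrix.of fun i j => q j (y i)).det)
    (g := fun y => ∏ i, k i (y i)) (det_of_comp_perm q) (by
      simp only [h1]
      exact integrable_det ν h)
  simp only [h1] at h2
  rw [integral_det ν h] at h2
  rw [← h2]
  refine integral_congr_ae (Filter.Eventually.of_forall fun y => ?_)
  simp only
  rw [Matrix.det_apply' (Matrix.of fun i j => k j (y i))]
  rfl

omit [DecidableEq κ] [DecidableEq ι] in
theorem measurePreserving_pairs (e : ι × Fin 2 ≃ κ) :
    MeasurePreserving (fun (w : ι → E × E) (i : κ) =>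
      if (e.symm i).2 = 0 then (w (e.symm i).1).1 else (w (e.symm i).1).2)
      (Measure.pi fun _ => ν.prod ν) (Measure.pi fun _ => ν) := by
  have hm : Measurable (fun (w : ι → E × E) (i : κ) =>
      if (e.symm i).2 = 0 then (w (e.symm i).1).1 else (w (e.symm i).1).2) := by
    refine measurable_pi_lambda _ fun i => ?_
    split_ifs
    · exact (measurable_pi_apply (e.symm i).1).fst
    · exact (measurable_pi_apply (e.symm i).1).snd
  refine ⟨hm, (Measure.pi_eq fun s hs => ?_).symm⟩
  rw [Measure.map_apply hm (MeasurableSet.univ_pi hs)]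
  have : (fun (w : ι → E × E) (i : κ) =>
      if (e.symm i).2 = 0 then (w (e.symm i).1).1 else (w (e.symm i).1).2) ⁻¹' Set.univ.pi s =
      Set.univ.pi fun k => s (e (k, 0)) ×ˢ s (e (k, 1)) := by
    ext w
    simp only [Set.mem_preimage, Set.mem_univ_pi, Set.mem_prod]
    constructor
    · intro h k
      exact ⟨by simpa using h (e (k, 0)), by simpa using h (e (k, 1))⟩
    · intro h i
      obtain ⟨⟨k, a⟩, rfl⟩ := e.surjective i
      fin_cases a
      · simpa using (h k).1
      · simpa using (h k).2
  rw [this, Measure.pi_pi]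
  simp only [Measure.prod_prod]
  rw [← e.prod_comp, Fintype.prod_prod_type]
  simp only [Fin.prod_univ_two]

omit [DecidableEq ι] in
/-- The de Bruijn identity. -/
theorem integral_det_mul_pfSum (e : ι × Fin 2 ≃ κ) {q : κ → E → ℝ} (hq : ∀ j, Integrable (q j) ν)
    {s : E → E → ℝ} (hs : Measurable fun p : E × E => s p.1 p.2) {c : ℝ} (hc : ∀ x y, |s x y| ≤ c) :
    ∫ y : κ → E, (Matrix.of fun i j => q j (y i)).det * pfSum e (Matrix.of fun i j => s (y i) (y j))
      ∂(Measure.pi fun _ => ν) =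
      ((Fintype.card κ)! : ℝ) * pfSum e (Matrix.of fun i j =>
        ∫ p : E × E, q i p.1 * q j p.2 * s p.1 p.2 ∂(ν.prod ν)) := by
  have hg : Measurable fun y : κ → E => ∏ k : ι, s (y (e (k, 0))) (y (e (k, 1))) :=
    Finset.measurable_fun_prod _ fun k _ =>
      hs.comp (f := fun y : κ → E => (y (e (k, 0)), y (e (k, 1))))
        ((measurable_pi_apply (e (k, 0))).prodMk (measurable_pi_apply (e (k, 1))))
  have hgb : ∀ y : κ → E, ‖∏ k : ι, s (y (e (k, 0))) (y (e (k, 1)))‖ ≤ c ^ Fintype.card ι := by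
    intro y
    rw [norm_prod]
    refine (Finset.prod_le_prod (fun _ _ => norm_nonneg _) fun k _ => hc _ _).trans ?_
    simp
  have hint : ∀ τ : Equiv.Perm κ, Integrable (fun y : κ → E =>
      (∏ i, q (τ i) (y i)) * ∏ k : ι, s (y (e (k, 0))) (y (e (k, 1)))) (Measure.pi fun _ => ν) := by
    intro τ
    have := (Integrable.fintype_prod (f := fun i z => q (τ i) z) fun i => hq (τ i)).bdd_mul
      (hg.aestronglyMeasurable (μ := Measure.pi fun _ => ν)) (Filter.Eventually.of_forall hgb)
    refine this.congr (Filter.Eventually.of_forall fun y => ?_)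
    simp only
    ring
  have h1 : ∀ y : κ → E, (Matrix.of fun i j => q j (y i)).det *
      (∏ k : ι, s (y (e (k, 0))) (y (e (k, 1)))) = ∑ τ : Equiv.Perm κ,
      ((Equiv.Perm.sign τ : ℤ) : ℝ) * ((∏ i, q (τ i) (y i)) *
        ∏ k : ι, s (y (e (k, 0))) (y (e (k, 1)))) := by
    intro y
    rw [det_eq_sum_prod_row, Finset.sum_mul]
    exact Finset.sum_congr rfl fun τ _ => mul_assoc _ _ _
  have h2 := integral_antisymm_mul_sum ν (a := fun y => (Matrix.of fun i j => q j (y i)).det)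
    (g := fun y => ∏ k : ι, s (y (e (k, 0))) (y (e (k, 1)))) (det_of_comp_perm q) (by
      simp only [h1]
      exact integrable_finsetSum _ fun τ _ => (hint τ).const_mul _)
  simp only [h1] at h2
  rw [integral_finsetSum _ fun τ _ => (hint τ).const_mul _] at h2
  refine Eq.trans ?_ (h2.trans ?_)
  · rfl
  congr 1
  unfold pfSum
  refine Finset.sum_congr rfl fun τ _ => ?_
  rw [integral_const_mul]
  congr 1
  have hp := measurePreserving_pairs ν e
  have h3 := integral_map (f := fun y : κ → E => (∏ i, q (τ i) (y i)) *
    ∏ k : ι, s (y (e (k, 0))) (y (e (k, 1)))) hp.measurable.aemeasurable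
    (by rw [hp.map_eq]; exact (hint τ).aestronglyMeasurable)
  rw [hp.map_eq] at h3
  refine h3.trans (Eq.trans ?_ (integral_fintype_prod_eq_prod (μ := fun _ : ι => ν.prod ν)
    (fun k (p : E × E) => q (τ (e (k, 0))) p.1 * q (τ (e (k, 1))) p.2 * s p.1 p.2)))
  refine integral_congr_ae (Filter.Eventually.of_forall fun w => ?_)
  simp only
  rw [prod_pairs e, ← Finset.prod_mul_distrib]
  refine Finset.prod_congr rfl fun k _ => ?_
  simp

end Andreief

/-! ### Iterated integrals along chains of kernels -/

section Chain

open scoped ENNReal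

variable {E : Type*} [MeasurableSpace E]

theorem measurable_fin_cons {M : ℕ} :
    Measurable fun p : E × (Fin M → E) => (Fin.cons p.1 p.2 : Fin (M + 1) → E) := by
  refine measurable_pi_lambda _ fun i => ?_
  refine Fin.cases ?_ (fun j => ?_) i
  · simpa using measurable_fst
  · simp only [Fin.cons_succ]
    exact (measurable_pi_apply j).comp measurable_snd

theorem measurePreserving_fin_cons {M : ℕ} (μ : Fin (M + 1) → Measure E) [∀ i, SigmaFinite (μ i)] :
    MeasurePreserving (fun p : E × (Fin M → E) => (Fin.cons p.1 p.2 : Fin (M + 1) → E))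
      ((μ 0).prod (Measure.pi fun j : Fin M => μ j.succ)) (Measure.pi μ) := by
  refine ⟨measurable_fin_cons, (Measure.pi_eq fun s hs => ?_).symm⟩
  rw [Measure.map_apply measurable_fin_cons (MeasurableSet.univ_pi hs)]
  have : (fun p : E × (Fin M → E) => (Fin.cons p.1 p.2 : Fin (M + 1) → E)) ⁻¹' Set.univ.pi s =
      s 0 ×ˢ Set.univ.pi fun j : Fin M => s j.succ := by
    ext p
    simp only [Set.mem_preimage, Set.mem_univ_pi, Set.mem_prod, Fin.forall_fin_succ, Fin.cons_zero,
      Fin.cons_succ]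
  rw [this, Measure.prod_prod, Measure.pi_pi, Fin.prod_univ_succ]

theorem lintegral_pi_fin_succ {M : ℕ} (μ : Fin (M + 1) → Measure E) [∀ i, SigmaFinite (μ i)]
    {F : (Fin (M + 1) → E) → ℝ≥0∞} (hF : Measurable F) :
    ∫⁻ X, F X ∂Measure.pi μ =
      ∫⁻ x, ∫⁻ Y, F (Fin.cons x Y) ∂(Measure.pi fun j : Fin M => μ j.succ) ∂μ 0 := by
  rw [← (measurePreserving_fin_cons μ).lintegral_comp hF,
    lintegral_prod (fun p : E × (Fin M → E) => F (Fin.cons p.1 p.2))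
      (hF.comp measurable_fin_cons).aemeasurable]

theorem integral_pi_fin_succ {M : ℕ} (μ : Fin (M + 1) → Measure E) [∀ i, SigmaFinite (μ i)]
    {F : (Fin (M + 1) → E) → ℝ} (hF : Integrable F (Measure.pi μ)) :
    ∫ X, F X ∂Measure.pi μ =
      ∫ Y, ∫ x, F (Fin.cons x Y) ∂μ 0 ∂(Measure.pi fun j : Fin M => μ j.succ) := by
  have hp := measurePreserving_fin_cons μ
  have h1 := integral_map (f := F) hp.measurable.aemeasurable
    (by rw [hp.map_eq]; exact hF.aestronglyMeasurable)
  rw [hp.map_eq] at h1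
  rw [h1, integral_prod_symm]
  exact hp.integrable_comp_of_integrable hF

/-- The first variable is fixed, and the rest is a chain whose initial function is the kernel
started there; its total mass is at most `B`. -/
theorem lintegral_chain_le : ∀ (M : ℕ) (μ : Fin (M + 1) → Measure E) [∀ i, SigmaFinite (μ i)]
    (g : E → ℝ≥0∞) (K : Fin M → E → E → ℝ≥0∞) (B : ℝ≥0∞), Measurable g →
    (∀ m, Measurable fun p : E × E => K m p.1 p.2) → (∀ m x, ∫⁻ y, K m x y ∂μ m.succ ≤ B) →
    ∫⁻ X, g (X 0) * ∏ m, K m (X m.castSucc) (X m.succ) ∂Measure.pi μ ≤ (∫⁻ x, g x ∂μ 0) * B ^ M := by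
  intro M
  induction M with
  | zero =>
    intro μ _ g K B hg _ _
    rw [lintegral_pi_fin_succ μ (by
      simp only [Finset.univ_eq_empty, Finset.prod_empty, mul_one]
      exact hg.comp (measurable_pi_apply (0 : Fin 1)))]
    simp
  | succ M ih =>
    intro μ _ g K B hg hK hB
    have hm : Measurable fun X : Fin (M + 1 + 1) → E =>
        g (X 0) * ∏ m, K m (X m.castSucc) (X m.succ) := by
      refine (hg.comp (measurable_pi_apply _)).mul (Finset.measurable_fun_prod _ fun m _ => ?_)
      exact (hK m).comp (f := fun X : Fin (M + 1 + 1) → E => (X m.castSucc, X m.succ))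
        ((measurable_pi_apply _).prodMk (measurable_pi_apply _))
    rw [lintegral_pi_fin_succ μ hm]
    simp only [Fin.prod_univ_succ, Fin.cons_zero, Fin.castSucc_zero, Fin.cons_succ,
      ← Fin.succ_castSucc]
    have hK0 : ∀ x, Measurable (K 0 x) := fun x => (hK 0).comp measurable_prodMk_left
    have hm' : ∀ x, Measurable fun Y : Fin (M + 1) → E =>
        K 0 x (Y 0) * ∏ m : Fin M, K m.succ (Y m.castSucc) (Y m.succ) := by
      intro x
      refine ((hK0 x).comp (measurable_pi_apply _)).mul (Finset.measurable_fun_prod _ fun m _ => ?_)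
      exact (hK m.succ).comp (f := fun X : Fin (M + 1) → E => (X m.castSucc, X m.succ))
        ((measurable_pi_apply _).prodMk (measurable_pi_apply _))
    have hstep : ∀ x, ∫⁻ Y : Fin (M + 1) → E, g x * (K 0 x (Y 0) *
        ∏ m : Fin M, K m.succ (Y m.castSucc) (Y m.succ))
          ∂(Measure.pi fun j : Fin (M + 1) => μ j.succ) ≤ g x * B ^ (M + 1) := by
      intro x
      rw [lintegral_const_mul _ (hm' x)]
      refine mul_le_mul_right ?_ _
      refine (ih (fun j => μ j.succ) (K 0 x) (fun m => K m.succ) B (hK0 x) (fun m => hK m.succ)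
        fun m y => hB m.succ y).trans ?_
      rw [pow_succ']
      exact mul_le_mul_left (hB 0 x) _
    refine (lintegral_mono hstep).trans ?_
    rw [lintegral_mul_const _ hg]

variable {κ : Type*} [Fintype κ] [DecidableEq κ]

theorem measurable_det_of {A : Type*} [MeasurableSpace A] {f : A → κ → κ → ℝ}
    (hf : ∀ i j, Measurable fun a => f a i j) :
    Measurable fun a => (Matrix.of (f a)).det := by
  simp only [det_eq_sum_prod_row, Matrix.of_apply]
  exact Finset.measurable_fun_sum _ fun σ _ =>
    (Finset.measurable_fun_prod _ fun i _ => hf i (σ i)).const_mul _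

/-- Leibniz expansion. The bound does not involve the starting points, so it serves as the uniform
constant `B` of `lintegral_chain_le`. -/
theorem lintegral_enorm_det_le (ν : Measure E) [SigmaFinite ν] {f : κ → E → ℝ} {b : ℝ}
    (hf : ∀ i, Integrable (f i) ν) (hb : ∀ i, ∫ y, |f i y| ∂ν ≤ b) :
    ∫⁻ y : κ → E, ‖(Matrix.of fun i j => f i (y j)).det‖ₑ ∂(Measure.pi fun _ => ν) ≤
      ENNReal.ofReal ((Fintype.card κ)! * b ^ Fintype.card κ) := by
  have hdet : ∀ y : κ → E, (Matrix.of fun i j => f i (y j)).det =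
      ∑ σ : Equiv.Perm κ, ((Equiv.Perm.sign σ : ℤ) : ℝ) * ∏ i, f (σ i) (y i) := fun y =>
    Matrix.det_apply' _
  have hint : ∀ σ : Equiv.Perm κ, Integrable (fun y : κ → E => ∏ i, f (σ i) (y i))
      (Measure.pi fun _ => ν) := fun σ =>
    Integrable.fintype_prod (f := fun i z => f (σ i) z) fun i => hf (σ i)
  have hd : Integrable (fun y : κ → E => (Matrix.of fun i j => f i (y j)).det)
      (Measure.pi fun _ => ν) := by
    simp only [hdet]
    exact integrable_finsetSum _ fun σ _ => (hint σ).const_mul _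
  rw [← ofReal_integral_norm_eq_lintegral_enorm hd]
  refine ENNReal.ofReal_le_ofReal ?_
  have hle : ∀ y : κ → E, ‖(Matrix.of fun i j => f i (y j)).det‖ ≤
      ∑ σ : Equiv.Perm κ, ∏ i, |f (σ i) (y i)| := by
    intro y
    rw [hdet]
    refine (norm_sum_le _ _).trans (Finset.sum_le_sum fun σ _ => ?_)
    rw [norm_mul, norm_prod]
    have : ‖((Equiv.Perm.sign σ : ℤ) : ℝ)‖ = 1 := by
      rcases Int.units_eq_one_or (Equiv.Perm.sign σ) with h | h <;> simp [h]
    rw [this, one_mul]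
    rfl
  have hint' : ∀ σ : Equiv.Perm κ, Integrable (fun y : κ → E => ∏ i, |f (σ i) (y i)|)
      (Measure.pi fun _ => ν) := fun σ =>
    Integrable.fintype_prod (f := fun i z => |f (σ i) z|) fun i => (hf (σ i)).abs
  refine (integral_mono hd.norm (integrable_finsetSum _ fun σ _ => hint' σ) hle).trans ?_
  rw [integral_finsetSum _ fun σ _ => hint' σ]
  refine (Finset.sum_le_card_nsmul _ _ (b ^ Fintype.card κ) fun σ _ => ?_).trans ?_
  · rw [integral_fintype_prod_eq_prod (fun i z => |f (σ i) z|)]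
    refine (Finset.prod_le_prod (fun i _ => integral_nonneg fun z => abs_nonneg _)
      fun i _ => hb (σ i)).trans ?_
    simp
  · rw [Finset.card_univ, Fintype.card_perm, nsmul_eq_mul]

/-- The product of the determinants along a path. -/
noncomputable def detChain {M : ℕ} (q : κ → E → ℝ) (k : Fin M → E → E → ℝ) (h : (κ → E) → ℝ)
    (X : Fin (M + 1) → κ → E) : ℝ :=
  (Matrix.of fun i j => q j (X 0 i)).det *
    (∏ m : Fin M, (Matrix.of fun i j => k m (X m.castSucc i) (X m.succ j)).det) *
    h (X (Fin.last M))

theorem measurable_detChain {M : ℕ} {q : κ → E → ℝ} {k : Fin M → E → E → ℝ} {h : (κ → E) → ℝ}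
    (hq : ∀ j, Measurable (q j)) (hk : ∀ m, Measurable fun p : E × E => k m p.1 p.2)
    (hh : Measurable h) : Measurable (detChain q k h) := by
  unfold detChain
  refine (Measurable.mul ?_ (Finset.measurable_fun_prod _ fun m _ => ?_)).mul
    (hh.comp (measurable_pi_apply _))
  · exact measurable_det_of fun i j =>
      (hq j).comp ((measurable_pi_apply i).comp (measurable_pi_apply 0))
  · exact measurable_det_of fun i j =>
      (hk m).comp (f := fun X : Fin (M + 1) → κ → E => (X m.castSucc i, X m.succ j))
        (((measurable_pi_apply i).comp (measurable_pi_apply _)).prodMk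
          ((measurable_pi_apply j).comp (measurable_pi_apply _)))

theorem integrable_detChain {M : ℕ} (ν : Fin (M + 1) → Measure E) [∀ m, SigmaFinite (ν m)]
    {q : κ → E → ℝ} {k : Fin M → E → E → ℝ} {h : (κ → E) → ℝ} {b c : ℝ}
    (hqm : ∀ j, Measurable (q j)) (hq : ∀ j, Integrable (q j) (ν 0))
    (hk : ∀ m, Measurable fun p : E × E => k m p.1 p.2)
    (hki : ∀ m x, Integrable (k m x) (ν m.succ)) (hkb : ∀ m x, ∫ y, |k m x y| ∂ν m.succ ≤ b)
    (hh : Measurable h) (hc : ∀ y, |h y| ≤ c) :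
    Integrable (detChain q k h) (Measure.pi fun m => Measure.pi fun _ => ν m) := by
  refine ⟨(measurable_detChain hqm hk hh).aestronglyMeasurable, ?_⟩
  have hd0 : Measurable fun y : κ → E => (Matrix.of fun i j => q j (y i)).det :=
    measurable_det_of fun i j => (hqm j).comp (measurable_pi_apply i)
  have hdk : ∀ m, Measurable fun p : (κ → E) × (κ → E) =>
      (Matrix.of fun i j => k m (p.1 i) (p.2 j)).det := fun m =>
    measurable_det_of fun i j => (hk m).comp (f := fun p : (κ → E) × (κ → E) => (p.1 i, p.2 j))
      (((measurable_pi_apply i).comp measurable_fst).prodMk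
        ((measurable_pi_apply j).comp measurable_snd))
  have hle : ∀ X : Fin (M + 1) → κ → E, ‖detChain q k h X‖ₑ ≤
      (‖(Matrix.of fun i j => q j (X 0 i)).det‖ₑ * ENNReal.ofReal c) *
        ∏ m : Fin M, ‖(Matrix.of fun i j => k m (X m.castSucc i) (X m.succ j)).det‖ₑ := by
    intro X
    have h1 : ‖h (X (Fin.last M))‖ₑ ≤ ENNReal.ofReal c := by
      rw [Real.enorm_eq_ofReal_abs]
      exact ENNReal.ofReal_le_ofReal (hc _)
    have h2 : ‖∏ m : Fin M, (Matrix.of fun i j => k m (X m.castSucc i) (X m.succ j)).det‖ₑ =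
        ∏ m : Fin M, ‖(Matrix.of fun i j => k m (X m.castSucc i) (X m.succ j)).det‖ₑ := by
      simp only [enorm, nnnorm_prod, ENNReal.ofNNReal_finsetProd]
    unfold detChain
    rw [enorm_mul, enorm_mul, h2, mul_right_comm]
    exact mul_le_mul_left (mul_le_mul_right h1 _) _
  refine lt_of_le_of_lt (lintegral_mono hle) ?_
  refine lt_of_le_of_lt (lintegral_chain_le M (fun m => Measure.pi fun _ : κ => ν m)
    (fun y => ‖(Matrix.of fun i j => q j (y i)).det‖ₑ * ENNReal.ofReal c)
    (fun m x y => ‖(Matrix.of fun i j => k m (x i) (y j)).det‖ₑ)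
    (ENNReal.ofReal ((Fintype.card κ)! * b ^ Fintype.card κ)) (hd0.enorm.mul_const _)
    (fun m => (hdk m).enorm) fun m x => ?_) ?_
  · exact lintegral_enorm_det_le (ν m.succ) (fun i => hki m (x i)) fun i => hkb m (x i)
  · refine ENNReal.mul_lt_top ?_ (ENNReal.pow_lt_top ENNReal.ofReal_lt_top)
    rw [lintegral_mul_const _ hd0.enorm]
    exact ENNReal.mul_lt_top (integrable_det (ν 0) (f := fun _ j => q j) fun i j => hq j).2
      ENNReal.ofReal_lt_top

/-- Andréief's identity integrates out the first time and replaces its functions by their transforms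
at the next time, with one factorial per step. The transforms `q m` are given data subject to a
recursion, so that explicit formulas can be inserted. -/
theorem integral_detChain {b c d : ℝ} {h : (κ → E) → ℝ} (hh : Measurable h) (hc : ∀ y, |h y| ≤ c) :
    ∀ {M : ℕ} (ν : Fin (M + 1) → Measure E) [∀ m, SigmaFinite (ν m)]
    (q : Fin (M + 1) → κ → E → ℝ) (k : Fin M → E → E → ℝ),
    (∀ m j, Measurable (q m j)) → (∀ m j, Integrable (q m j) (ν m)) →
    (∀ m, Measurable fun p : E × E => k m p.1 p.2) →
    (∀ m x, Integrable (k m x) (ν m.succ)) → (∀ m x, ∫ y, |k m x y| ∂ν m.succ ≤ b) →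
    (∀ m x y, |k m x y| ≤ d) →
    (∀ (m : Fin M) j y, q m.succ j y = ∫ x, k m x y * q m.castSucc j x ∂ν m.castSucc) →
    ∫ X, detChain (q 0) k h X ∂(Measure.pi fun m => Measure.pi fun _ => ν m) =
      ((Fintype.card κ)! : ℝ) ^ M * ∫ y, (Matrix.of fun i j => q (Fin.last M) j (y i)).det * h y
        ∂(Measure.pi fun _ => ν (Fin.last M)) := by
  intro M
  induction M with
  | zero =>
    intro ν _ q k hqm hq hk hki hkb hkd hrec
    rw [integral_pi_fin_succ (fun m => Measure.pi fun _ : κ => ν m)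
      (integrable_detChain ν (hqm 0) (hq 0) hk hki hkb hh hc)]
    -- When only one time is left, the remaining product measure has no factors and total mass 1.
    have h1 : (Measure.pi fun j : Fin 0 => Measure.pi fun _ : κ => ν j.succ).real Set.univ = 1 := by
      rw [Measure.real, Measure.pi_of_empty _ (fun j => j.elim0)]
      simp
    simp [detChain, h1]
  | succ M ih =>
    intro ν _ q k hqm hq hk hki hkb hkd hrec
    rw [integral_pi_fin_succ (fun m => Measure.pi fun _ : κ => ν m)
      (integrable_detChain ν (hqm 0) (hq 0) hk hki hkb hh hc)]
    have hstep : ∀ Y : Fin (M + 1) → κ → E,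
        ∫ x, detChain (q 0) k h (Fin.cons x Y) ∂(Measure.pi fun _ => ν 0) =
          ((Fintype.card κ)! : ℝ) *
            detChain (q (Fin.succ 0)) (fun m : Fin M => k m.succ) h Y := by
      intro Y
      have hi : ∀ i j, Integrable (fun z => k 0 z (Y 0 i) * q 0 j z) (ν 0) := fun i j =>
        (hq 0 j).bdd_mul (c := d)
          ((hk 0).comp measurable_prodMk_right).aestronglyMeasurable
          (Filter.Eventually.of_forall fun z => hkd 0 z (Y 0 i))
      have h1 := integral_det_mul_det (ν 0) (q := q 0) (k := fun i z => k 0 z (Y 0 i)) hi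
      have h2 : (Matrix.of fun i j => q (Fin.succ 0) j (Y 0 i)).det =
          (Matrix.of fun i j => ∫ z, k 0 z (Y 0 i) * q 0 j z ∂(ν 0)).det := by
        congr 1
        exact Matrix.ext fun i j => hrec 0 j (Y 0 i)
      unfold detChain
      simp only [Fin.prod_univ_succ, Fin.cons_zero, Fin.castSucc_zero, Fin.cons_succ,
        ← Fin.succ_castSucc, ← Fin.succ_last]
      rw [h2, ← mul_assoc, ← mul_assoc, ← h1, ← integral_mul_const, ← integral_mul_const]
      refine integral_congr_ae (Filter.Eventually.of_forall fun y => ?_)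
      simp only
      ring
    simp only [hstep]
    rw [integral_const_mul, ih (fun m => ν m.succ) (fun m => q m.succ) (fun m => k m.succ)
      (fun m j => hqm _ j) (fun m j => hq _ j) (fun m => hk _) (fun m => hki _) (fun m => hkb _)
      (fun m => hkd _) (fun m j y => by rw [Fin.succ_castSucc]; exact hrec m.succ j y),
      Fin.succ_last, pow_succ']
    ring

end Chain

/-! ### Product measures of mixtures -/

section Mixture

open scoped NNReal

theorem sigmaFinite_finset_sum {E C : Type*} [MeasurableSpace E] [Fintype C] (w : C → ℝ≥0)
    (κ : C → Measure E) [∀ c, SigmaFinite (κ c)] : SigmaFinite (∑ c, w c • κ c) := by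
  rw [← Measure.sum_fintype]
  infer_instance

theorem pi_sum_smul {ι : Type*} [Fintype ι] [DecidableEq ι] {E : ι → Type*}
    [∀ i, MeasurableSpace (E i)]
    {C : ι → Type*} [∀ i, Fintype (C i)] (w : ∀ i, C i → ℝ≥0) (κ : ∀ i, C i → Measure (E i))
    [∀ i c, SigmaFinite (κ i c)] :
    Measure.pi (fun i => ∑ c, w i c • κ i c) =
      ∑ f : ∀ i, C i, (∏ i, w i (f i)) • Measure.pi fun i => κ i (f i) := by
  have := fun i => sigmaFinite_finset_sum (w i) (κ i)
  refine Measure.pi_eq fun s hs => ?_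
  simp only [Measure.finsetSum_apply, Measure.smul_apply, Measure.pi_pi, ENNReal.smul_def,
    smul_eq_mul, ENNReal.ofNNReal_finsetProd, ← Finset.prod_mul_distrib]
  rw [Finset.prod_univ_sum]
  simp

/-- The measures whose mixture is considered: Lebesgue measure and point masses. -/
noncomputable def pointOrVolume {a : ℕ} (x : Fin a → ℝ) (o : Option (Fin a)) : Measure ℝ :=
  o.elim volume fun i => Measure.dirac (x i)

instance {a : ℕ} (x : Fin a → ℝ) (o : Option (Fin a)) : SigmaFinite (pointOrVolume x o) := by
  cases o <;> simp only [pointOrVolume, Option.elim] <;> infer_instance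

/-- A choice that uses every point once describes particles of which `a` sit at the prescribed
points while the other `b` are distributed by Lebesgue measure; `e` sorts them into these two
groups. -/
theorem pi_pointOrVolume {a b N : ℕ} (x : Fin a → ℝ) (e : Fin (a + b) ≃ Fin N)
    (c : Fin N → Option (Fin a)) (h1 : ∀ i, c (e (Fin.castAdd b i)) = some i)
    (h2 : ∀ j, c (e (Fin.natAdd a j)) = none) :
    Measure.pi (fun i => pointOrVolume x (c i)) =
      (volume : Measure (Fin b → ℝ)).map fun y => Fin.append x y ∘ e.symm := by
  have hm : Measurable fun y : Fin b → ℝ => Fin.append x y ∘ e.symm := by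
    refine measurable_pi_lambda _ fun i => ?_
    obtain ⟨j, rfl⟩ := e.surjective i
    simp only [Function.comp_apply, Equiv.symm_apply_apply]
    refine Fin.addCases (fun i => ?_) (fun i => ?_) j
    · simp
    · simp only [Fin.append_right]
      exact measurable_pi_apply i
  refine Measure.pi_eq fun s hs => ?_
  rw [Measure.map_apply hm (MeasurableSet.univ_pi hs), ← e.prod_comp, Fin.prod_univ_add]
  simp only [h1, h2]
  have hset : (fun y : Fin b → ℝ => Fin.append x y ∘ e.symm) ⁻¹' Set.univ.pi s =
      {_y | ∀ i, x i ∈ s (e (Fin.castAdd b i))} ∩ Set.univ.pi fun j => s (e (Fin.natAdd a j)) := by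
    ext y
    simp only [Set.mem_preimage, Set.mem_univ_pi, Set.mem_inter_iff, Set.mem_ofPred_eq,
      Function.comp_apply]
    rw [← e.forall_congr_right]
    simp only [Equiv.symm_apply_apply]
    constructor
    · intro h
      exact ⟨fun i => by simpa using h (Fin.castAdd b i), fun i => by simpa using h (Fin.natAdd a i)⟩
    · rintro ⟨h, h'⟩ i
      refine Fin.addCases (fun i => ?_) (fun i => ?_) i
      · simpa using h i
      · simpa using h' i
  rw [hset]
  simp only [pointOrVolume, Option.elim]
  by_cases hx : ∀ i, x i ∈ s (e (Fin.castAdd b i))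
  · have : ({_y | ∀ i, x i ∈ s (e (Fin.castAdd b i))} : Set (Fin b → ℝ)) = Set.univ := by
      ext y
      simpa using hx
    have hone : ∏ i, Measure.dirac (x i) (s (e (Fin.castAdd b i))) = 1 := by
      refine Finset.prod_eq_one fun i _ => ?_
      rw [Measure.dirac_apply' _ (hs _)]
      simp [hx i]
    rw [this, Set.univ_inter, volume_pi_pi, hone, one_mul]
  · have : ({_y | ∀ i, x i ∈ s (e (Fin.castAdd b i))} : Set (Fin b → ℝ)) = ∅ := by
      ext y
      simpa using hx
    push Not at hx
    obtain ⟨i, hi⟩ := hx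
    rw [this, Set.empty_inter, measure_empty, Finset.prod_eq_zero (Finset.mem_univ i), zero_mul]
    rw [Measure.dirac_apply' _ (hs _)]
    simp [hi]

/-- A choice of particles in which every point is chosen exactly once. -/
def IsExactChoice {a N : ℕ} (c : Fin N → Option (Fin a)) : Prop :=
  ∀ i, (Finset.univ.filter fun l => c l = some i).card = 1

instance {a N : ℕ} : DecidablePred (IsExactChoice (a := a) (N := N)) := fun c =>
  inferInstanceAs (Decidable (∀ i, (Finset.univ.filter fun l => c l = some i).card = 1))

theorem IsExactChoice.exists_embedding {a N : ℕ} {c : Fin N → Option (Fin a)}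
    (hc : IsExactChoice c) : ∃ f : Fin a ↪ Fin N, ∀ i l, c l = some i ↔ f i = l := by
  have h : ∀ i, ∃ l, ∀ l', c l' = some i ↔ l = l' := by
    intro i
    obtain ⟨l, hl⟩ := Finset.card_eq_one.1 (hc i)
    refine ⟨l, fun l' => ?_⟩
    have := Finset.ext_iff.1 hl l'
    simpa [eq_comm] using this
  choose f hf using h
  refine ⟨⟨f, fun i j hij => ?_⟩, hf⟩
  have h1 := (hf i (f i)).2 rfl
  have h2 := (hf j (f i)).2 hij.symm
  exact Option.some_injective _ (h1.symm.trans h2)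

theorem IsExactChoice.exists_equiv {a N : ℕ} {c : Fin N → Option (Fin a)}
    (hc : IsExactChoice c) : ∃ e : Fin (a + (N - a)) ≃ Fin N,
      (∀ i, c (e (Fin.castAdd (N - a) i)) = some i) ∧ ∀ j, c (e (Fin.natAdd a j)) = none := by
  classical
  obtain ⟨f, hf⟩ := hc.exists_embedding
  have hb : Function.Bijective (Sum.elim f (Subtype.val : {l // c l = none} → Fin N)) := by
    constructor
    · rintro (i | l) (j | l') h
      · exact congrArg _ (f.injective h)
      · have := (hf i l').2 h
        rw [l'.2] at this
        cases this
      · have := (hf j l).2 h.symm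
        rw [l.2] at this
        cases this
      · exact congrArg _ (Subtype.ext h)
    · intro l
      cases h : c l with
      | none => exact ⟨Sum.inr ⟨l, h⟩, rfl⟩
      | some i => exact ⟨Sum.inl i, (hf i l).1 h⟩
  have hcard : Fintype.card {l // c l = none} = N - a := by
    have := Fintype.card_congr (Equiv.ofBijective _ hb)
    rw [Fintype.card_sum, Fintype.card_fin, Fintype.card_fin] at this
    omega
  let g := (Fintype.equivFinOfCardEq hcard).symm
  refine ⟨finSumFinEquiv.symm.trans (((Equiv.refl _).sumCongr g).trans (Equiv.ofBijective _ hb)),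
    fun i => ?_, fun j => ?_⟩
  · simpa using (hf i (f i)).2 rfl
  · simpa using (g j).2

/-- Exact choices are the partial inverses of the embeddings of the points into the particles. -/
theorem card_exactChoice (a N : ℕ) :
    (Finset.univ.filter (IsExactChoice (a := a) (N := N))).card = N.descFactorial a := by
  classical
  have := Fintype.card_embedding_eq (α := Fin a) (β := Fin N)
  rw [Fintype.card_fin, Fintype.card_fin] at this
  rw [← this, ← Finset.card_univ, eq_comm]
  have key : ∀ (f : Fin a ↪ Fin N) i l, Function.partialInv f l = some i ↔ f i = l := fun f i l =>
    Function.Injective.isPartialInv f.injective i l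
  refine Finset.card_bij (fun f _ => Function.partialInv f) (fun f _ => ?_) (fun f _ g _ h => ?_)
    fun c hc => ?_
  · refine Finset.mem_filter.2 ⟨Finset.mem_univ _, fun i => ?_⟩
    simp only [key]
    rw [Finset.filter_eq]
    simp
  · ext i
    have h1 := (key f i (f i)).2 rfl
    rw [h] at h1
    exact congrArg _ ((key g i (f i)).1 h1).symm
  · obtain ⟨f, hf⟩ := (Finset.mem_filter.1 hc).2.exists_embedding
    refine ⟨f, Finset.mem_univ _, funext fun l => Option.ext fun i => ?_⟩
    rw [hf]
    exact key f i l

variable {M N : ℕ} {n : Fin (M + 1) → ℕ} (x : (m : Fin (M + 1)) → Fin (n m) → ℝ)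

/-- The weight of a choice for one particle. -/
noncomputable def choiceWeight {R : Type*} [One R] (u : Fin (∑ m, n m) → R) (m : Fin (M + 1))
    (o : Option (Fin (n m))) : R :=
  o.elim 1 fun a => u (finSigmaFinEquiv ⟨m, a⟩)

/-- Lebesgue measure with point masses `u` added at the points `x`. -/
noncomputable def mixture (u : Fin (∑ m, n m) → ℝ≥0) (m : Fin (M + 1)) : Measure ℝ :=
  ∑ o, choiceWeight u m o • pointOrVolume (x m) o

/-- The product measure given by choices for all particles. -/
noncomputable def choiceMeasure (c : (m : Fin (M + 1)) → Fin N → Option (Fin (n m))) :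
    Measure (Fin (M + 1) → Fin N → ℝ) :=
  Measure.pi fun m => Measure.pi fun i => pointOrVolume (x m) (c m i)

theorem pi_pi_mixture (u : Fin (∑ m, n m) → ℝ≥0) :
    (Measure.pi fun m => Measure.pi fun _ : Fin N => mixture x u m) =
      ∑ c : (m : Fin (M + 1)) → Fin N → Option (Fin (n m)),
        (∏ m, ∏ i, choiceWeight u m (c m i)) • choiceMeasure x c := by
  unfold choiceMeasure mixture
  simp only [pi_sum_smul (ι := Fin N)]
  exact pi_sum_smul (fun m (c : Fin N → Option (Fin (n m))) => ∏ i, choiceWeight u m (c i))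
    fun m c => Measure.pi fun i => pointOrVolume (x m) (c i)

/-- The integral against the product of the mixtures, as a polynomial in the point masses. -/
noncomputable def mixturePoly (D : (Fin (M + 1) → Fin N → ℝ) → ℝ) :
    MvPolynomial (Fin (∑ m, n m)) ℝ :=
  ∑ c : (m : Fin (M + 1)) → Fin N → Option (Fin (n m)),
    MvPolynomial.C (∫ X, D X ∂choiceMeasure x c) * ∏ m, ∏ i, choiceWeight MvPolynomial.X m (c m i)

variable {x} {D : (Fin (M + 1) → Fin N → ℝ) → ℝ}

/-- With all masses equal to 1 each choice measure is one of the summands of the product measure. -/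
theorem integrable_choiceMeasure
    (hD : Integrable D (Measure.pi fun m => Measure.pi fun _ : Fin N => mixture x (fun _ => 1) m))
    (c : (m : Fin (M + 1)) → Fin N → Option (Fin (n m))) : Integrable D (choiceMeasure x c) := by
  rw [pi_pi_mixture, integrable_finsetSum_measure] at hD
  have h1 : ∀ m (o : Option (Fin (n m))), choiceWeight (fun _ => (1 : ℝ≥0)) m o = 1 := by
    intro m o
    cases o <;> rfl
  simpa [h1] using hD c (Finset.mem_univ c)

theorem eval_mixturePoly
    (hD : Integrable D (Measure.pi fun m => Measure.pi fun _ : Fin N => mixture x (fun _ => 1) m))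
    (u : Fin (∑ m, n m) → ℝ≥0) :
    MvPolynomial.eval (fun a => (u a : ℝ)) (mixturePoly x D) =
      ∫ X, D X ∂(Measure.pi fun m => Measure.pi fun _ : Fin N => mixture x u m) := by
  have h1 : ∀ m (o : Option (Fin (n m))), MvPolynomial.eval (fun a => (u a : ℝ))
      (choiceWeight MvPolynomial.X m o) = (choiceWeight u m o : ℝ≥0) := by
    intro m o
    cases o <;> simp [choiceWeight]
  rw [pi_pi_mixture, integral_finsetSum_measure fun c _ =>
    (integrable_choiceMeasure hD c).smul_measure_nnreal]
  simp only [integral_smul_nnreal_measure]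
  rw [mixturePoly, map_sum]
  refine Finset.sum_congr rfl fun c _ => ?_
  simp only [map_mul, map_prod, h1, MvPolynomial.eval_C, NNReal.smul_def, smul_eq_mul,
    NNReal.coe_prod]
  ring

/-- The exponent of the variable of a point is the number of particles placed at that point. -/
theorem coeff_ones_prod_choiceWeight (c : (m : Fin (M + 1)) → Fin N → Option (Fin (n m))) :
    MvPolynomial.coeff (onesExp (Fin (∑ m, n m)))
      (∏ m, ∏ i, choiceWeight (MvPolynomial.X (R := ℝ)) m (c m i)) =
      if ∀ m, IsExactChoice (c m) then 1 else 0 := by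
  classical
  set s : ∀ m, Option (Fin (n m)) → (Fin (∑ m, n m) →₀ ℕ) := fun m o =>
    o.elim 0 fun a => Finsupp.single (finSigmaFinEquiv ⟨m, a⟩) 1 with hs
  have h1 : ∀ m (o : Option (Fin (n m))), choiceWeight (MvPolynomial.X (R := ℝ)) m o =
      MvPolynomial.monomial (s m o) 1 := by
    intro m o
    cases o <;> rfl
  have h2 : (∏ m, ∏ i, choiceWeight (MvPolynomial.X (R := ℝ)) m (c m i)) =
      MvPolynomial.monomial (∑ m, ∑ i, s m (c m i)) 1 := by
    simp only [h1]
    rw [MvPolynomial.monomial_sum_one]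
    simp only [MvPolynomial.monomial_sum_one]
  have h3 : ∀ m a, (∑ m, ∑ i, s m (c m i)) (finSigmaFinEquiv ⟨m, a⟩) =
      (Finset.univ.filter fun l => c m l = some a).card := by
    intro m a
    have h4 : ∀ m' (o : Option (Fin (n m'))), s m' o (finSigmaFinEquiv ⟨m, a⟩) =
        if (⟨m', o⟩ : Σ m, Option (Fin (n m))) = ⟨m, some a⟩ then 1 else 0 := by
      intro m' o
      cases o with
      | none =>
        rw [if_neg]
        · rfl
        · rintro h
          cases h
      | some b =>
        simp only [hs, Option.elim, Finsupp.single_apply, EmbeddingLike.apply_eq_iff_eq]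
        refine if_congr ⟨fun h => ?_, fun h => ?_⟩ rfl rfl
        · cases h
          rfl
        · cases h
          rfl
    rw [Finset.card_filter]
    simp only [Finsupp.coe_finsetSum, Finset.sum_apply, h4]
    rw [Finset.sum_eq_single m]
    · refine Finset.sum_congr rfl fun i _ => if_congr ⟨fun h => ?_, fun h => ?_⟩ rfl rfl
      · simpa using h
      · rw [h]
    · intro m' _ hm'
      refine Finset.sum_eq_zero fun i _ => if_neg fun h => hm' ?_
      exact congrArg Sigma.fst h
    · simp
  rw [h2, MvPolynomial.coeff_monomial]
  refine if_congr ⟨fun h m a => ?_, fun h => ?_⟩ rfl rfl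
  · rw [← h3, h]
    rfl
  · ext b
    obtain ⟨⟨m, a⟩, rfl⟩ := finSigmaFinEquiv.surjective b
    rw [h3, h m a]
    rfl

variable {G : (Fin (M + 1) → Finset ℝ) → ℝ}

theorem choiceMeasure_of_exact {c : (m : Fin (M + 1)) → Fin N → Option (Fin (n m))}
    (hc : ∀ m, IsExactChoice (c m))
    (hD : Integrable (fun X => G fun m => config (X m)) (choiceMeasure x c)) :
    Integrable (fun y : (m : Fin (M + 1)) → Fin (N - n m) → ℝ =>
        G fun m => config (Fin.append (x m) (y m))) ∧
      ∫ X, G (fun m => config (X m)) ∂choiceMeasure x c =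
        ∫ y : (m : Fin (M + 1)) → Fin (N - n m) → ℝ,
          G fun m => config (Fin.append (x m) (y m)) := by
  choose e he1 he2 using fun m => (hc m).exists_equiv
  have h1 := fun m => pi_pointOrVolume (x m) (e m) (c m) (he1 m) (he2 m)
  have hmeas : ∀ m, Measurable fun y : Fin (N - n m) → ℝ =>
      Fin.append (x m) y ∘ (e m).symm := by
    intro m
    refine measurable_pi_lambda _ fun i => ?_
    obtain ⟨j, rfl⟩ := (e m).surjective i
    simp only [Function.comp_apply, Equiv.symm_apply_apply]
    refine Fin.addCases (fun i => ?_) (fun i => ?_) j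
    · simp
    · simp only [Fin.append_right]
      exact measurable_pi_apply i
  have hsf : ∀ m, SigmaFinite ((volume : Measure (Fin (N - n m) → ℝ)).map fun y =>
      Fin.append (x m) y ∘ (e m).symm) := by
    intro m
    rw [← h1]
    infer_instance
  have h2 : choiceMeasure x c = (volume : Measure ((m : Fin (M + 1)) → Fin (N - n m) → ℝ)).map
      fun y m => Fin.append (x m) (y m) ∘ (e m).symm := by
    unfold choiceMeasure
    simp only [h1]
    exact (Measure.pi_map_pi fun m => (hmeas m).aemeasurable).symm
  have hm : Measurable fun (y : (m : Fin (M + 1)) → Fin (N - n m) → ℝ) (m : Fin (M + 1)) =>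
      Fin.append (x m) (y m) ∘ (e m).symm :=
    measurable_pi_lambda _ fun m => (hmeas m).comp (measurable_pi_apply m)
  rw [h2] at hD ⊢
  have h3 := hD.comp_measurable hm
  have h4 := integral_map hm.aemeasurable hD.aestronglyMeasurable
  have h5 : ∀ (y : (m : Fin (M + 1)) → Fin (N - n m) → ℝ) (m : Fin (M + 1)),
      config (Fin.append (x m) (y m) ∘ (e m).symm) = config (Fin.append (x m) (y m)) :=
    fun y m => config_comp_equiv _ _
  simp only [h5] at h4
  exact ⟨h3.congr (Filter.Eventually.of_forall fun y => congrArg G (funext (h5 y))), h4⟩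

/-- All exact choices give the same integral, because the integrand depends only on the
configurations; the coefficient is that integral times the number of exact choices. -/
theorem coeff_ones_mixturePoly (hn : ∀ m, n m ≤ N)
    (hD : Integrable (fun X : Fin (M + 1) → Fin N → ℝ => G fun m => config (X m))
      (Measure.pi fun m => Measure.pi fun _ : Fin N => mixture x (fun _ => 1) m)) :
    Integrable (fun y : (m : Fin (M + 1)) → Fin (N - n m) → ℝ =>
        G fun m => config (Fin.append (x m) (y m))) ∧
      MvPolynomial.coeff (onesExp (Fin (∑ m, n m)))
        (mixturePoly x fun X : Fin (M + 1) → Fin N → ℝ => G fun m => config (X m)) =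
        (∏ m, (N.descFactorial (n m) : ℝ)) *
          ∫ y : (m : Fin (M + 1)) → Fin (N - n m) → ℝ,
            G fun m => config (Fin.append (x m) (y m)) := by
  classical
  have hcard : (Finset.univ.filter fun c : (m : Fin (M + 1)) → Fin N → Option (Fin (n m)) =>
      ∀ m, IsExactChoice (c m)).card = ∏ m, N.descFactorial (n m) := by
    have : (Finset.univ.filter fun c : (m : Fin (M + 1)) → Fin N → Option (Fin (n m)) =>
        ∀ m, IsExactChoice (c m)) = Fintype.piFinset fun m =>
          Finset.univ.filter (IsExactChoice (a := n m) (N := N)) := by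
      ext c
      simp
    rw [this, Fintype.card_piFinset]
    simp only [card_exactChoice]
  constructor
  -- Since `n m ≤ N` some exact choice exists, and integrability can be read off from it.
  · have hpos : 0 < ∏ m, N.descFactorial (n m) :=
      Finset.prod_pos fun m _ => Nat.descFactorial_pos.2 (hn m)
    rw [← hcard, Finset.card_pos] at hpos
    obtain ⟨c, hc⟩ := hpos
    exact (choiceMeasure_of_exact (Finset.mem_filter.1 hc).2 (integrable_choiceMeasure hD c)).1
  · rw [mixturePoly, MvPolynomial.coeff_sum]
    simp only [MvPolynomial.coeff_C_mul, coeff_ones_prod_choiceWeight, mul_ite, mul_one, mul_zero]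
    rw [← Finset.sum_filter, Finset.sum_congr rfl fun c hc =>
      (choiceMeasure_of_exact (Finset.mem_filter.1 hc).2 (integrable_choiceMeasure hD c)).2,
      Finset.sum_const, hcard, nsmul_eq_mul, Nat.cast_prod]

end Mixture

/-! ### The skew products with respect to Lebesgue measure with point masses -/

section PointMasses

open scoped NNReal

variable {M : ℕ} {t : Fin (M + 2) → ℝ} {α : Type*} [Fintype α] [DecidableEq α]
  (τ : α → Fin (M + 1)) (p : α → ℝ) (u : α → ℝ≥0)

/-- Lebesgue measure with the masses `u a` at the points `p a` of time `m`. -/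
noncomputable def pointMeasure (m : Fin (M + 1)) : Measure ℝ :=
  volume + ∑ a, (if τ a = m then u a else 0) • Measure.dirac (p a)

instance (m : Fin (M + 1)) : SigmaFinite (pointMeasure τ p u m) := by
  unfold pointMeasure
  have := sigmaFinite_finset_sum (fun a => if τ a = m then u a else 0)
    fun a => Measure.dirac (p a)
  infer_instance

variable {τ p u}

omit [DecidableEq α] in
theorem integrable_pointMeasure {f : ℝ → ℝ} (hf : Integrable f) (m : Fin (M + 1)) :
    Integrable f (pointMeasure τ p u m) := by
  refine hf.add_measure (integrable_finsetSum_measure.2 fun a _ => ?_)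
  exact (integrable_dirac enorm_lt_top).smul_measure_nnreal

omit [DecidableEq α] in
theorem integral_pointMeasure {f : ℝ → ℝ} (hf : Integrable f) (m : Fin (M + 1)) :
    ∫ y, f y ∂pointMeasure τ p u m =
      (∫ y, f y) + ∑ a, if τ a = m then (u a : ℝ) * f (p a) else 0 := by
  have h : ∀ a ∈ Finset.univ, Integrable f
      ((if τ a = m then u a else 0) • Measure.dirac (p a)) := fun a _ =>
    (integrable_dirac enorm_lt_top).smul_measure_nnreal
  rw [pointMeasure, integral_add_measure hf (integrable_finsetSum_measure.2 h),
    integral_finsetSum_measure h]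
  congr 1
  refine Finset.sum_congr rfl fun a _ => ?_
  rw [integral_smul_nnreal_measure, integral_dirac]
  split_ifs
  · rfl
  · simp

variable (t τ p) in
/-- The heat kernels from earlier to later points. -/
noncomputable def heatMatrix : Matrix α α ℝ :=
  Matrix.of fun a b =>
    if τ a < τ b then heat (t (τ b).succ - t (τ a).succ) (p a) (p b) else 0

variable (t τ p) in
/-- The values of the functions `R_j` at the points. -/
noncomputable def transRMatrix (N : ℕ) : Matrix (Fin N) α ℝ :=
  Matrix.of fun j a => transR t (τ a) j (p a)

variable (t τ p) in
/-- The values of the functions `Φ_j` at the points. -/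
noncomputable def transPhiMatrix (N : ℕ) : Matrix (Fin N) α ℝ :=
  Matrix.of fun j a => transPhi t (τ a) j (p a)

variable (t τ p) in
/-- The values of the kernels `F` at the points. -/
noncomputable def kernelFMatrix : Matrix α α ℝ :=
  Matrix.of fun a b => kernelF t (τ a) (τ b) (p a) (p b)

variable (t τ p u) in
/-- The functions `R_j` transported with the point masses taken into account, where `v j a` is the
value at the point `p a`. -/
noncomputable def massFn {N : ℕ} (v : Matrix (Fin N) α ℝ) (m : Fin (M + 1)) (j : Fin N) (y : ℝ) : ℝ :=
  transR t m j y + ∑ a, if τ a < m then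
    (u a : ℝ) * v j a * heat (t m.succ - t (τ a).succ) (p a) y else 0

theorem time_sub_pos (ht : StrictMono t) {m m' : Fin (M + 1)} (h : m < m') :
    0 < t m'.succ - t m.succ :=
  sub_pos.2 (ht (Fin.succ_lt_succ_iff.2 h))

theorem time_sub_one_nonneg (ht : StrictMono t) (m : Fin (M + 1)) : 0 ≤ t m.succ - t 1 :=
  sub_nonneg.2 (ht.monotone (by
    rw [← Fin.succ_zero_eq_one]
    exact Fin.succ_le_succ_iff.2 (Fin.zero_le m)))

theorem finalTime_sub_nonneg (ht : StrictMono t) (m : Fin (M + 1)) :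
    0 ≤ finalTime t - t m.succ :=
  sub_nonneg.2 (ht.monotone (Fin.le_last _))

theorem integrable_transR (ht₀ : t 0 = 0) (ht : StrictMono t) (m : Fin (M + 1)) (k : ℕ) :
    Integrable (transR t m k) :=
  integrable_heatOp (time_sub_one_nonneg ht m) (integrable_initialFn ht₀ ht k)

theorem measurable_transR (ht : StrictMono t) (m : Fin (M + 1)) (k : ℕ) :
    Measurable (transR t m k) :=
  measurable_heatOp (time_sub_one_nonneg ht m) (measurable_initialFn t k)

theorem transR_last (t : Fin (M + 2) → ℝ) (k : ℕ) : transR t (Fin.last M) k = finalFn t k := by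
  rw [transR_eq_heatOp, Fin.succ_last]
  rfl

omit [DecidableEq α] in
theorem integrable_massFn (ht₀ : t 0 = 0) (ht : StrictMono t) {N : ℕ} (v : Matrix (Fin N) α ℝ)
    (m : Fin (M + 1)) (j : Fin N) : Integrable (massFn t τ p u v m j) := by
  refine (integrable_transR ht₀ ht m j).add (integrable_finsetSum _ fun a _ => ?_)
  split_ifs with h
  · exact (integrable_heat (time_sub_pos ht h) _).const_mul _
  · exact integrable_zero _ _ _

omit [DecidableEq α] in
theorem measurable_massFn (ht : StrictMono t) {N : ℕ} (v : Matrix (Fin N) α ℝ)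
    (m : Fin (M + 1)) (j : Fin N) : Measurable (massFn t τ p u v m j) := by
  refine (measurable_transR ht m j).add (Finset.measurable_fun_sum _ fun a _ => ?_)
  split_ifs with h
  · exact ((measurable_heat _).comp measurable_prodMk_left).const_mul _
  · exact measurable_const

/-- The equation v = R + v U P is the consistency condition that the coefficients `v j b` in
`massFn` are its own values at the points. -/
theorem massFn_apply {N : ℕ} {v : Matrix (Fin N) α ℝ}
    (hv : v * (1 - Matrix.diagonal (fun a => (u a : ℝ)) * heatMatrix t τ p) = transRMatrix t τ p N)
    (j : Fin N) (b : α) : massFn t τ p u v (τ b) j (p b) = v j b := by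
  have h := congrFun (congrFun hv j) b
  rw [Matrix.mul_sub, Matrix.mul_one, ← Matrix.mul_assoc, Matrix.sub_apply, Matrix.mul_apply (N := heatMatrix t τ p)] at h
  have h2 : transRMatrix t τ p N j b = transR t (τ b) j (p b) := rfl
  rw [h2] at h
  rw [massFn, ← h]
  have h3 : ∀ a, (v * Matrix.diagonal fun a => (u a : ℝ)) j a * heatMatrix t τ p a b =
      if τ a < τ b then
        (u a : ℝ) * v j a * heat (t (τ b).succ - t (τ a).succ) (p a) (p b) else 0 := by
    intro a
    rw [Matrix.mul_diagonal, heatMatrix, Matrix.of_apply]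
    split_ifs
    · ring
    · ring
  simp only [h3]
  ring

/-- This is the recursion required by `integral_detChain`. The Lebesgue part is transported by the
semigroup property, and each mass at time `m` starts a new heat kernel weighted by the value of the
function there. -/
theorem massFn_succ (ht₀ : t 0 = 0) (ht : StrictMono t) {N : ℕ} {v : Matrix (Fin N) α ℝ}
    (hv : v * (1 - Matrix.diagonal (fun a => (u a : ℝ)) * heatMatrix t τ p) = transRMatrix t τ p N)
    (m : Fin M) (j : Fin N) (y : ℝ) :
    massFn t τ p u v m.succ j y = ∫ x, heat (t m.succ.succ - t m.castSucc.succ) x y *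
      massFn t τ p u v m.castSucc j x ∂pointMeasure τ p u m.castSucc := by
  have hs : 0 < t m.succ.succ - t m.castSucc.succ := time_sub_pos ht Fin.castSucc_lt_succ
  have hi : Integrable fun x => heat (t m.succ.succ - t m.castSucc.succ) x y *
      massFn t τ p u v m.castSucc j x := by
    simp only [heat_symm _ _ y]
    exact integrable_heat_mul hs (integrable_massFn ht₀ ht v _ j) y
  have hsplit : ∫ x, heat (t m.succ.succ - t m.castSucc.succ) x y *
      massFn t τ p u v m.castSucc j x = transR t m.succ j y + ∑ a, if τ a < m.castSucc then
        (u a : ℝ) * v j a * heat (t m.succ.succ - t (τ a).succ) (p a) y else 0 := by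
    have h1 : ∀ x, heat (t m.succ.succ - t m.castSucc.succ) x y * massFn t τ p u v m.castSucc j x =
        heat (t m.succ.succ - t m.castSucc.succ) y x * transR t m.castSucc j x +
        ∑ a, if τ a < m.castSucc then (u a : ℝ) * v j a *
          (heat (t m.castSucc.succ - t (τ a).succ) (p a) x *
            heat (t m.succ.succ - t m.castSucc.succ) x y) else 0 := by
      intro x
      rw [massFn, mul_add, Finset.mul_sum, heat_symm _ y x]
      congr 1
      refine Finset.sum_congr rfl fun a _ => ?_
      split_ifs
      · ring
      · ring
    have h2 : ∀ a, Integrable fun x => if τ a < m.castSucc then (u a : ℝ) * v j a *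
          (heat (t m.castSucc.succ - t (τ a).succ) (p a) x *
            heat (t m.succ.succ - t m.castSucc.succ) x y) else 0 := by
      intro a
      split_ifs with h
      · have := integrable_heat_mul hs (integrable_heat (time_sub_pos ht h) (p a)) y
        simp only [heat_symm (t m.succ.succ - t m.castSucc.succ) y] at this
        simp only [mul_comm (heat (t m.castSucc.succ - t (τ a).succ) (p a) _)]
        exact this.const_mul _
      · exact integrable_zero _ _ _
    simp only [h1]
    rw [integral_add (integrable_heat_mul hs (integrable_transR ht₀ ht _ _) y)
      (integrable_finsetSum _ fun a _ => h2 a), integral_finsetSum _ fun a _ => h2 a]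
    congr 1
    · rw [← heatOp_of_pos hs, transR_eq_heatOp, transR_eq_heatOp,
        heatOp_heatOp hs.le (time_sub_one_nonneg ht _) (integrable_initialFn ht₀ ht _)]
      congr 1
      ring
    · refine Finset.sum_congr rfl fun a _ => ?_
      split_ifs with h
      · rw [integral_const_mul, integral_heat_mul_heat (time_sub_pos ht h) hs]
        congr 2
        ring
      · simp
  rw [integral_pointMeasure hi, hsplit, massFn, add_assoc, ← Finset.sum_add_distrib]
  congr 1
  refine Finset.sum_congr rfl fun a _ => ?_
  -- Earlier masses are already carried along, masses at the present time enter now, and later ones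
  -- do not contribute.
  rcases lt_trichotomy (τ a) m.castSucc with h | h | h
  · rw [if_pos (h.trans Fin.castSucc_lt_succ), if_pos h, if_neg h.ne, add_zero]
  · rw [if_pos (h ▸ Fin.castSucc_lt_succ), if_neg h.not_lt, if_pos h, zero_add, ← h,
      massFn_apply hv]
    ring
  · have h' : ¬ τ a < m.succ := by
      rw [not_lt, Fin.le_def, Fin.val_succ]
      exact h
    rw [if_neg h', if_neg h.not_gt, if_neg h.ne', add_zero]

/-- Masses at the final time join the earlier ones in a single sum, because `heatMeasure` at time 0
is the unit mass. -/
theorem integral_massFn_mul (ht₀ : t 0 = 0) (ht : StrictMono t) {N : ℕ} {v : Matrix (Fin N) α ℝ}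
    (hv : v * (1 - Matrix.diagonal (fun a => (u a : ℝ)) * heatMatrix t τ p) = transRMatrix t τ p N)
    (j : Fin N) {ψ : ℝ → ℝ} (hψ : Measurable ψ) {c : ℝ} (hc : ∀ x, |ψ x| ≤ c) :
    ∫ y, massFn t τ p u v (Fin.last M) j y * ψ y ∂pointMeasure τ p u (Fin.last M) =
      (∫ y, finalFn t j y * ψ y) +
        ∑ a, (u a : ℝ) * v j a * ∫ y, ψ y ∂heatMeasure (finalTime t - t (τ a).succ) (p a) := by
  have hT : t (Fin.last M).succ = finalTime t := by rw [Fin.succ_last]; rfl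
  have hb : ∀ {f : ℝ → ℝ}, Integrable f → Integrable fun y => f y * ψ y := by
    intro f hf
    have := hf.bdd_mul (c := c) hψ.aestronglyMeasurable (Filter.Eventually.of_forall hc)
    simpa only [mul_comm] using this
  rw [integral_pointMeasure (hb (integrable_massFn ht₀ ht v _ j))]
  have h1 : ∀ y, massFn t τ p u v (Fin.last M) j y * ψ y = finalFn t j y * ψ y +
      ∑ a, if τ a < Fin.last M then (u a : ℝ) * v j a *
        (heat (finalTime t - t (τ a).succ) (p a) y * ψ y) else 0 := by
    intro y
    rw [massFn, add_mul, Finset.sum_mul, transR_last, hT]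
    congr 1
    refine Finset.sum_congr rfl fun a _ => ?_
    split_ifs
    · ring
    · ring
  have hpos : ∀ {a}, τ a < Fin.last M → 0 < finalTime t - t (τ a).succ := by
    intro a h
    rw [← hT]
    exact time_sub_pos ht h
  have h2 : ∀ a, Integrable fun y => if τ a < Fin.last M then (u a : ℝ) * v j a *
        (heat (finalTime t - t (τ a).succ) (p a) y * ψ y) else 0 := by
    intro a
    split_ifs with h
    · exact (hb (integrable_heat (hpos h) (p a))).const_mul _
    · exact integrable_zero _ _ _
  have h3 : Integrable (finalFn t j) := by
    rw [← transR_last]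
    exact integrable_transR ht₀ ht _ _
  have h4 : ∫ y, massFn t τ p u v (Fin.last M) j y * ψ y = (∫ y, finalFn t j y * ψ y) +
      ∑ a, if τ a < Fin.last M then (u a : ℝ) * v j a *
        ∫ y, ψ y ∂heatMeasure (finalTime t - t (τ a).succ) (p a) else 0 := by
    simp only [h1]
    rw [integral_add (hb h3) (integrable_finsetSum _ fun a _ => h2 a),
      integral_finsetSum _ fun a _ => h2 a]
    congr 1
    refine Finset.sum_congr rfl fun a _ => ?_
    split_ifs with h
    · rw [integral_const_mul, integral_heatMeasure (hpos h)]
    · simp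
  rw [h4, add_assoc, ← Finset.sum_add_distrib]
  congr 1
  refine Finset.sum_congr rfl fun a _ => ?_
  rcases (Fin.le_last (τ a)).lt_or_eq with h | h
  · rw [if_pos h, if_neg h.ne, add_zero]
  · rw [if_neg h.not_lt, if_pos h, zero_add, ← h, massFn_apply hv, h, hT, sub_self,
      heatMeasure_zero, integral_dirac]
    ring

theorem kernelF_eq_integral (t : Fin (M + 2) → ℝ) (m m' : Fin (M + 1)) (x y : ℝ) :
    kernelF t m m' x y = ∫ z, ∫ w, signKernel z w ∂heatMeasure (finalTime t - t m'.succ) y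
      ∂heatMeasure (finalTime t - t m.succ) x :=
  (integral_signKernel_prod _ _).symm

/-- The symmetry of the heat semigroup moves the transport from the first argument of F to the
function, which thereby reaches the final time. -/
theorem transPhi_eq_integral (ht₀ : t 0 = 0) (ht : StrictMono t) (m : Fin (M + 1)) (k : ℕ) (x : ℝ) :
    transPhi t m k x =
      ∫ z, finalFn t k z * ∫ w, signKernel z w ∂heatMeasure (finalTime t - t m.succ) x := by
  have h1 : finalFn t k = heatOp (finalTime t - t m.succ) (transR t m k) := by
    funext z
    rw [transR_eq_heatOp, heatOp_heatOp (finalTime_sub_nonneg ht m) (time_sub_one_nonneg ht m)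
      (integrable_initialFn ht₀ ht k), finalFn]
    congr 1
    ring
  rw [h1, integral_heatOp_mul (finalTime_sub_nonneg ht m) (integrable_transR ht₀ ht m k)
    (measurable_integral_signKernel _) (abs_integral_signKernel_le _)]
  unfold transPhi
  simp only [kernelF_eq_integral]
  rfl

/-- The skew products of the transported functions. -/
theorem integral_massFn_mul_massFn (ht₀ : t 0 = 0) (ht : StrictMono t) {N : ℕ}
    {v : Matrix (Fin N) α ℝ}
    (hv : v * (1 - Matrix.diagonal (fun a => (u a : ℝ)) * heatMatrix t τ p) = transRMatrix t τ p N)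
    (i j : Fin N) :
    ∫ q : ℝ × ℝ, massFn t τ p u v (Fin.last M) i q.1 * massFn t τ p u v (Fin.last M) j q.2 *
      signKernel q.1 q.2
      ∂((pointMeasure τ p u (Fin.last M)).prod (pointMeasure τ p u (Fin.last M))) =
      skewForm (finalFn t i) (finalFn t j) +
        (∑ b, transPhiMatrix t τ p N i b * (u b : ℝ) * v j b) -
        (∑ a, v i a * (u a : ℝ) * transPhiMatrix t τ p N j a) +
        ∑ a, ∑ b, v i a * (u a : ℝ) * kernelFMatrix t τ p a b * (u b : ℝ) * v j b := by
  set ν := pointMeasure τ p u (Fin.last M) with hν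
  set γ : α → Measure ℝ := fun a => heatMeasure (finalTime t - t (τ a).succ) (p a) with hγ
  have hfi : ∀ k, Integrable (finalFn t k) := fun k => by
    rw [← transR_last]
    exact integrable_transR ht₀ ht _ _
  have hsm : ∀ x, Measurable (signKernel x) := fun x =>
    measurable_signKernel.comp measurable_prodMk_left
  have hprod : ∀ {f g : ℝ → ℝ} {μ μ' : Measure ℝ} [SigmaFinite μ] [SigmaFinite μ'],
      Integrable f μ → Integrable g μ' →
      Integrable (fun q : ℝ × ℝ => f q.1 * (g q.2 * signKernel q.1 q.2)) (μ.prod μ') := by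
    intro f g μ μ' _ _ hf hg
    have := (hf.mul_prod hg).bdd_mul (f := fun q : ℝ × ℝ => signKernel q.1 q.2) (c := 1)
      measurable_signKernel.aestronglyMeasurable
      (Filter.Eventually.of_forall fun q => abs_signKernel_le _ _)
    refine this.congr (Filter.Eventually.of_forall fun q => ?_)
    simp only
    ring
  have hmi : ∀ k : Fin N, Integrable (massFn t τ p u v (Fin.last M) k) ν := fun k =>
    integrable_pointMeasure (integrable_massFn ht₀ ht v _ k) _
  set g : ℝ → ℝ := fun x => ∫ y, finalFn t j y * signKernel x y with hg
  set h : α → ℝ → ℝ := fun b x => ∫ y, signKernel x y ∂γ b with hh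
  have hgm : Measurable g := by
    have hm : StronglyMeasurable fun q : ℝ × ℝ => finalFn t j q.2 * signKernel q.1 q.2 := by
      have : Measurable (finalFn t j) := by
        rw [← transR_last]
        exact measurable_transR ht _ _
      exact ((this.comp measurable_snd).mul measurable_signKernel).stronglyMeasurable
    exact hm.integral_prod_right'.measurable
  have hgb : ∀ x, |g x| ≤ ∫ y, |finalFn t j y| := by
    intro x
    refine (abs_integral_le_integral_abs).trans (integral_mono_of_nonneg
      (Filter.Eventually.of_forall fun _ => abs_nonneg _) (hfi j).abs
      (Filter.Eventually.of_forall fun y => ?_))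
    simp only
    rw [abs_mul]
    exact mul_le_of_le_one_right (abs_nonneg _) (abs_signKernel_le x y)
  have hhm : ∀ b, Measurable (h b) := fun b => measurable_integral_signKernel _
  have hhb : ∀ b x, |h b x| ≤ 1 := fun b x => abs_integral_signKernel_le _ _
  have hinner : ∀ x, ∫ y, massFn t τ p u v (Fin.last M) j y * signKernel x y ∂ν =
      g x + ∑ b, (u b : ℝ) * v j b * h b x := fun x =>
    integral_massFn_mul ht₀ ht hv j (hsm x) (abs_signKernel_le x)
  have hbm : Measurable fun x => g x + ∑ b, (u b : ℝ) * v j b * h b x :=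
    hgm.add (Finset.measurable_fun_sum _ fun b _ => (hhm b).const_mul _)
  have hbb : ∀ x, |g x + ∑ b, (u b : ℝ) * v j b * h b x| ≤
      (∫ y, |finalFn t j y|) + ∑ b, |(u b : ℝ) * v j b| := by
    intro x
    refine (abs_add_le _ _).trans (add_le_add (hgb x) ((Finset.abs_sum_le_sum_abs _ _).trans
      (Finset.sum_le_sum fun b _ => ?_)))
    rw [abs_mul]
    exact mul_le_of_le_one_right (abs_nonneg _) (hhb b x)
  have houter := integral_massFn_mul ht₀ ht hv i hbm hbb
  have hLHS : ∫ q : ℝ × ℝ, massFn t τ p u v (Fin.last M) i q.1 *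
      massFn t τ p u v (Fin.last M) j q.2 * signKernel q.1 q.2 ∂(ν.prod ν) =
      ∫ x, massFn t τ p u v (Fin.last M) i x * (g x + ∑ b, (u b : ℝ) * v j b * h b x) ∂ν := by
    simp only [mul_assoc (massFn t τ p u v (Fin.last M) i _)]
    rw [integral_prod _ (hprod (hmi i) (hmi j))]
    simp only [integral_const_mul, hinner]
  have hgi : ∀ a, Integrable g (γ a) := fun a =>
    (integrable_const (∫ y, |finalFn t j y|)).mono' hgm.aestronglyMeasurable
      (Filter.Eventually.of_forall hgb)
  have hhi' : ∀ a b, Integrable (h b) (γ a) := fun a b =>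
    (integrable_const (1 : ℝ)).mono' (hhm b).aestronglyMeasurable
      (Filter.Eventually.of_forall (hhb b))
  have hbd : ∀ {f ψ : ℝ → ℝ} {c : ℝ}, Integrable f → Measurable ψ → (∀ x, |ψ x| ≤ c) →
      Integrable fun y => f y * ψ y := by
    intro f ψ c hf hψ hc
    have := hf.bdd_mul (c := c) hψ.aestronglyMeasurable (Filter.Eventually.of_forall hc)
    simpa only [mul_comm] using this
  have hfirst : ∫ y, finalFn t i y * (g y + ∑ b, (u b : ℝ) * v j b * h b y) =
      skewForm (finalFn t i) (finalFn t j) +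
        ∑ b, transPhiMatrix t τ p N i b * (u b : ℝ) * v j b := by
    have h1 : ∀ y, finalFn t i y * (g y + ∑ b, (u b : ℝ) * v j b * h b y) =
        finalFn t i y * g y + ∑ b, (u b : ℝ) * v j b * (finalFn t i y * h b y) := by
      intro y
      rw [mul_add, Finset.mul_sum]
      congr 1
      exact Finset.sum_congr rfl fun b _ => by ring
    simp only [h1]
    have h2 : ∀ b, Integrable fun y => (u b : ℝ) * v j b * (finalFn t i y * h b y) := fun b =>
      (hbd (hfi i) (hhm b) (hhb b)).const_mul _
    rw [integral_add (hbd (hfi i) hgm hgb) (integrable_finsetSum _ fun b _ => h2 b),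
      integral_finsetSum _ fun b _ => h2 b]
    congr 1
    refine Finset.sum_congr rfl fun b _ => ?_
    rw [integral_const_mul, transPhiMatrix, Matrix.of_apply, transPhi_eq_integral ht₀ ht]
    ring
  have hsecond : ∀ a, ∫ y, (g y + ∑ b, (u b : ℝ) * v j b * h b y) ∂γ a =
      -transPhiMatrix t τ p N j a + ∑ b, (u b : ℝ) * v j b * kernelFMatrix t τ p a b := by
    intro a
    have h2 : ∀ b, Integrable (fun y => (u b : ℝ) * v j b * h b y) (γ a) := fun b =>
      (hhi' a b).const_mul _
    rw [integral_add (hgi a) (integrable_finsetSum _ fun b _ => h2 b),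
      integral_finsetSum _ fun b _ => h2 b]
    congr 1
    · rw [transPhiMatrix, Matrix.of_apply, transPhi_eq_integral ht₀ ht, ← integral_neg]
      have h3 := hprod (integrable_const (1 : ℝ) : Integrable (fun _ : ℝ => (1 : ℝ)) (γ a)) (hfi j)
      simp only [one_mul] at h3
      rw [hg, integral_integral_swap (f := fun x y => finalFn t j y * signKernel x y) h3]
      refine integral_congr_ae (Filter.Eventually.of_forall fun y => ?_)
      simp only
      rw [integral_const_mul, ← mul_neg, ← integral_neg]
      congr 1
      refine integral_congr_ae (Filter.Eventually.of_forall fun x => ?_)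
      simp only
      rw [signKernel_swap]
    · refine Finset.sum_congr rfl fun b _ => ?_
      rw [integral_const_mul, kernelFMatrix, Matrix.of_apply, kernelF_eq_integral]
  rw [hLHS, houter, hfirst]
  simp only [hγ] at hsecond
  simp only [hsecond, mul_add, Finset.sum_add_distrib, Finset.mul_sum]
  have e1 : ∑ a, (u a : ℝ) * v i a * -transPhiMatrix t τ p N j a =
      -∑ a, v i a * (u a : ℝ) * transPhiMatrix t τ p N j a := by
    rw [← Finset.sum_neg_distrib]
    exact Finset.sum_congr rfl fun a _ => by ring
  have e2 : ∑ a, ∑ b, (u a : ℝ) * v i a * ((u b : ℝ) * v j b * kernelFMatrix t τ p a b) =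
      ∑ a, ∑ b, v i a * (u a : ℝ) * kernelFMatrix t τ p a b * (u b : ℝ) * v j b :=
    Finset.sum_congr rfl fun a _ => Finset.sum_congr rfl fun b _ => by ring
  rw [e1, e2]
  ring

end PointMasses

/-! ### The quaternion kernel and the matrix of skew products -/

section SymplecticAlgebra

variable {κ ι α R : Type*} [Fintype κ] [DecidableEq κ] [Fintype ι] [DecidableEq ι] [CommRing R]

omit [DecidableEq κ] in
theorem symplDiag_mul_apply (e : ι × Fin 2 ≃ κ) (d : ι → R) (Y : Matrix κ α R) (k : ι) (b : α) :
    (symplDiag e d * Y) (e (k, 0)) b = d k * Y (e (k, 1)) b ∧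
      (symplDiag e d * Y) (e (k, 1)) b = -(d k * Y (e (k, 0)) b) := by
  constructor
  · rw [Matrix.mul_apply, ← e.sum_comp, Fintype.sum_prod_type, Finset.sum_eq_single k]
    · simp [symplDiag, symplTwo]
    · intro l _ hl
      simp [symplDiag, hl.symm]
    · simp
  · rw [Matrix.mul_apply, ← e.sum_comp, Fintype.sum_prod_type, Finset.sum_eq_single k]
    · simp [symplDiag, symplTwo]
    · intro l _ hl
      simp [symplDiag, hl.symm]
    · simp

omit [DecidableEq κ] in
theorem transpose_mul_symplDiag_mul_apply (e : ι × Fin 2 ≃ κ) (d : ι → R) (X Y : Matrix κ α R)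
    (a b : α) : (X.transpose * (symplDiag e d * Y)) a b =
      ∑ k, d k * (X (e (k, 0)) a * Y (e (k, 1)) b - X (e (k, 1)) a * Y (e (k, 0)) b) := by
  rw [Matrix.mul_apply, ← e.sum_comp, Fintype.sum_prod_type]
  refine Finset.sum_congr rfl fun k _ => ?_
  rw [Fin.sum_univ_two, (symplDiag_mul_apply e d Y k b).1, (symplDiag_mul_apply e d Y k b).2]
  simp only [Matrix.transpose_apply]
  ring

theorem inv_symplDiag {K : Type*} [Field K] (e : ι × Fin 2 ≃ κ) (d : ι → K) (hd : ∀ k, d k ≠ 0) :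
    (symplDiag e d)⁻¹ = -symplDiag e fun k => 1 / d k := by
  refine Matrix.inv_eq_right_inv ?_
  rw [Matrix.mul_neg]
  refine Matrix.ext fun i j => ?_
  rw [Matrix.neg_apply]
  obtain ⟨⟨k, a⟩, rfl⟩ := e.surjective i
  obtain ⟨⟨l, b⟩, rfl⟩ := e.surjective j
  have hk := hd k
  by_cases hkl : k = l
  · subst hkl
    fin_cases a
    · refine (congrArg _ (symplDiag_mul_apply e d _ k _).1).trans ?_
      fin_cases b <;> simp [symplDiag, symplTwo, hk]
    · refine (congrArg _ (symplDiag_mul_apply e d _ k _).2).trans ?_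
      fin_cases b <;> simp [symplDiag, symplTwo, hk]
  · fin_cases a
    · refine (congrArg _ (symplDiag_mul_apply e d _ k _).1).trans ?_
      simp [symplDiag, hkl]
    · refine (congrArg _ (symplDiag_mul_apply e d _ k _).2).trans ?_
      simp [symplDiag, hkl]

/-- Reordering from pairs (point, component) to two blocks of points relates the quaternion layout
to the block matrices of `det_perturbed_skew`. -/
theorem det_one_add_weighted_pairs [Fintype α] [DecidableEq α] (u : α → R)
    (B : Matrix (α × Fin 2) (α × Fin 2) R) :
    (1 + Matrix.of fun x y => u x.1 * B x y).det =
      (1 + Matrix.fromBlocks (Matrix.diagonal u) 0 0 (Matrix.diagonal u) *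
        Matrix.fromBlocks (Matrix.of fun a b => B (a, 0) (b, 0)) (Matrix.of fun a b => B (a, 0) (b, 1))
          (Matrix.of fun a b => B (a, 1) (b, 0)) (Matrix.of fun a b => B (a, 1) (b, 1))).det := by
  let e : α ⊕ α ≃ α × Fin 2 :=
    { toFun := Sum.elim (fun a => (a, 0)) fun a => (a, 1)
      invFun := fun x => if x.2 = 0 then Sum.inl x.1 else Sum.inr x.1
      left_inv := by rintro (a | a) <;> simp
      right_inv := by
        rintro ⟨a, i⟩
        fin_cases i <;> simp }
  rw [← Matrix.det_submatrix_equiv_self e]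
  congr 1
  refine Matrix.ext fun x y => ?_
  rcases x with a | a <;> rcases y with b | b <;>
    simp [e, Matrix.one_apply, Matrix.diagonal_mul]

end SymplecticAlgebra

/-! ### Self-duality and the determinant of the skew products -/

section Kernel

open scoped NNReal

variable {M : ℕ} {t : Fin (M + 2) → ℝ}

/-- The real `2 × 2` matrix of the quaternion `q^{m,m'}(x, y)`. -/
noncomputable def kernelMatrix (N : ℕ) (t : Fin (M + 2) → ℝ) (m m' : Fin (M + 1)) (x y : ℝ) :
    Matrix (Fin 2) (Fin 2) ℝ :=
  !![kernelSTilde N t m m' x y, kernelITilde N t m m' x y;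
    kernelD N t m m' x y, kernelSTilde N t m' m y x]

theorem matrixRep_kernelQ (N : ℕ) (t : Fin (M + 2) → ℝ) (m m' : Fin (M + 1)) (x y : ℝ)
    (i j : Fin 2) : matrixRep (kernelQ N t m m' x y) i j = (kernelMatrix N t m m' x y i j : ℂ) := by
  rw [kernelQ, matrixRep_ofMatrix]
  fin_cases i <;> fin_cases j <;> rfl

theorem kernelD_swap (N : ℕ) (t : Fin (M + 2) → ℝ) (m m' : Fin (M + 1)) (x y : ℝ) :
    kernelD N t m' m y x = -kernelD N t m m' x y := by
  unfold kernelD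
  rw [← Finset.sum_neg_distrib]
  exact Finset.sum_congr rfl fun k _ => by ring

theorem kernelF_swap (t : Fin (M + 2) → ℝ) (m m' : Fin (M + 1)) (x y : ℝ) :
    kernelF t m' m y x = -kernelF t m m' x y := by
  unfold kernelF
  have h : ∀ (μ ν : Measure ℝ) [IsProbabilityMeasure μ] [IsProbabilityMeasure ν],
      (μ.prod ν).real {v | v.1 < v.2} = (ν.prod μ).real {v | v.2 < v.1} := by
    intro μ ν _ _
    rw [← Measure.prod_swap, Measure.real, Measure.real,
      Measure.map_apply measurable_swap (measurableSet_lt measurable_fst measurable_snd)]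
    rfl
  rw [h, h (heatMeasure (finalTime t - t m.succ) x)]
  ring

theorem kernelITilde_swap (N : ℕ) (t : Fin (M + 2) → ℝ) (m m' : Fin (M + 1)) (x y : ℝ) :
    kernelITilde N t m' m y x = -kernelITilde N t m m' x y := by
  unfold kernelITilde kernelI
  rw [kernelF_swap, neg_add, neg_neg, ← Finset.sum_neg_distrib]
  congr 1
  exact Finset.sum_congr rfl fun k _ => by ring

/-- In the matrix representation the dual exchanges the diagonal entries and negates the other two;
D and Ĩ are antisymmetric under exchange of their arguments. -/
theorem star_kernelQ (N : ℕ) (t : Fin (M + 2) → ℝ) (m m' : Fin (M + 1)) (x y : ℝ) :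
    star (kernelQ N t m' m y x) = kernelQ N t m m' x y := by
  rw [star_eq_dual]
  unfold kernelQ ofMatrix
  rw [kernelD_swap N t m m' x y, kernelITilde_swap N t m m' x y]
  ext <;> simp <;> ring

variable {α : Type*} [Fintype α] [DecidableEq α] {τ : α → Fin (M + 1)} {p : α → ℝ} {u : α → ℝ≥0}

variable (t τ p) in
/-- The matrix of the kernels at the points. -/
noncomputable def pointKernel (N : ℕ) : Matrix (α × Fin 2) (α × Fin 2) ℝ :=
  Matrix.of fun x y => kernelMatrix N t (τ x.1) (τ y.1) (p x.1) (p y.1) x.2 y.2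

variable (t τ p) in
/-- The solution `v` of `v = R + v U P`. -/
noncomputable def massMatrix (u : α → ℝ≥0) (N : ℕ) : Matrix (Fin N) α ℝ :=
  transRMatrix t τ p N * (1 - Matrix.diagonal (fun a => (u a : ℝ)) * heatMatrix t τ p)⁻¹

variable (t τ p) in
/-- The matrix of the skew products of the transported functions. -/
noncomputable def skewMatrix (u : α → ℝ≥0) (N : ℕ) : Matrix (Fin N) (Fin N) ℝ :=
  Matrix.of fun i j => ∫ q : ℝ × ℝ, massFn t τ p u (massMatrix t τ p u N) (Fin.last M) i q.1 *
    massFn t τ p u (massMatrix t τ p u N) (Fin.last M) j q.2 * signKernel q.1 q.2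
      ∂((pointMeasure τ p u (Fin.last M)).prod (pointMeasure τ p u (Fin.last M)))

theorem det_one_sub_heatMatrix (u : α → ℝ≥0) :
    (1 - Matrix.diagonal (fun a => (u a : ℝ)) * heatMatrix t τ p).det = 1 :=
  det_one_sub_mul_strictly_triangular τ _ _ fun a b h => by simp [heatMatrix, h]

theorem massMatrix_mul (u : α → ℝ≥0) (N : ℕ) :
    massMatrix t τ p u N * (1 - Matrix.diagonal (fun a => (u a : ℝ)) * heatMatrix t τ p) =
      transRMatrix t τ p N := by
  rw [massMatrix, Matrix.mul_assoc, Matrix.nonsing_inv_mul _ (by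
    rw [det_one_sub_heatMatrix]; exact isUnit_one), Matrix.mul_one]

theorem skewMatrix_eq (hM : 1 ≤ M) (ht₀ : t 0 = 0) (ht : StrictMono t) (u : α → ℝ≥0) (n : ℕ) :
    skewMatrix t τ p u (n * 2) =
      symplDiag (finProdFinEquiv : Fin n × Fin 2 ≃ Fin (n * 2)) (fun k => skewNorm t k) +
      transPhiMatrix t τ p (n * 2) * Matrix.diagonal (fun a => (u a : ℝ)) *
        (massMatrix t τ p u (n * 2)).transpose -
      massMatrix t τ p u (n * 2) * Matrix.diagonal (fun a => (u a : ℝ)) *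
        (transPhiMatrix t τ p (n * 2)).transpose +
      massMatrix t τ p u (n * 2) * Matrix.diagonal (fun a => (u a : ℝ)) * kernelFMatrix t τ p *
        Matrix.diagonal (fun a => (u a : ℝ)) * (massMatrix t τ p u (n * 2)).transpose := by
  refine Matrix.ext fun i j => ?_
  refine (integral_massFn_mul_massFn ht₀ ht (massMatrix_mul u (n * 2)) i j).trans ?_
  rw [Matrix.add_apply, Matrix.sub_apply, Matrix.add_apply, skewForm_finalFn hM ht₀ ht]
  congr 1
  · congr 1
    · congr 1
      rw [Matrix.mul_apply]
      simp only [Matrix.mul_diagonal, Matrix.transpose_apply]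
    · rw [Matrix.mul_apply]
      simp only [Matrix.mul_diagonal, Matrix.transpose_apply]
  · rw [Matrix.mul_apply, Finset.sum_comm]
    refine Finset.sum_congr rfl fun b _ => ?_
    rw [Matrix.mul_diagonal, Matrix.mul_apply, Finset.sum_mul, Finset.sum_mul]
    refine Finset.sum_congr rfl fun a _ => ?_
    rw [Matrix.mul_diagonal, Matrix.transpose_apply]

theorem skewMatrix_antisymm (u : α → ℝ≥0) (N : ℕ) (i j : Fin N) :
    skewMatrix t τ p u N j i = -skewMatrix t τ p u N i j := by
  simp only [skewMatrix, Matrix.of_apply]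
  rw [← integral_prod_swap, ← integral_neg]
  refine integral_congr_ae (Filter.Eventually.of_forall fun q => ?_)
  simp only [Prod.fst_swap, Prod.snd_swap]
  rw [signKernel_swap]
  ring

omit [Fintype α] [DecidableEq α] in
theorem kernels_eq_skew_products (hM : 1 ≤ M) (ht₀ : t 0 = 0) (ht : StrictMono t) (n : ℕ)
    (X Y : Matrix (Fin (n * 2)) α ℝ) (a b : α) :
    (X.transpose * (symplDiag (finProdFinEquiv : Fin n × Fin 2 ≃ Fin (n * 2))
      (fun k => skewNorm t k))⁻¹ * Y) a b =
      -∑ k : Fin n, 1 / skewNorm t k *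
        (X (finProdFinEquiv (k, 0)) a * Y (finProdFinEquiv (k, 1)) b -
          X (finProdFinEquiv (k, 1)) a * Y (finProdFinEquiv (k, 0)) b) := by
  rw [inv_symplDiag _ _ fun k : Fin n => (skewNorm_pos hM ht₀ ht k).ne', Matrix.mul_assoc, Matrix.neg_mul,
    Matrix.mul_neg, Matrix.neg_apply, transpose_mul_symplDiag_mul_apply]

/-- By `det_perturbed_skew`, the inverse of the unperturbed matrix produces the sums over k with
weights 1 / r_k; `P` and `F` supply the heat kernel in S̃ and the term F in Ĩ. -/
theorem det_skewMatrix (hM : 1 ≤ M) (ht₀ : t 0 = 0) (ht : StrictMono t) (u : α → ℝ≥0) (n : ℕ) :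
    (skewMatrix t τ p u (n * 2)).det = (∏ k : Fin n, skewNorm t k ^ 2) *
      (1 + Matrix.of fun x y => (u x.1 : ℝ) * pointKernel t τ p (n * 2) x y).det := by
  have hA : (symplDiag (finProdFinEquiv : Fin n × Fin 2 ≃ Fin (n * 2))
      (fun k => skewNorm t k)).det ≠ 0 := by
    rw [det_symplDiag]
    exact Finset.prod_ne_zero_iff.2 fun k _ => pow_ne_zero _ (skewNorm_pos hM ht₀ ht k).ne'
  rw [skewMatrix_eq hM ht₀ ht]
  refine (det_perturbed_skew _ hA (transRMatrix t τ p (n * 2)) _ _ _ (heatMatrix t τ p) _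
    (Matrix.diagonal_transpose _) (massMatrix_mul u _) (det_one_sub_heatMatrix u)).trans ?_
  rw [det_symplDiag, det_one_add_weighted_pairs fun a => (u a : ℝ)]
  have hv : ∀ (k : Fin n) (a : Fin 2),
      ((finProdFinEquiv (k, a) : Fin (n * 2)) : ℕ) = a + 2 * k := fun k a => rfl
  have hdiv : n * 2 / 2 = n := Nat.mul_div_cancel n (by norm_num)
  congr 3
  refine congrArg _ (Matrix.fromBlocks_inj.2 ⟨?_, ?_, ?_, ?_⟩)
  · refine Matrix.ext fun a b => ?_
    rw [Matrix.sub_apply, Matrix.neg_apply, kernels_eq_skew_products hM ht₀ ht]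
    simp [transPhiMatrix, transRMatrix, heatMatrix, hv, pointKernel, kernelMatrix, kernelSTilde,
      kernelS, hdiv, Finset.sum_range, add_comm]
  · refine Matrix.ext fun a b => ?_
    rw [Matrix.add_apply, kernels_eq_skew_products hM ht₀ ht]
    simp [transPhiMatrix, kernelFMatrix, hv, pointKernel, kernelMatrix, kernelITilde,
      kernelI, hdiv, Finset.sum_range, add_comm]
  · refine Matrix.ext fun a b => ?_
    rw [Matrix.neg_apply, kernels_eq_skew_products hM ht₀ ht]
    simp [transRMatrix, hv, pointKernel, kernelMatrix, kernelD, hdiv, Finset.sum_range, add_comm]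
  · refine Matrix.ext fun a b => ?_
    rw [Matrix.sub_apply, kernels_eq_skew_products hM ht₀ ht, ← Finset.sum_neg_distrib]
    simp only [transPhiMatrix, transRMatrix, heatMatrix, hv, pointKernel, kernelMatrix, kernelSTilde,
      kernelS, hdiv, Finset.sum_range, Matrix.transpose_apply, Matrix.of_apply]
    simp only [Matrix.cons_val_one, Matrix.cons_val_fin_one, Fin.val_zero, Fin.val_one, zero_add,
      add_comm 1]
    -- The lower right block is S̃ with its arguments exchanged; the exchange accounts for the minus
    -- sign of the inverse.
    congr 1
    exact Finset.sum_congr rfl fun k _ => by ring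

end Kernel

/-! ### The generating function of the correlation functions -/

section GeneratingFunction

open scoped NNReal

variable {M : ℕ} {t : Fin (M + 2) → ℝ}

theorem measurable_signPf {n : ℕ} : Measurable (signPf (n := n)) := by
  unfold signPf pfSum
  refine Finset.measurable_fun_sum _ fun σ _ =>
    (Finset.measurable_fun_prod _ fun k _ => ?_).const_mul _
  exact measurable_signKernel.comp (f := fun x : Fin (n * 2) → ℝ =>
    (x (σ (finProdFinEquiv (k, 0))), x (σ (finProdFinEquiv (k, 1)))))
    ((measurable_pi_apply _).prodMk (measurable_pi_apply _))

theorem abs_signPf_le {n : ℕ} (x : Fin (n * 2) → ℝ) : |signPf x| ≤ ((n * 2)! : ℝ) := by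
  unfold signPf pfSum
  refine (Finset.abs_sum_le_sum_abs _ _).trans ((Finset.sum_le_card_nsmul _ _ 1 fun σ _ => ?_).trans ?_)
  · have h1 : |((Equiv.Perm.sign σ : ℤ) : ℝ)| = 1 := by
      rcases Int.units_eq_one_or (Equiv.Perm.sign σ) with h | h <;> simp [h]
    rw [abs_mul, h1, one_mul, Finset.abs_prod]
    exact Finset.prod_le_one (fun _ _ => abs_nonneg _) fun k _ => abs_signKernel_le _ _
  · rw [Finset.card_univ, Fintype.card_perm, Fintype.card_fin, nsmul_eq_mul, mul_one]

section Points

variable {α : Type*} [Fintype α] [DecidableEq α] {τ : α → Fin (M + 1)} {p : α → ℝ} {u : α → ℝ≥0}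

omit [DecidableEq α] in
theorem massFn_zero {N : ℕ} (v : Matrix (Fin N) α ℝ) (j : Fin N) :
    massFn t τ p u v 0 j = initialFn t j := by
  funext y
  have h : ∀ a, ¬ τ a < 0 := fun a => not_lt.2 (Fin.zero_le _)
  simp only [massFn, h, if_false, Finset.sum_const_zero, add_zero]
  rw [transR_eq_heatOp, Fin.succ_zero_eq_one, sub_self, heatOp_zero]

omit [DecidableEq α] in
theorem pathWeight_eq_detChain {n : ℕ} (v : Matrix (Fin (n * 2)) α ℝ) :
    pathWeight (n := n) t = detChain (massFn t τ p u v 0)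
      (fun m : Fin M => heat (t m.succ.succ - t m.castSucc.succ)) signPf := by
  funext X
  simp only [pathWeight, detChain, massFn_zero]
  rfl

omit [DecidableEq α] in
theorem exists_heat_bounds (ht : StrictMono t) (τ : α → Fin (M + 1)) (p : α → ℝ) (u : α → ℝ≥0) :
    ∃ b d : ℝ, (∀ (m : Fin M) x y, |heat (t m.succ.succ - t m.castSucc.succ) x y| ≤ d) ∧
      (∀ (m : Fin M) x, Integrable (heat (t m.succ.succ - t m.castSucc.succ) x)
        (pointMeasure τ p u m.succ)) ∧
      ∀ (m : Fin M) x, ∫ y, |heat (t m.succ.succ - t m.castSucc.succ) x y|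
        ∂pointMeasure τ p u m.succ ≤ b := by
  have hs : ∀ m : Fin M, 0 < t m.succ.succ - t m.castSucc.succ := fun m =>
    time_sub_pos ht Fin.castSucc_lt_succ
  set d : ℝ := ∑ m : Fin M, 1 / Real.sqrt (2 * Real.pi * (t m.succ.succ - t m.castSucc.succ)) with hd
  have hle : ∀ (m : Fin M) x y, heat (t m.succ.succ - t m.castSucc.succ) x y ≤ d := fun m x y =>
    (heat_le (hs m) x y).trans (Finset.single_le_sum
      (f := fun m : Fin M => 1 / Real.sqrt (2 * Real.pi * (t m.succ.succ - t m.castSucc.succ)))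
      (fun m _ => by positivity) (Finset.mem_univ m))
  refine ⟨1 + ∑ a, (u a : ℝ) * d, d, fun m x y => ?_, fun m x => ?_, fun m x => ?_⟩
  · rw [abs_of_nonneg (heat_nonneg _ _ _)]
    exact hle m x y
  · exact integrable_pointMeasure (integrable_heat (hs m) x) _
  · simp only [abs_of_nonneg (heat_nonneg _ _ _)]
    rw [integral_pointMeasure (integrable_heat (hs m) x), integral_heat (hs m)]
    refine add_le_add le_rfl (Finset.sum_le_sum fun a _ => ?_)
    split_ifs
    · exact mul_le_mul_of_nonneg_left (hle m _ _) (u a).2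
    · exact mul_nonneg (u a).2 ((heat_nonneg _ _ _).trans (hle m x (p a)))

theorem integrable_pathWeight (ht₀ : t 0 = 0) (ht : StrictMono t) (n : ℕ) :
    Integrable (pathWeight (n := n) t)
      (Measure.pi fun m => Measure.pi fun _ : Fin (n * 2) => pointMeasure τ p u m) := by
  obtain ⟨b, d, h1, h2, h3⟩ := exists_heat_bounds ht τ p u
  rw [pathWeight_eq_detChain (τ := τ) (p := p) (u := u) (massMatrix t τ p u (n * 2))]
  exact integrable_detChain _ (measurable_massFn ht _ 0)
    (fun j => integrable_pointMeasure (integrable_massFn ht₀ ht _ 0 j) 0)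
    (fun m => measurable_heat _) h2 h3 measurable_signPf abs_signPf_le

/-- The M steps of Andréief's identity and the final de Bruijn identity contribute one factorial
each. -/
theorem integral_pathWeight (ht₀ : t 0 = 0) (ht : StrictMono t) (n : ℕ) :
    ∫ X, pathWeight (n := n) t X
      ∂(Measure.pi fun m => Measure.pi fun _ : Fin (n * 2) => pointMeasure τ p u m) =
      ((n * 2)! : ℝ) ^ (M + 1) * pfSum (finProdFinEquiv : Fin n × Fin 2 ≃ Fin (n * 2))
        (skewMatrix t τ p u (n * 2)) := by
  obtain ⟨b, d, h1, h2, h3⟩ := exists_heat_bounds ht τ p u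
  rw [pathWeight_eq_detChain (τ := τ) (p := p) (u := u) (massMatrix t τ p u (n * 2))]
  refine (integral_detChain measurable_signPf abs_signPf_le _ _ _ (measurable_massFn ht _)
    (fun m j => integrable_pointMeasure (integrable_massFn ht₀ ht _ m j) m)
    (fun m => measurable_heat _) h2 h3 h1 (massFn_succ ht₀ ht (massMatrix_mul u _))).trans ?_
  have := integral_det_mul_pfSum (pointMeasure τ p u (Fin.last M))
    (finProdFinEquiv : Fin n × Fin 2 ≃ Fin (n * 2))
    (q := massFn t τ p u (massMatrix t τ p u (n * 2)) (Fin.last M))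
    (fun j => integrable_pointMeasure (integrable_massFn ht₀ ht _ _ j) _)
    measurable_signKernel abs_signKernel_le
  rw [Fintype.card_fin] at this ⊢
  rw [pow_succ, mul_assoc]
  exact congrArg _ this

theorem skewMatrix_zero (hM : 1 ≤ M) (ht₀ : t 0 = 0) (ht : StrictMono t) (n : ℕ) :
    skewMatrix t τ p 0 (n * 2) =
      symplDiag (finProdFinEquiv : Fin n × Fin 2 ≃ Fin (n * 2)) (fun k => skewNorm t k) := by
  rw [skewMatrix_eq hM ht₀ ht]
  have : (Matrix.diagonal fun a => (((0 : α → ℝ≥0) a : ℝ≥0) : ℝ)) = 0 := by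
    simp
  rw [this]
  simp

end Points

variable {n : Fin (M + 1) → ℕ} (x : (m : Fin (M + 1)) → Fin (n m) → ℝ)

/-- The time of the `a`-th point. -/
def siteOf (a : Fin (∑ m, n m)) : Fin (M + 1) := (finSigmaFinEquiv.symm a).1

/-- The `a`-th point. -/
def pointOf (a : Fin (∑ m, n m)) : ℝ := x _ (finSigmaFinEquiv.symm a).2

theorem pointOf_apply (m : Fin (M + 1)) (i : Fin (n m)) :
    pointOf x (finSigmaFinEquiv ⟨m, i⟩) = x m i := by
  unfold pointOf
  rw [Equiv.symm_apply_apply]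

theorem mixture_eq_pointMeasure (u : Fin (∑ m, n m) → ℝ≥0) (m : Fin (M + 1)) :
    mixture x u m = pointMeasure siteOf (pointOf x) u m := by
  unfold mixture pointMeasure
  rw [Fintype.sum_option, ← finSigmaFinEquiv.sum_comp, Fintype.sum_sigma, Finset.sum_eq_single m]
  · simp [choiceWeight, pointOrVolume, siteOf, pointOf_apply]
  · intro m' _ hm'
    refine Finset.sum_eq_zero fun i _ => ?_
    simp [siteOf, hm']
  · simp

/-- The normalized generating function of the correlation functions. -/
noncomputable def correlationPoly (N : ℕ) (t : Fin (M + 2) → ℝ) : MvPolynomial (Fin (∑ m, n m)) ℝ :=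
  MvPolynomial.C (((N ! : ℝ) ^ (M + 1))⁻¹) *
    mixturePoly x fun X : Fin (M + 1) → Fin N → ℝ => multitimeDensity N t fun m => config (X m)

theorem integrable_multitimeDensity (hM : 1 ≤ M) (ht₀ : t 0 = 0) (ht : StrictMono t) (N : ℕ) :
    Integrable (fun X : Fin (M + 1) → Fin (N * 2) → ℝ =>
        multitimeDensity (N * 2) t fun m => config (X m))
      (Measure.pi fun m => Measure.pi fun _ : Fin (N * 2) => mixture x (fun _ => 1) m) := by
  simp only [multitimeDensity_config hM ht₀ ht, mixture_eq_pointMeasure]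
  exact (integrable_pathWeight ht₀ ht N).const_mul _

theorem eval_correlationPoly (hM : 1 ≤ M) (ht₀ : t 0 = 0) (ht : StrictMono t) (N : ℕ)
    (u : Fin (∑ m, n m) → ℝ≥0) :
    MvPolynomial.eval (fun a => (u a : ℝ)) (correlationPoly x (N * 2) t) =
      originConst (N * 2) (finalTime t) (t 1) / (2 ^ N * N !) *
        pfSum (finProdFinEquiv : Fin N × Fin 2 ≃ Fin (N * 2))
          (skewMatrix t siteOf (pointOf x) u (N * 2)) := by
  rw [correlationPoly, map_mul, MvPolynomial.eval_C,
    eval_mixturePoly (integrable_multitimeDensity x hM ht₀ ht N)]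
  simp only [multitimeDensity_config hM ht₀ ht, mixture_eq_pointMeasure]
  rw [integral_const_mul, integral_pathWeight ht₀ ht]
  have : ((N * 2)! : ℝ) ≠ 0 := by exact_mod_cast Nat.factorial_ne_zero _
  field_simp

/-- Without masses the Pfaffian is the product of the norms r_k, which the constant of the density
cancels. The total mass of the density is thereby computed, not assumed. -/
theorem coeff_zero_correlationPoly (hM : 1 ≤ M) (ht₀ : t 0 = 0) (ht : StrictMono t) (N : ℕ) :
    MvPolynomial.coeff 0 (correlationPoly x (N * 2) t) = 1 := by
  have h := eval_correlationPoly x hM ht₀ ht N 0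
  rw [skewMatrix_zero hM ht₀ ht, pfSum_symplDiag, Fintype.card_fin] at h
  have h1 := originConst_mul_prod_skewNorm hM ht₀ ht N
  have h2 : (fun a : Fin (∑ m, n m) => (((0 : Fin (∑ m, n m) → ℝ≥0) a : ℝ≥0) : ℝ)) = 0 := by
    funext a
    simp
  rw [h2] at h
  have h3 : (N ! : ℝ) ≠ 0 := by exact_mod_cast Nat.factorial_ne_zero _
  rw [← MvPolynomial.constantCoeff_eq, ← MvPolynomial.eval_zero, h, ← h1]
  field_simp

theorem correlationPoly_sq (hM : 1 ≤ M) (ht₀ : t 0 = 0) (ht : StrictMono t) (N : ℕ) :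
    correlationPoly x (N * 2) t ^ 2 = Matrix.det (1 + Matrix.of fun a b =>
      (MvPolynomial.X a.1 * MvPolynomial.C (pointKernel t siteOf (pointOf x) (N * 2) a b) :
        MvPolynomial (Fin (∑ m, n m)) ℝ)) := by
  set E : MvPolynomial (Fin (∑ m, n m)) ℝ := Matrix.det (1 + Matrix.of fun a b =>
      (MvPolynomial.X a.1 * MvPolynomial.C (pointKernel t siteOf (pointOf x) (N * 2) a b) :
        MvPolynomial (Fin (∑ m, n m)) ℝ)) with hE
  have hev : ∀ w : Fin (∑ m, n m) → ℝ, MvPolynomial.eval w E = (1 + Matrix.of fun a b =>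
      w a.1 * pointKernel t siteOf (pointOf x) (N * 2) a b).det := by
    intro w
    rw [hE, RingHom.map_det]
    congr 1
    refine Matrix.ext fun a b => ?_
    simp [Matrix.one_apply, apply_ite]
  have hE0 : E ≠ 0 := by
    intro h0
    have h1 := hev 0
    have h2 : (Matrix.of fun a b : Fin (∑ m, n m) × Fin 2 =>
        (0 : Fin (∑ m, n m) → ℝ) a.1 * pointKernel t siteOf (pointOf x) (N * 2) a b) = 0 := by
      ext a b
      simp
    rw [h0, h2] at h1
    simp at h1
  -- Multiplication by `E` settles the masses at which it vanishes; `pfSum_sq` is applicable only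
  -- where the skew determinant is nonzero.
  refine mul_right_cancel₀ hE0 ?_
  -- The values at nonnegative masses, the only ones with a measure behind them, determine the
  -- polynomials.
  refine MvPolynomial.funext_set (fun _ => Set.Ici (0 : ℝ)) (fun _ => Set.Ici_infinite _)
    fun w hw => ?_
  obtain ⟨u, rfl⟩ : ∃ u : Fin (∑ m, n m) → ℝ≥0, w = fun a => (u a : ℝ) :=
    ⟨fun a => ⟨w a, hw a trivial⟩, rfl⟩
  rw [map_mul, map_mul, map_pow, eval_correlationPoly x hM ht₀ ht]
  have hdet := det_skewMatrix (τ := siteOf) (p := pointOf x) hM ht₀ ht u N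
  rw [← hev fun a => (u a : ℝ)] at hdet
  by_cases h0 : MvPolynomial.eval (fun a => (u a : ℝ)) E = 0
  · rw [h0, mul_zero, mul_zero]
  · have hprod : ∏ k : Fin N, skewNorm t k ^ 2 ≠ 0 :=
      Finset.prod_ne_zero_iff.2 fun k _ => pow_ne_zero _ (skewNorm_pos hM ht₀ ht k).ne'
    have hpf := pfSum_sq (finProdFinEquiv : Fin N × Fin 2 ≃ Fin (N * 2))
      (skewMatrix t siteOf (pointOf x) u (N * 2)) (skewMatrix_antisymm u _)
      (by rw [hdet]; exact mul_ne_zero hprod h0)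
    have h1 := originConst_mul_prod_skewNorm hM ht₀ ht N
    have h3 : (N ! : ℝ) ≠ 0 := by exact_mod_cast Nat.factorial_ne_zero _
    rw [mul_pow, hpf, hdet, Finset.prod_pow]
    congr 1
    have h4 : (originConst (N * 2) (finalTime t) (t 1) * ∏ k : Fin N, skewNorm t k) ^ 2 = 1 := by
      rw [h1, one_pow]
    rw [mul_pow] at h4
    rw [div_pow]
    field_simp
    linear_combination h4

/-- At each time the normalization 1/N! and the number N!/(N - n_m)! of exact choices combine to the
prefactor 1/(N - n_m)!, with N standing for the number of particles `N * 2`. -/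
theorem correlation_eq_coeff (hM : 1 ≤ M) (ht₀ : t 0 = 0) (ht : StrictMono t) {N : ℕ}
    (hn : ∀ m, n m ≤ N * 2) :
    Integrable (correlationIntegrand (N * 2) t n x) ∧
      correlation (N * 2) t n x =
        MvPolynomial.coeff (onesExp (Fin (∑ m, n m))) (correlationPoly x (N * 2) t) := by
  obtain ⟨h1, h2⟩ := coeff_ones_mixturePoly (G := fun ξ => multitimeDensity (N * 2) t ξ) hn
    (integrable_multitimeDensity x hM ht₀ ht N)
  refine ⟨h1.const_mul _, ?_⟩
  rw [correlationPoly, MvPolynomial.coeff_C_mul, h2, ← mul_assoc]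
  unfold correlation correlationIntegrand
  rw [integral_const_mul]
  congr 1
  have h3 : ((N * 2)! : ℝ) ^ (M + 1) = ∏ _m : Fin (M + 1), ((N * 2)! : ℝ) := by simp
  rw [h3, ← Finset.prod_inv_distrib, ← Finset.prod_mul_distrib]
  refine Finset.prod_congr rfl fun m _ => ?_
  have h4 : ((N * 2 - n m)! : ℝ) * (N * 2).descFactorial (n m) = (N * 2)! := by
    exact_mod_cast Nat.factorial_mul_descFactorial (hn m)
  have h5 : ((N * 2 - n m)! : ℝ) ≠ 0 := by exact_mod_cast Nat.factorial_ne_zero _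
  have h6 : ((N * 2)! : ℝ) ≠ 0 := by exact_mod_cast Nat.factorial_ne_zero _
  rw [← h4] at h6 ⊢
  have h7 := right_ne_zero_of_mul h6
  field_simp

theorem quaternionMatrix_isSelfDual (N : ℕ) : IsSelfDual (quaternionMatrix N t n x) :=
  fun _ _ => star_kernelQ N t _ _ _ _

theorem matrixRep_quaternionMatrix (N : ℕ) (a b : Fin (∑ m, n m)) (i j : Fin 2) :
    matrixRep (quaternionMatrix N t n x a b) i j =
      (pointKernel t siteOf (pointOf x) N (a, i) (b, j) : ℂ) :=
  matrixRep_kernelQ N t _ _ _ _ i j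

theorem correlation_eq_Tdet (hM : 1 ≤ M) (ht₀ : t 0 = 0) (ht : StrictMono t) {N : ℕ}
    (hn : ∀ m, n m ≤ N * 2) :
    ((correlation (N * 2) t n x : ℂ) : ℍ[ℂ]) = Tdet (quaternionMatrix (N * 2) t n x) := by
  rw [Tdet_eq_sum_labellings (quaternionMatrix_isSelfDual x (N * 2)),
    (correlation_eq_coeff x hM ht₀ ht hn).2,
    coeff_ones_of_sq_eq_det _ _ (coeff_zero_correlationPoly x hM ht₀ ht N)
      (correlationPoly_sq x hM ht₀ ht N)]
  congr 1
  push_cast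
  simp only [matrixRep_quaternionMatrix]

end GeneratingFunction
theorem theorem3 (N M : ℕ) (hN : Even N) (hM : 1 ≤ M)
    (t : Fin (M + 2) → ℝ) (ht₀ : t 0 = 0) (ht : StrictMono t)
    (n : Fin (M + 1) → ℕ) (hn : ∀ m, 1 ≤ n m ∧ n m ≤ N)
    (x : (m : Fin (M + 1)) → Fin (n m) → ℝ) (hx : ∀ m, StrictMono (x m)) :
    IsSelfDual (quaternionMatrix N t n x) ∧
      Integrable (correlationIntegrand N t n x) ∧
      ((correlation N t n x : ℂ) : ℍ[ℂ]) = Tdet (quaternionMatrix N t n x) := by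
  obtain ⟨r, rfl⟩ := hN
  -- In the form `r * 2` the indices split into consecutive pairs by `finProdFinEquiv`.
  rw [← mul_two] at hn ⊢
  exact ⟨quaternionMatrix_isSelfDual x _, (correlation_eq_coeff x hM ht₀ ht fun m => (hn m).2).1,
    correlation_eq_Tdet x hM ht₀ ht fun m => (hn m).2⟩
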